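/- Let $K$ be a finite field extension of $\mathbb{Q}_2$. Let $q$ be the cardinality of its residue field, $e_K = e(K/\mathbb{Q}_2)$ its absolute ramification index, and $v_K$ its valuation, normalised so that a uniformiser has valuation $1$. For a finite extension $L/K$ let $d_{L/K}$ be its discriminant ideal, and let the Galois closure group of $L/K$ be $\mathrm{Gal}(\widetilde{L}/K)$, where $\widetilde{L}$ is the normal closure of $L$ over $K$. For a non-negative integer $m$, let $\Sigma_m^{V_4}$ be the set of isomorphism classes of totally ramified quartic field extensions $L/K$ with $v_K(d_{L/K}) = m$ whose Galois closure group is isomorphic to the Klein four-group $V_4 = C_2 \times C_2$. If $\Sigma_m^{V_4}$ is nonempty, then $m$ is an even integer with $6 \leq m \leq 6e_K + 2$. For all even integers $m$ with $6 \leq m \leq 6e_K+2$, the set $\Sigma_m^{V_4}$ is finite and $$ \#\Sigma_{m}^{V_4} = 2(q-1)q^{\frac{m-4}{2}}\Big( q^{-\lfloor \frac{m}{6}\rfloor}\Big(1 + \mathbb{1}_{3 \mid m}\cdot \frac{q-2}{3}\Big) - \mathbb{1}_{m\leq 4e_K + 2}\cdot q^{-\lfloor\frac{m-2}{4}\rfloor}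 \Big), $$ where $\mathbb{1}_P$ is $1$ if the condition $P$ holds and $0$ otherwise. -/

import Mathlib

namespace TwoAdic

/-! A `2`-adic field is a field `F` that is a finite extension of `ℚ₂`. The classes
`[Algebra ℤ_[2] F] [IsScalarTower ℤ_[2] ℚ_[2] F]` below carry no extra data or hypothesis: they only
name the restriction of `ℚ₂ → F` to `ℤ₂`. -/

open IsLocalRing

/-- The ring of integers `𝒪_F` of a `2`-adic field `F`: the integral closure of `ℤ₂` in `F`. -/
noncomputable abbrev ringOfIntegers (F : Type*) [Field F] [Algebra ℤ_[2] F] : Subalgebra ℤ_[2] F :=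
  integralClosure ℤ_[2] F

section IsLocal

variable {F : Type*} [Field F] [Algebra ℚ_[2] F] [Algebra ℤ_[2] F] [IsScalarTower ℤ_[2] ℚ_[2] F]

theorem isIntegral_iff_spectralNorm_le_one [Algebra.IsAlgebraic ℚ_[2] F] (x : F) :
    IsIntegral ℤ_[2] x ↔ spectralNorm ℚ_[2] F x ≤ 1 := by
  have hx : IsIntegral ℚ_[2] x := Algebra.IsIntegral.isIntegral x
  rw [spectralNorm, spectralValue_le_one_iff (minpoly.monic hx)]
  constructor
  · intro h n
    rw [minpoly.isIntegrallyClosed_eq_field_fractions' ℚ_[2] h, Polynomial.coeff_map]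
    exact PadicInt.norm_le_one _
  · intro h
    have hl : minpoly ℚ_[2] x ∈ Polynomial.lifts (algebraMap ℤ_[2] ℚ_[2]) := by
      rw [Polynomial.lifts_iff_coeff_lifts]
      exact fun n => ⟨⟨_, h n⟩, rfl⟩
    obtain ⟨p, hp, -, hmonic⟩ := Polynomial.lifts_and_natDegree_eq_and_monic hl (minpoly.monic hx)
    refine ⟨p, hmonic, ?_⟩
    have := minpoly.aeval ℚ_[2] x
    rw [← hp, Polynomial.aeval_map_algebraMap] at this
    exact this

/-- The ring of integers is a local ring. -/
instance isLocalRing_ringOfIntegers [Algebra.IsAlgebraic ℚ_[2] F] :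
    IsLocalRing (ringOfIntegers F) := by
  have hunit : ∀ x : ringOfIntegers F, ¬ IsUnit x → spectralNorm ℚ_[2] F (x : F) < 1 := by
    intro x hx
    have hle := (isIntegral_iff_spectralNorm_le_one (x : F)).1 x.2
    refine lt_of_le_of_ne hle fun h1 => hx ?_
    have hx0 : (x : F) ≠ 0 := by
      intro h0
      rw [h0, spectralNorm_zero] at h1
      exact zero_ne_one h1
    have hmul : spectralNorm ℚ_[2] F ((x : F) * (x : F)⁻¹) =
        spectralNorm ℚ_[2] F (x : F) * spectralNorm ℚ_[2] F (x : F)⁻¹ :=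
      map_mul (spectralMulAlgNorm ℚ_[2] F) _ _
    rw [mul_inv_cancel₀ hx0, spectralNorm_one, h1, one_mul] at hmul
    refine IsUnit.of_mul_eq_one
      ⟨(x : F)⁻¹, (isIntegral_iff_spectralNorm_le_one _).2 hmul.ge⟩ ?_
    exact Subtype.ext (mul_inv_cancel₀ hx0)
  refine IsLocalRing.of_nonunits_add fun a b ha hb hab => ?_
  have h1 := (isNonarchimedean_spectralNorm (K := ℚ_[2]) (L := F)) (a : F) (b : F)
  have h2 : spectralNorm ℚ_[2] F ((a + b : ringOfIntegers F) : F) < 1 :=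
    lt_of_le_of_lt h1 (max_lt (hunit a ha) (hunit b hb))
  obtain ⟨c, hc⟩ := hab.exists_right_inv
  have hc' : ((a + b : ringOfIntegers F) : F) * (c : F) = 1 := congrArg Subtype.val hc
  have hmul : spectralNorm ℚ_[2] F (((a + b : ringOfIntegers F) : F) * (c : F)) =
      spectralNorm ℚ_[2] F ((a + b : ringOfIntegers F) : F) * spectralNorm ℚ_[2] F (c : F) :=
    map_mul (spectralMulAlgNorm ℚ_[2] F) _ _
  rw [hc', spectralNorm_one] at hmul
  have h3 := (isIntegral_iff_spectralNorm_le_one (c : F)).1 c.2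
  have h4 := spectralNorm_nonneg (K := ℚ_[2]) ((a + b : ringOfIntegers F) : F)
  nlinarith

end IsLocal

section Invariants

variable (F : Type*) [Field F] [Algebra ℚ_[2] F] [Algebra ℤ_[2] F] [IsScalarTower ℤ_[2] ℚ_[2] F]
  [Algebra.IsAlgebraic ℚ_[2] F]

/-- `q_F`, the cardinality of the residue field of `F`. -/
noncomputable def residueCard : ℕ := Nat.card (ResidueField (ringOfIntegers F))

/-- `e_F = e(F/ℚ₂)`, the absolute ramification index of `F`. -/
noncomputable def absRamificationIdx : ℕ :=
  (maximalIdeal (ringOfIntegers F)).ramificationIdx ℤ_[2]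

end Invariants

section Extension

variable (K L : Type*) [Field K] [Algebra ℚ_[2] K] [Algebra ℤ_[2] K] [IsScalarTower ℤ_[2] ℚ_[2] K]
  [Field L] [Algebra ℚ_[2] L] [Algebra ℤ_[2] L] [IsScalarTower ℤ_[2] ℚ_[2] L]
  [Algebra K L] [IsScalarTower ℤ_[2] K L]

/-- `𝒪_L` is an `𝒪_K`-algebra through the restriction of `K → L`. -/
noncomputable instance algebraRingOfIntegers : Algebra (ringOfIntegers K) (ringOfIntegers L) :=
  ((IsScalarTower.toAlgHom ℤ_[2] K L).mapIntegralClosure).toRingHom.toAlgebra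

/-- `L/K` is totally ramified: its ramification index `e(L/K)` equals its degree. -/
def IsTotallyRamified [Algebra.IsAlgebraic ℚ_[2] L] : Prop :=
  (maximalIdeal (ringOfIntegers L)).ramificationIdx (ringOfIntegers K) = Module.finrank K L

/-- The discriminant ideal `d_{L/K}`: the ideal of `𝒪_K` generated by the discriminants of the
`K`-bases of `L` that consist of integral elements. -/
noncomputable def discrIdeal : Ideal (ringOfIntegers K) :=
  Ideal.span {d | ∃ b : Module.Basis (Fin (Module.finrank K L)) K L,
    (∀ i, b i ∈ ringOfIntegers L) ∧ algebraMap (ringOfIntegers K) K d = Algebra.discr K b}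

/-- `v_K(d_{L/K})`, the exponent of the maximal ideal `𝔭_K` in the discriminant ideal. -/
noncomputable def discrValuation [Algebra.IsAlgebraic ℚ_[2] K] : ℕ∞ :=
  emultiplicity (maximalIdeal (ringOfIntegers K)) (discrIdeal K L)

end Extension

section Sigma

open IntermediateField

variable (K : Type*) [Field K] [Algebra ℚ_[2] K] [Algebra ℤ_[2] K] [IsScalarTower ℤ_[2] ℚ_[2] K]
  [Algebra.IsAlgebraic ℚ_[2] K]

instance isScalarTower_intermediateField (L : IntermediateField K (AlgebraicClosure K)) :
    IsScalarTower ℤ_[2] ℚ_[2] L := by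
  refine IsScalarTower.of_algebraMap_eq fun x => ?_
  rw [IsScalarTower.algebraMap_apply ℤ_[2] K L, IsScalarTower.algebraMap_apply ℚ_[2] K L,
    ← IsScalarTower.algebraMap_apply ℤ_[2] ℚ_[2] K]

/-- An extension of `K` inside its algebraic closure is algebraic over `ℚ₂`. -/
instance isAlgebraic_intermediateField (L : IntermediateField K (AlgebraicClosure K)) :
    Algebra.IsAlgebraic ℚ_[2] L :=
  Algebra.IsAlgebraic.trans ℚ_[2] K L

/-- Two extensions of `K` inside the algebraic closure are equivalent if they are isomorphic
over `K`. -/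
def extensionSetoid : Setoid (IntermediateField K (AlgebraicClosure K)) where
  r L L' := Nonempty (L ≃ₐ[K] L')
  iseqv :=
    { refl := fun _ => ⟨AlgEquiv.refl⟩
      symm := fun ⟨e⟩ => ⟨e.symm⟩
      trans := fun ⟨e⟩ ⟨e'⟩ => ⟨e.trans e'⟩ }

/-- `L/K` is a totally ramified quartic extension with `v_K(d_{L/K}) = m` whose Galois closure
group, the Galois group of the normal closure of `L` over `K`, is isomorphic to `G`. -/
structure IsSigmaExtension (G : Type*) [Group G] (m : ℕ)
    (L : IntermediateField K (AlgebraicClosure K)) : Prop where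
  finrank_eq : Module.finrank K L = 4
  isTotallyRamified : IsTotallyRamified K L
  discrValuation_eq : discrValuation K L = m
  galoisClosureGroup : Nonempty (Gal(normalClosure K L (AlgebraicClosure K)/K) ≃* G)

/-- The set `Σ_m^G` of isomorphism classes of totally ramified quartic extensions `L/K` with
`v_K(d_{L/K}) = m` and Galois closure group isomorphic to `G`. -/
def SigmaSet (G : Type*) [Group G] (m : ℕ) : Set (Quotient (extensionSetoid K)) :=
  Quotient.mk (extensionSetoid K) '' {L | IsSigmaExtension K G m L}

end Sigma

/-- The Klein four-group `V₄ = C₂ × C₂`. -/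
abbrev V4 : Type := Multiplicative (ZMod 2) × Multiplicative (ZMod 2)

end TwoAdic

/-! By Kummer theory the `V₄`-extensions of `K` are the fields `K(√a, √b)` attached to the subgroups
`{1, a, b, ab}` of order four in the group `Kˣ/Kˣ²` of square classes. Such a field is normal, so it
is the only subfield of the algebraic closure in its isomorphism class. The theorem is therefore a
weighted count of subgroups.

Square classes are filtered by a depth between `0` and `e + 1`. Depth `0` means represented in `1 +
4𝒪`; depth `1 ≤ j ≤ e` means represented by a unit at distance exactly `2(e - j) + 1` from `1`,
measured in powers of the uniformiser; depth `e + 1` means odd valuation. In positive depth the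
square root is ramified, and the discriminant exponent is `2j`, or `2e + 1` at the top
(`exists_uniformizer_of_depth`). Each step of the filtration below the top has index `q`
(`relIndex_level_succ`), and the bottom is an Artin–Schreier quotient of order two
(`relIndex_square_level`). So `2q^j` classes have depth at most `j ≤ e`, out of `4q^e` in all.

The field `K(√a, √b)` is totally ramified exactly when `a`, `b` and `ab` all have positive depth
(`isSquare_of_mem_level`, `exists_quartic_uniformizer`). Its discriminant exponent is then the sum
of the three quadratic ones (`IsBiquadratic.abv_discr`).

Depth satisfies an ultrametric inequality, so among the depths of `a`, `b`, `ab` the two largest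
agree. Either one is strictly smaller than the other two, which gives a telescoping geometric sum
(`sum_lt_pairs`), or all three agree, which requires `3 ∣ m` and gives the term with `q - 2`
(`sum_eq_pairs`). Each subgroup has six ordered generating pairs (`card_eq_six_mul_card_image`).

All sizes are measured by one Galois-invariant absolute value on the algebraic closure. The
hypotheses `IsDyadic` hold for `K` and pass to `K(√a)` when `a` has positive depth, so results on
quadratic extensions can be applied twice in a tower. -/

namespace TwoAdic

open IsLocalRing

/-! ### Ultrametric absolute values -/

section Ultrametric

variable {F : Type*} [Field F] {v : AbsoluteValue F ℝ}

theorem abv_sub_le (hv : IsNonarchimedean v) (x y : F) : v (x - y) ≤ max (v x) (v y) := by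
  have h := hv x (-y)
  rwa [← sub_eq_add_neg, v.map_neg] at h

theorem abv_eq_of_sub_lt (hv : IsNonarchimedean v) {x y : F} (h : v (x - y) < v y) :
    v x = v y := by
  apply le_antisymm
  · have h1 := hv (x - y) y
    rw [sub_add_cancel] at h1
    exact h1.trans (max_le h.le le_rfl)
  · have h1 := abv_sub_le hv x (x - y)
    rw [sub_sub_cancel] at h1
    rcases le_max_iff.1 h1 with h2 | h2
    · exact h2
    · exact absurd h2 (not_le.2 h)

theorem abv_one_add (hv : IsNonarchimedean v) {x : F} (h : v x < 1) : v (1 + x) = 1 := by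
  have h1 : v ((1 + x) - 1) < v 1 := by simpa using h
  simpa using abv_eq_of_sub_lt hv h1

/-- If `γ (γ + 2)` is larger than `4`, then `γ` dominates `2`. -/
theorem abv_sq_eq_of_two_sq_lt (hv : IsNonarchimedean v) {γ : F}
    (h : v 2 ^ 2 < v (γ * (γ + 2))) : v γ ^ 2 = v (γ * (γ + 2)) := by
  rw [map_mul] at h ⊢
  have h2 := v.nonneg (2 : F)
  rcases le_or_gt (v γ) (v 2) with hle | hlt
  · have h1 : v (γ + 2) ≤ v 2 := (hv γ 2).trans (max_le hle le_rfl)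
    nlinarith [v.nonneg γ]
  · have h1 : v (γ + 2) = v γ := abv_eq_of_sub_lt hv (by simpa using hlt)
    rw [h1, sq]

end Ultrametric

/-- A discretely valued field of residue characteristic two with perfect residue field, absolute
ramification index `e` and uniformiser `π`, in which every element of `1 + 4𝔭` is a square. -/
structure IsDyadic {F : Type*} [Field F] (v : AbsoluteValue F ℝ) (π : F) (e : ℕ) : Prop where
  nonarch : IsNonarchimedean v
  ne_zero : π ≠ 0
  lt_one : v π < 1
  discrete : ∀ x ≠ 0, ∃ n : ℤ, v x = v π ^ n
  two : v 2 = v π ^ e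
  pos : 0 < e
  perfect : ∀ x, v x ≤ 1 → ∃ y, v (y ^ 2 - x) < 1
  hensel : ∀ c, v c < 1 → IsSquare (1 + 4 * c)

/-! ### Units modulo squares, filtered by distance from 1 -/

namespace IsDyadic

variable {F : Type*} [Field F] {v : AbsoluteValue F ℝ} {π : F} {e : ℕ} (h : IsDyadic v π e)
include h

theorem abv_pos : 0 < v π := v.pos h.ne_zero

theorem zpow_le_iff {m n : ℤ} : v π ^ m ≤ v π ^ n ↔ n ≤ m :=
  zpow_le_zpow_iff_right_of_lt_one₀ h.abv_pos h.lt_one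

theorem zpow_lt_iff {m n : ℤ} : v π ^ m < v π ^ n ↔ n < m :=
  zpow_lt_zpow_iff_right_of_lt_one₀ h.abv_pos h.lt_one

theorem zpow_inj {m n : ℤ} (hmn : v π ^ m = v π ^ n) : m = n :=
  le_antisymm (h.zpow_le_iff.1 hmn.ge) (h.zpow_le_iff.1 hmn.le)

theorem pow_le_iff {m n : ℕ} : v π ^ m ≤ v π ^ n ↔ n ≤ m := by
  have := h.zpow_le_iff (m := m) (n := n)
  simpa using this

theorem pow_lt_iff {m n : ℕ} : v π ^ m < v π ^ n ↔ n < m := by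
  have := h.zpow_lt_iff (m := m) (n := n)
  simpa using this

theorem le_pow_succ {x : F} {n : ℕ} (hx : v x < v π ^ n) : v x ≤ v π ^ (n + 1) := by
  rcases eq_or_ne x 0 with rfl | h0
  · simp [h.abv_pos.le]
  · obtain ⟨k, hk⟩ := h.discrete x h0
    rw [hk, ← zpow_natCast, h.zpow_lt_iff] at hx
    rw [hk, ← zpow_natCast, h.zpow_le_iff]
    push_cast; omega

theorem two_ne_zero : (2 : F) ≠ 0 := by
  rw [← v.ne_zero_iff, h.two]
  exact (pow_pos h.abv_pos e).ne'

theorem four : v 4 = v π ^ (2 * e) := by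
  rw [show (4 : F) = 2 * 2 by norm_num, map_mul, h.two]; ring

theorem abv_two_lt : v 2 < 1 := by
  rw [h.two]; exact pow_lt_one₀ h.abv_pos.le h.lt_one h.pos.ne'

theorem abv_four_lt : v 4 < 1 := by
  rw [h.four]; exact pow_lt_one₀ h.abv_pos.le h.lt_one (by have := h.pos; omega)

/-- The elements which modulo squares lie in `1 + 𝔭 ^ (2 s)`. -/
def level (s : ℕ) : Subgroup Fˣ where
  carrier := {x | ∃ y : F, v (x * y ^ 2) = 1 ∧ v (x * y ^ 2 - 1) ≤ v π ^ (2 * s)}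
  one_mem' := ⟨1, by simp, by simp [h.abv_pos.le]⟩
  mul_mem' := by
    rintro a b ⟨y, hy1, hy2⟩ ⟨z, hz1, hz2⟩
    refine ⟨y * z, ?_, ?_⟩
    · rw [Units.val_mul, show (a * b : F) * (y * z) ^ 2 = (a * y ^ 2) * (b * z ^ 2) by ring,
        map_mul, hy1, hz1, one_mul]
    · rw [Units.val_mul, show (a * b : F) * (y * z) ^ 2 - 1 =
        (a * y ^ 2 - 1) * (b * z ^ 2) + (b * z ^ 2 - 1) by ring]
      refine (h.nonarch _ _).trans (max_le ?_ hz2)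
      rwa [map_mul, hz1, mul_one]
  inv_mem' := by
    rintro a ⟨y, hy1, hy2⟩
    have hy : y ≠ 0 := by rintro rfl; simp at hy1
    have ha : (a : F) ≠ 0 := a.ne_zero
    refine ⟨y⁻¹, ?_, ?_⟩
    · rw [Units.val_inv_eq_inv_val, inv_pow, ← mul_inv, map_inv₀, hy1, inv_one]
    · rw [Units.val_inv_eq_inv_val, inv_pow, ← mul_inv,
        show ((a : F) * y ^ 2)⁻¹ - 1 = -((a * y ^ 2 - 1) * (a * y ^ 2)⁻¹) by field_simp; ring,
        v.map_neg, map_mul, map_inv₀, hy1, inv_one, mul_one]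
      exact hy2

theorem level_anti {s t : ℕ} (hst : s ≤ t) : h.level t ≤ h.level s := by
  rintro x ⟨y, hy1, hy2⟩
  exact ⟨y, hy1, hy2.trans (h.pow_le_iff.2 (by omega))⟩

theorem square_le_level (s : ℕ) : Subgroup.square Fˣ ≤ h.level s := by
  rintro x hx
  obtain ⟨y, rfl⟩ := hx
  refine ⟨(y⁻¹ : Fˣ), ?_, ?_⟩
  · rw [sq, ← Units.val_mul, ← Units.val_mul]; simp
  · rw [sq, ← Units.val_mul, ← Units.val_mul]; simp [h.abv_pos.le]

theorem abv_eq_one_of_le {x : F} {n : ℕ} (hn : 0 < n) (hx : v (x - 1) ≤ v π ^ n) : v x = 1 := by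
  have : v (x - 1) < v 1 := by
    rw [map_one]
    exact hx.trans_lt (pow_lt_one₀ h.abv_pos.le h.lt_one hn.ne')
  simpa using abv_eq_of_sub_lt h.nonarch this

/-- An element outside `level 0` has odd valuation. -/
theorem odd_of_notMem_level {x : Fˣ} (hx : x ∉ h.level 0) :
    ∃ n : ℤ, v x = v π ^ (2 * n + 1) := by
  obtain ⟨n, hn⟩ := h.discrete x x.ne_zero
  rcases Int.even_or_odd' n with ⟨k, rfl | rfl⟩
  · refine absurd ⟨π ^ (-k), ?_, ?_⟩ hx
    · rw [map_mul, hn, map_pow, map_zpow₀, ← zpow_natCast, ← zpow_mul, ← zpow_add₀ h.abv_pos.ne']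
      ring_nf; simp
    · have h1 : v (x * (π ^ (-k)) ^ 2) = 1 := by
        rw [map_mul, hn, map_pow, map_zpow₀, ← zpow_natCast, ← zpow_mul, ← zpow_add₀ h.abv_pos.ne']
        ring_nf; simp
      have := abv_sub_le h.nonarch (x * (π ^ (-k)) ^ 2 : F) 1
      rw [h1, map_one, max_self] at this
      simpa using this
  · exact ⟨k, hn⟩

theorem notMem_level_of_odd {x : Fˣ} {n : ℤ} (hx : v x = v π ^ (2 * n + 1)) (s : ℕ) :
    x ∉ h.level s := by
  rintro ⟨y, hy1, -⟩
  have hy : y ≠ 0 := by rintro rfl; simp at hy1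
  obtain ⟨k, hk⟩ := h.discrete y hy
  rw [map_mul, map_pow, hx, hk, ← zpow_natCast, ← zpow_mul, ← zpow_add₀ h.abv_pos.ne',
    ← zpow_zero (v π)] at hy1
  have := h.zpow_inj hy1
  push_cast at this; omega

/-- A unit close to `1` can be moved closer by multiplying with a square. -/
theorem exists_sq_mul_close {w : F} {s : ℕ} (hs : s < e) (hw : v w = 1)
    (hw1 : v (w - 1) ≤ v π ^ (2 * s)) :
    ∃ y, v (w * y ^ 2) = 1 ∧ v (w * y ^ 2 - 1) ≤ v π ^ (2 * s + 1) := by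
  have hπ := h.ne_zero
  have hp := h.abv_pos
  obtain ⟨d, hd⟩ := h.perfect ((w - 1) / π ^ (2 * s)) (by
    rw [map_div₀, map_pow]; exact div_le_one_of_le₀ hw1 (by positivity))
  have hd1 : v d ≤ 1 := by
    by_contra hcon
    have h1 : v (d ^ 2) ≤ 1 := by
      have := h.nonarch (d ^ 2 - (w - 1) / π ^ (2 * s)) ((w - 1) / π ^ (2 * s))
      rw [sub_add_cancel] at this
      refine this.trans (max_le hd.le ?_)
      rw [map_div₀, map_pow]; exact div_le_one_of_le₀ hw1 (by positivity)
    rw [map_pow] at h1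
    exact hcon ((pow_le_one_iff_of_nonneg (v.nonneg d) (by norm_num)).1 h1)
  -- Here `d ^ 2` agrees with `(w - 1) / π ^ (2 * s)` modulo the maximal ideal, so `z ^ 2` matches
  -- `w` up to the cross term `2 * π ^ s * d`. That term has exponent at least `e + s`, which is at
  -- least `2 * s + 1` because `s < e`.
  set z := 1 + π ^ s * d with hz
  have key : v (w - z ^ 2) ≤ v π ^ (2 * s + 1) := by
    have h1 : w - z ^ 2 = -(π ^ (2 * s) * (d ^ 2 - (w - 1) / π ^ (2 * s))) - 2 * π ^ s * d := by
      rw [hz]; field_simp; ring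
    rw [h1]
    refine (abv_sub_le h.nonarch _ _).trans (max_le ?_ ?_)
    · rw [v.map_neg, map_mul, map_pow, pow_succ _ (2 * s)]
      have := h.le_pow_succ (n := 0) (by simpa using hd)
      exact mul_le_mul_of_nonneg_left (by rwa [zero_add, pow_one] at this) (by positivity)
    · rw [map_mul, map_mul, map_pow, h.two, ← pow_add]
      calc v π ^ (e + s) * v d ≤ v π ^ (e + s) * 1 := by gcongr
        _ = v π ^ (e + s) := mul_one _
        _ ≤ _ := h.pow_le_iff.2 (by omega)
  have hz2 : v (z ^ 2) = 1 := by
    have : v (z ^ 2 - w) < v w := by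
      rw [v.map_sub, hw]
      exact key.trans_lt (pow_lt_one₀ hp.le h.lt_one (by omega))
    rw [abv_eq_of_sub_lt h.nonarch this, hw]
  have hz0 : z ≠ 0 := by intro h0; rw [h0] at hz2; simp at hz2
  refine ⟨z⁻¹, ?_, ?_⟩
  · rw [map_mul, inv_pow, map_inv₀, hz2, hw]; simp
  · rw [show w * z⁻¹ ^ 2 - 1 = (w - z ^ 2) * (z ^ 2)⁻¹ by field_simp, map_mul, map_inv₀, hz2]
    simpa using key

theorem exists_of_mem_level {x : Fˣ} {s : ℕ} (hs : s < e) (hx : x ∈ h.level s) :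
    ∃ y : F, v (x * y ^ 2) = 1 ∧ v (x * y ^ 2 - 1) ≤ v π ^ (2 * s + 1) := by
  obtain ⟨y, hy1, hy2⟩ := hx
  obtain ⟨z, hz1, hz2⟩ := h.exists_sq_mul_close hs hy1 hy2
  exact ⟨y * z, by rwa [mul_pow, ← mul_assoc], by rwa [mul_pow, ← mul_assoc]⟩

/-- Squares absorb the even exponent `2 * s`, so the first obstruction to moving closer to `1` sits
at the odd exponent `2 * s + 1`, and it is attained exactly. -/
theorem exists_of_mem_level_of_notMem {x : Fˣ} {s : ℕ} (hs : s < e) (hx : x ∈ h.level s)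
    (hx' : x ∉ h.level (s + 1)) :
    ∃ y : F, v (x * y ^ 2) = 1 ∧ v (x * y ^ 2 - 1) = v π ^ (2 * s + 1) := by
  obtain ⟨y, hy1, hy2⟩ := h.exists_of_mem_level hs hx
  refine ⟨y, hy1, hy2.eq_of_not_lt fun hlt => hx' ⟨y, hy1, ?_⟩⟩
  exact h.le_pow_succ hlt

/-- If a square `y ^ 2` moved `x` closer to `1`, then `y⁻¹ ^ 2 - 1 = γ (γ + 2)` with `γ = y⁻¹ - 1`
would have exponent exactly `2 * s + 1`. This is below `2 * e`, so `γ` dominates `2` and the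
exponent is that of `γ ^ 2`, which is even. -/
theorem notMem_level_of_eq {x : Fˣ} {s : ℕ} (hs : s < e)
    (hx : v ((x : F) - 1) = v π ^ (2 * s + 1)) : x ∉ h.level (s + 1) := by
  rintro ⟨y, hy1, hy2⟩
  have hxv : v x = 1 := h.abv_eq_one_of_le (by omega) hx.le
  have hy : v (y ^ 2) = 1 := by rwa [map_mul, hxv, one_mul] at hy1
  have hy0 : y ≠ 0 := by rintro rfl; simp at hy
  have hz : v ((y⁻¹) ^ 2 - 1) = v π ^ (2 * s + 1) := by
    rw [← hx]
    refine abv_eq_of_sub_lt h.nonarch ?_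
    rw [show (y⁻¹) ^ 2 - 1 - (x - 1) = -((x * y ^ 2 - 1) * (y ^ 2)⁻¹) by field_simp; ring,
      v.map_neg, map_mul, map_inv₀, hy, hx]
    simp only [inv_one, mul_one]
    exact hy2.trans_lt (h.pow_lt_iff.2 (by omega))
  rw [show (y⁻¹) ^ 2 - 1 = (y⁻¹ - 1) * ((y⁻¹ - 1) + 2) by ring] at hz
  have h1 := abv_sq_eq_of_two_sq_lt h.nonarch (γ := y⁻¹ - 1) (by
    rw [hz, h.two, ← pow_mul]; exact h.pow_lt_iff.2 (by omega))
  rw [hz] at h1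
  have h0 : y⁻¹ - 1 ≠ 0 := by
    intro h0; rw [h0, map_zero] at h1
    exact absurd h1.symm (by simpa using h.ne_zero)
  obtain ⟨k, hk⟩ := h.discrete _ h0
  rw [hk, ← zpow_natCast, ← zpow_mul, ← zpow_natCast] at h1
  have := h.zpow_inj h1
  push_cast at this; omega

/-- The form `1 + 4c` is chosen because `(1 + 2y) ^ 2 = 1 + 4(y ^ 2 + y)`, which turns squares at
this level into Artin–Schreier values. -/
theorem mem_level_e {x : Fˣ} : x ∈ h.level e ↔ ∃ y c : F, v c ≤ 1 ∧ x * y ^ 2 = 1 + 4 * c := by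
  have h4 : (4 : F) ≠ 0 := by
    rw [show (4 : F) = 2 * 2 by norm_num]; exact mul_ne_zero h.two_ne_zero h.two_ne_zero
  constructor
  · rintro ⟨y, hy1, hy2⟩
    refine ⟨y, (x * y ^ 2 - 1) / 4, ?_, by field_simp; ring⟩
    rw [map_div₀, h.four]
    exact div_le_one_of_le₀ hy2 (pow_nonneg h.abv_pos.le _)
  · rintro ⟨y, c, hc, hy⟩
    have h1 : v (x * y ^ 2 - 1) ≤ v π ^ (2 * e) := by
      rw [hy, add_sub_cancel_left, map_mul, h.four]
      exact mul_le_of_le_one_right (pow_nonneg h.abv_pos.le _) hc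
    exact ⟨y, h.abv_eq_one_of_le (by have := h.pos; omega) h1, h1⟩

/-- The index of the group of elements of even valuation. -/
theorem index_level_zero : (h.level 0).index = 2 := by
  rw [Subgroup.index_eq_two_iff]
  refine ⟨Units.mk0 π h.ne_zero, fun b => ?_⟩
  have hiff : ∀ x : Fˣ, x ∈ h.level 0 ↔ ∃ n : ℤ, v x = v π ^ (2 * n) := by
    intro x
    constructor
    · intro hx
      obtain ⟨n, hn⟩ := h.discrete x x.ne_zero
      rcases Int.even_or_odd' n with ⟨k, rfl | rfl⟩
      · exact ⟨k, hn⟩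
      · exact absurd hx (h.notMem_level_of_odd hn 0)
    · rintro ⟨n, hn⟩
      by_contra hx
      obtain ⟨k, hk⟩ := h.odd_of_notMem_level hx
      rw [hk] at hn
      have := h.zpow_inj hn
      omega
  rw [hiff, hiff]
  obtain ⟨n, hn⟩ := h.discrete b b.ne_zero
  have hb : v ((b * Units.mk0 π h.ne_zero : Fˣ) : F) = v π ^ (n + 1) := by
    rw [Units.val_mul, map_mul, hn, Units.val_mk0, zpow_add_one₀ h.abv_pos.ne']
  rw [hb, hn]
  rcases Int.even_or_odd' n with ⟨k, rfl | rfl⟩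
  · right
    refine ⟨⟨k, rfl⟩, ?_⟩
    rintro ⟨j, hj⟩
    have := h.zpow_inj hj
    omega
  · left
    refine ⟨⟨k + 1, by ring_nf⟩, ?_⟩
    rintro ⟨j, hj⟩
    have := h.zpow_inj hj
    omega

end IsDyadic

/-- The map `f` has the same image in `G ⧸ N` as `H`, and both indices count that image. This
converts indices of unit groups into indices of additive subgroups of the ring of integers. -/
theorem relIndex_eq_index_ker {R G : Type*} [AddCommGroup R] [CommGroup G] (N H : Subgroup G)
    (f : R →+ Additive (G ⧸ N)) (hf : ∀ c, ∃ g ∈ H, f c = Additive.ofMul (g : G ⧸ N))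
    (hf' : ∀ g ∈ H, ∃ c, f c = Additive.ofMul (g : G ⧸ N)) :
    N.relIndex H = f.ker.index := by
  rw [AddSubgroup.index_ker]
  have h1 := Subgroup.relIndex_ker H (QuotientGroup.mk' N)
  rw [QuotientGroup.ker_mk'] at h1
  rw [h1]
  refine Nat.card_congr (Equiv.subtypeEquiv Additive.ofMul fun x => ?_)
  rw [Subgroup.mem_map, AddMonoidHom.mem_range]
  constructor
  · rintro ⟨g, hg, rfl⟩
    exact hf' g hg
  · rintro ⟨c, hc⟩
    obtain ⟨g, hg, hg'⟩ := hf c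
    exact ⟨g, hg, Additive.ofMul.injective (hg'.symm.trans hc)⟩

end TwoAdic

/-! ### Indices of the filtration steps -/

namespace TwoAdic

open IsLocalRing

/-- The Artin–Schreier map in characteristic two. -/
def artinSchreier (k : Type*) [Field k] [CharP k 2] : k →+ k :=
  AddMonoidHom.mk' (fun y => y ^ 2 + y) fun x y => by
    rw [add_pow_char]; ring

/-- On a finite group the index of the range equals the size of the kernel, and the roots of `y ^ 2
+ y` are `0` and `1`. -/
theorem index_range_artinSchreier (k : Type*) [Field k] [CharP k 2] [Finite k] :
    (artinSchreier k).range.index = 2 := by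
  have h1 := AddSubgroup.card_mul_index (artinSchreier k).range
  have h2 := AddSubgroup.card_mul_index (artinSchreier k).ker
  rw [AddSubgroup.index_ker] at h2
  have hk : Nat.card (artinSchreier k).ker = 2 := by
    have : ((artinSchreier k).ker : Set k) = {0, 1} := by
      ext y
      simp only [SetLike.mem_coe, AddMonoidHom.mem_ker, Set.mem_insert_iff, Set.mem_singleton_iff]
      change y ^ 2 + y = 0 ↔ _
      rw [sq, ← mul_add_one, mul_eq_zero, ← CharTwo.sub_eq_add, sub_eq_zero]
    change Nat.card ((artinSchreier k).ker : Set k) = 2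
    rw [this, Nat.card_coe_set_eq, Set.ncard_pair zero_ne_one]
  have hpos : 0 < Nat.card (artinSchreier k).range := Nat.card_pos
  rw [hk, mul_comm, ← h1] at h2
  exact (Nat.eq_of_mul_eq_mul_left hpos h2).symm

namespace IsDyadic

variable {F : Type*} [Field F] {v : AbsoluteValue F ℝ} {π : F} {e : ℕ} (h : IsDyadic v π e)
  {R : Type*} [CommRing R] [IsLocalRing R] [Algebra R F]
  (hR : ∀ x, v x ≤ 1 ↔ x ∈ Set.range (algebraMap R F))
  (hm : ∀ r : R, r ∈ maximalIdeal R ↔ v (algebraMap R F r) < 1)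
include h

theorem one_add_ne_zero {x : F} (hx : v x < 1) : 1 + x ≠ 0 := by
  rw [← v.ne_zero_iff, abv_one_add h.nonarch hx]; exact one_ne_zero

include hR in
omit [IsLocalRing R] in
theorem abv_algebraMap_le (c : R) : v (algebraMap R F c) ≤ 1 := (hR _).2 ⟨c, rfl⟩

/-- The unit `1 + a c` attached to an integral element `c`. -/
def oneAddMul {a : F} (ha : v a < 1) (c : R) : Fˣ :=
  Units.mk0 (1 + a * algebraMap R F c) (h.one_add_ne_zero (by
    rw [map_mul]
    exact mul_lt_one_of_nonneg_of_lt_one_left (v.nonneg a) ha (h.abv_algebraMap_le hR c)))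

theorem oneAddMul_val {a : F} (ha : v a < 1) (c : R) :
    (h.oneAddMul hR ha c : F) = 1 + a * algebraMap R F c := rfl

theorem abv_oneAddMul {a : F} (ha : v a < 1) (c : R) : v (h.oneAddMul hR ha c : F) = 1 := by
  rw [oneAddMul_val]
  apply abv_one_add h.nonarch
  rw [map_mul]
  exact mul_lt_one_of_nonneg_of_lt_one_left (v.nonneg a) ha (h.abv_algebraMap_le hR c)

/-- If `1 + a ^ 2 𝒪` lies in `N`, then `c ↦ 1 + a c` is additive modulo `N`. -/
def oneAddHom {a : F} (ha : v a < 1) (N : Subgroup Fˣ)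
    (hN : ∀ x : Fˣ, v (x - 1) ≤ v a ^ 2 → x ∈ N) : R →+ Additive (Fˣ ⧸ N) :=
  AddMonoidHom.mk' (fun c => Additive.ofMul (h.oneAddMul hR ha c : Fˣ ⧸ N)) fun c d => by
    rw [← ofMul_mul, ← QuotientGroup.mk_mul]
    congr 1
    rw [QuotientGroup.eq]
    apply hN
    have hne := (h.oneAddMul hR ha (c + d)).ne_zero
    rw [Units.val_mul, Units.val_inv_eq_inv_val, show
      ((h.oneAddMul hR ha (c + d) : Fˣ) : F)⁻¹ *
        ((h.oneAddMul hR ha c * h.oneAddMul hR ha d : Fˣ) : F) - 1 =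
      ((h.oneAddMul hR ha (c + d) : Fˣ) : F)⁻¹ * (a ^ 2 * (algebraMap R F c * algebraMap R F d)) by
        field_simp
        simp only [Units.val_mul, oneAddMul_val, map_add]
        ring]
    rw [map_mul, map_inv₀, h.abv_oneAddMul, inv_one, one_mul, map_mul, map_pow, map_mul]
    exact mul_le_of_le_one_right (by positivity) (mul_le_one₀ (h.abv_algebraMap_le hR c)
      (v.nonneg _) (h.abv_algebraMap_le hR d))

theorem mem_level_of_abv_sub_one_le {s : ℕ} (hs : 0 < s) {x : Fˣ}
    (hx : v ((x : F) - 1) ≤ v π ^ (2 * s)) : x ∈ h.level s := by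
  refine ⟨1, ?_, by simpa using hx⟩
  simpa using h.abv_eq_one_of_le (by omega) hx

include hR hm in
-- The map `c ↦ 1 + π ^ (2 * s + 1) * c` is additive modulo the next level, since products of error
-- terms have exponent `4 * s + 2 ≥ 2 * s + 2`. It reaches every class, and its kernel is the
-- maximal ideal, so the quotient is the residue field.
theorem relIndex_level_succ {s : ℕ} (hs : s < e) :
    (h.level (s + 1)).relIndex (h.level s) = Nat.card (ResidueField R) := by
  have hp := h.abv_pos
  have ha : v (π ^ (2 * s + 1)) < 1 := by
    rw [map_pow]; exact pow_lt_one₀ hp.le h.lt_one (by omega)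
  have hN : ∀ x : Fˣ, v ((x : F) - 1) ≤ v (π ^ (2 * s + 1)) ^ 2 → x ∈ h.level (s + 1) := by
    intro x hx
    refine h.mem_level_of_abv_sub_one_le (by omega) (hx.trans ?_)
    rw [map_pow, ← pow_mul, h.pow_le_iff]; omega
  have hval : ∀ c : R, v ((h.oneAddMul hR ha c : F) - 1) =
      v π ^ (2 * s + 1) * v (algebraMap R F c) := by
    intro c
    rw [h.oneAddMul_val, add_sub_cancel_left, map_mul, map_pow]
  rw [relIndex_eq_index_ker _ _ (h.oneAddHom hR ha _ hN)]
  · have hker : (h.oneAddHom hR ha _ hN).ker = (residue R).toAddMonoidHom.ker := by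
      ext c
      rw [AddMonoidHom.mem_ker, AddMonoidHom.mem_ker]
      change Additive.ofMul (h.oneAddMul hR ha c : Fˣ ⧸ h.level (s + 1)) = Additive.ofMul 1 ↔ residue R c = 0
      rw [Additive.ofMul.injective.eq_iff, QuotientGroup.eq_one_iff, residue_eq_zero_iff, hm]
      constructor
      · intro hc
        by_contra hcon
        refine h.notMem_level_of_eq hs ?_ hc
        rw [hval, le_antisymm (h.abv_algebraMap_le hR c) (not_lt.1 hcon), mul_one]
      · intro hc
        refine h.mem_level_of_abv_sub_one_le (by omega) ?_
        rw [hval, show 2 * (s + 1) = (2 * s + 1) + 1 by ring, pow_succ _ (2 * s + 1)]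
        have := h.le_pow_succ (n := 0) (by simpa using hc)
        rw [zero_add, pow_one] at this
        gcongr
    rw [hker, AddSubgroup.index_ker]
    have hsurj : Function.Surjective (residue R).toAddMonoidHom := residue_surjective
    rw [AddMonoidHom.range_eq_top.2 hsurj]
    exact Nat.card_congr AddSubgroup.topEquiv.toEquiv
  · intro c
    refine ⟨h.oneAddMul hR ha c, ⟨1, ?_, ?_⟩, rfl⟩
    · simpa using h.abv_oneAddMul hR ha c
    · rw [one_pow, mul_one, hval]
      calc _ ≤ v π ^ (2 * s + 1) * 1 := by gcongr; exact h.abv_algebraMap_le hR c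
        _ ≤ _ := by rw [mul_one]; exact h.pow_le_iff.2 (by omega)
  · intro x hx
    obtain ⟨y, hy1, hy2⟩ := h.exists_of_mem_level hs hx
    have hy : y ≠ 0 := by rintro rfl; simp at hy1
    obtain ⟨c, hc⟩ := (hR ((x * y ^ 2 - 1) / π ^ (2 * s + 1))).1 (by
      rw [map_div₀, map_pow]; exact div_le_one_of_le₀ hy2 (by positivity))
    refine ⟨c, ?_⟩
    change Additive.ofMul _ = _
    congr 1
    rw [QuotientGroup.eq]
    apply h.square_le_level
    refine ⟨(Units.mk0 y hy)⁻¹, ?_⟩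
    have hc' : h.oneAddMul hR ha c = x * (Units.mk0 y hy * Units.mk0 y hy) := by
      ext
      rw [h.oneAddMul_val, hc, Units.val_mul, Units.val_mul, Units.val_mk0]
      field_simp [h.ne_zero]; ring
    rw [hc']; group

include hR hm in
-- A square root of `1 + 4c` has the form `1 + 2y` with `y ^ 2 + y = c`. Hence the quotient is the
-- residue field modulo its Artin–Schreier image, of order two.
theorem relIndex_square_level [Finite (ResidueField R)]
    (hinj : Function.Injective (algebraMap R F)) :
    (Subgroup.square Fˣ).relIndex (h.level e) = 2 := by
  have ha : v 4 < 1 := h.abv_four_lt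
  have h4 : (4 : F) ≠ 0 := by
    rw [show (4 : F) = 2 * 2 by norm_num]; exact mul_ne_zero h.two_ne_zero h.two_ne_zero
  have hens : ∀ x : F, v (x - 1) < v 4 → IsSquare x := by
    intro x hx
    obtain ⟨y, hy⟩ := h.hensel ((x - 1) / 4) (by
      rw [map_div₀]; exact (div_lt_one (v.pos h4)).2 hx)
    refine ⟨y, ?_⟩
    rw [← hy]; field_simp; ring
  have hsq : ∀ x : Fˣ, x ∈ Subgroup.square Fˣ ↔ IsSquare (x : F) := by
    intro x
    rw [Subgroup.mem_square]
    constructor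
    · rintro ⟨y, rfl⟩; exact ⟨y, rfl⟩
    · rintro ⟨y, hy⟩
      have hy0 : y ≠ 0 := by rintro rfl; simp at hy
      exact ⟨Units.mk0 y hy0, by ext; simpa using hy⟩
  have hN : ∀ x : Fˣ, v ((x : F) - 1) ≤ v (4 : F) ^ 2 → x ∈ Subgroup.square Fˣ := by
    intro x hx
    rw [hsq]
    refine hens _ (hx.trans_lt ?_)
    nlinarith [v.pos h4]
  have h2m : (2 : R) ∈ maximalIdeal R := by
    rw [hm, map_ofNat]; exact h.abv_two_lt
  have : CharP (ResidueField R) 2 := by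
    refine CharTwo.of_one_ne_zero_of_two_eq_zero one_ne_zero ?_
    have := (residue_eq_zero_iff (2 : R)).2 h2m
    rwa [map_ofNat] at this
  rw [relIndex_eq_index_ker _ _ (h.oneAddHom hR ha _ hN)]
  · have hker : (h.oneAddHom hR ha _ hN).ker =
        (artinSchreier (ResidueField R)).range.comap (residue R).toAddMonoidHom := by
      ext c
      rw [AddMonoidHom.mem_ker, AddSubgroup.mem_comap, AddMonoidHom.mem_range]
      change Additive.ofMul (h.oneAddMul hR ha c : Fˣ ⧸ Subgroup.square Fˣ) = Additive.ofMul 1 ↔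
        ∃ y : ResidueField R, y ^ 2 + y = residue R c
      rw [Additive.ofMul.injective.eq_iff, QuotientGroup.eq_one_iff, hsq, h.oneAddMul_val]
      constructor
      · rintro ⟨x, hx⟩
        have hx1 : (x - 1) / 2 * ((x - 1) / 2 + 1) = algebraMap R F c := by
          have h2 := h.two_ne_zero
          field_simp
          linear_combination -hx
        -- If `(x - 1) / 2` were not integral, then adding `1` would not change its size, and the
        -- product `algebraMap R F c` would not be integral either.
        obtain ⟨y, hy⟩ := (hR ((x - 1) / 2)).1 (by
          by_contra hcon
          push Not at hcon
          have h3 : v ((x - 1) / 2 + 1) = v ((x - 1) / 2) :=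
            abv_eq_of_sub_lt h.nonarch (by simpa using hcon)
          have h4 := h.abv_algebraMap_le hR c
          rw [← hx1, map_mul, h3] at h4
          nlinarith)
        refine ⟨residue R y, ?_⟩
        rw [← map_pow, ← map_add]
        congr 1
        apply hinj
        rw [← hx1, ← hy, map_add, map_pow]; ring
      · rintro ⟨y, hy⟩
        obtain ⟨y, rfl⟩ := residue_surjective y
        rw [← map_pow, ← map_add, ← sub_eq_zero, ← map_sub, residue_eq_zero_iff, hm] at hy
        set Y := algebraMap R F y
        have hY : v (1 + 2 * Y) = 1 := abv_one_add h.nonarch (by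
          rw [map_mul]
          exact mul_lt_one_of_nonneg_of_lt_one_left (v.nonneg _) h.abv_two_lt
            (h.abv_algebraMap_le hR y))
        have hY0 : 1 + 2 * Y ≠ 0 := by rw [← v.ne_zero_iff, hY]; exact one_ne_zero
        -- Dividing by `(1 + 2Y) ^ 2 = 1 + 4(Y ^ 2 + Y)` leaves an element closer to `1` than `4`,
        -- which is a square.
        have := hens ((1 + 4 * algebraMap R F c) / (1 + 2 * Y) ^ 2) (by
          rw [show (1 + 4 * algebraMap R F c) / (1 + 2 * Y) ^ 2 - 1 =
            -(4 * algebraMap R F (y ^ 2 + y - c)) / (1 + 2 * Y) ^ 2 by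
              rw [map_sub, map_add, map_pow]; field_simp; ring, map_div₀, v.map_neg, map_mul,
              map_pow, hY, one_pow, div_one]
          have := v.pos h4
          nlinarith)
        obtain ⟨z, hz⟩ := this
        refine ⟨z * (1 + 2 * Y), ?_⟩
        rw [div_eq_iff (pow_ne_zero 2 hY0)] at hz
        rw [hz]; ring
    rw [hker, AddSubgroup.index_comap_of_surjective, index_range_artinSchreier]
    exact residue_surjective
  · intro c
    refine ⟨h.oneAddMul hR ha c, h.mem_level_e.2 ⟨1, algebraMap R F c, h.abv_algebraMap_le hR c, ?_⟩,
      rfl⟩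
    rw [h.oneAddMul_val]; ring
  · intro x hx
    obtain ⟨y, c, hc, hy⟩ := h.mem_level_e.1 hx
    obtain ⟨c, rfl⟩ := (hR c).1 hc
    have hy0 : y ≠ 0 := by
      rintro rfl
      have := abv_one_add h.nonarch (x := 4 * algebraMap R F c) (by
        rw [map_mul]; exact mul_lt_one_of_nonneg_of_lt_one_left (v.nonneg _) ha hc)
      rw [← hy] at this; simp at this
    refine ⟨c, ?_⟩
    change Additive.ofMul _ = _
    congr 1
    rw [QuotientGroup.eq]
    refine ⟨(Units.mk0 y hy0)⁻¹, ?_⟩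
    have hc' : h.oneAddMul hR ha c = x * (Units.mk0 y hy0 * Units.mk0 y hy0) := by
      ext
      rw [h.oneAddMul_val, ← hy, Units.val_mul, Units.val_mul, Units.val_mk0, sq]
    rw [hc']; group

end IsDyadic

end TwoAdic

/-! ### Depth of a unit -/

namespace TwoAdic

namespace IsDyadic

variable {F : Type*} [Field F] {v : AbsoluteValue F ℝ} {π : F} {e : ℕ} (h : IsDyadic v π e)
include h

/-- The ascending filtration of the unit group by `level`, ending with the whole group. -/
def filtration (j : ℕ) : Subgroup Fˣ := if j ≤ e then h.level (e - j) else ⊤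

theorem filtration_mono : Monotone h.filtration := by
  intro i j hij
  unfold filtration
  split_ifs with h1 h2 h2
  · exact h.level_anti (by omega)
  · exact le_top
  · omega
  · exact le_rfl

open Classical in
/-- The first step of the filtration that contains `x`. -/
noncomputable def depth (x : Fˣ) : ℕ :=
  Nat.find (p := fun j => x ∈ h.filtration j)
    ⟨e + 1, by rw [filtration, if_neg (by omega)]; exact Subgroup.mem_top x⟩

theorem depth_le_iff {x : Fˣ} {j : ℕ} : h.depth x ≤ j ↔ x ∈ h.filtration j := by
  classical
  constructor
  · intro hj
    exact h.filtration_mono hj (Nat.find_spec (p := fun j => x ∈ h.filtration j) _)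
  · exact fun hj => Nat.find_min' _ hj

theorem depth_le (x : Fˣ) : h.depth x ≤ e + 1 := by
  rw [h.depth_le_iff, filtration, if_neg (by omega)]; exact Subgroup.mem_top x

theorem depth_eq_zero_iff {x : Fˣ} : h.depth x = 0 ↔ x ∈ h.level e := by
  rw [← Nat.le_zero, h.depth_le_iff, filtration, if_pos (Nat.zero_le _), Nat.sub_zero]

end IsDyadic

/-- The exponent of the discriminant of a quadratic extension of given depth. -/
def discExponent (e j : ℕ) : ℕ := if j ≤ e then 2 * j else 2 * e + 1

/-! ### Ramified quadratic extensions -/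

section Extension

variable {K Ω : Type*} [Field K] [Field Ω] [Algebra K Ω]

/-- The restriction of an absolute value to a subfield. -/
abbrev restrictAbv (v : AbsoluteValue Ω ℝ) (K : Type*) [Field K] [Algebra K Ω] :
    AbsoluteValue K ℝ :=
  v.comp (algebraMap K Ω).injective

theorem restrictAbv_apply (v : AbsoluteValue Ω ℝ) (x : K) :
    restrictAbv v K x = v (algebraMap K Ω x) := rfl

/-- In an extension with invariant absolute value, the conjugates `y` and `-1 - y` of a root of
`y² + y = c` have the same size, so that `1 + 4𝔭` consists of squares. -/
theorem isSquare_one_add_four_mul [IsGalois K Ω] [IsAlgClosed Ω] [CharZero K]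
    {v : AbsoluteValue Ω ℝ} (hv : IsNonarchimedean v)
    (hinv : ∀ (s : Ω ≃ₐ[K] Ω) (x : Ω), v (s x) = v x) (c : K) (hc : v (algebraMap K Ω c) < 1) :
    IsSquare (1 + 4 * c) := by
  have : CharZero Ω := charZero_of_injective_algebraMap (algebraMap K Ω).injective
  obtain ⟨z, hz⟩ := IsAlgClosed.exists_pow_nat_eq (algebraMap K Ω (1 + 4 * c)) (n := 2) (by norm_num)
  by_cases hzK : z ∈ Set.range (algebraMap K Ω)
  · obtain ⟨x, rfl⟩ := hzK
    rw [← map_pow] at hz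
    exact ⟨x, by rw [← (algebraMap K Ω).injective hz, sq]⟩
  · exfalso
    rw [InfiniteGalois.mem_range_algebraMap_iff_fixed] at hzK
    push Not at hzK
    obtain ⟨s, hs⟩ := hzK
    have hs1 : s z = -z := by
      have : (s z - z) * (s z + z) = 0 := by
        rw [show (s z - z) * (s z + z) = s z ^ 2 - z ^ 2 by ring, ← map_pow, hz, AlgEquiv.commutes,
          sub_self]
      rcases mul_eq_zero.1 this with h1 | h1
      · exact absurd (sub_eq_zero.1 h1) hs
      · exact eq_neg_of_add_eq_zero_left h1
    have h2 : s ((z - 1) / 2) = -(1 + (z - 1) / 2) := by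
      rw [map_div₀, map_sub, hs1, map_one, map_ofNat]; ring
    have h3 : v (1 + (z - 1) / 2) = v ((z - 1) / 2) := by
      rw [← hinv s ((z - 1) / 2), h2, v.map_neg]
    have h4 : (z - 1) / 2 * (1 + (z - 1) / 2) = algebraMap K Ω c := by
      have : z ^ 2 = 1 + 4 * algebraMap K Ω c := by
        rw [hz, map_add, map_mul, map_one, map_ofNat]
      linear_combination this / 4
    have h5 : v ((z - 1) / 2) ^ 2 < 1 := by
      rw [sq]; nth_rw 2 [← h3]; rw [← map_mul, h4]; exact hc
    have h6 : v ((z - 1) / 2) < 1 := by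
      by_contra hcon
      nlinarith
    rw [abv_one_add hv h6] at h3
    linarith

variable {v : AbsoluteValue Ω ℝ} (hv : IsNonarchimedean v) {π : K} {e : ℕ}
  (h : IsDyadic (restrictAbv v K) π e)
include hv h

/-- The absolute values of the terms of a polynomial expression in an element of fractional
valuation `1 / n` are bounded by the absolute value of their sum. -/
theorem abv_term_le {n : ℕ} {z : Ω} (hz : v z ^ n = v (algebraMap K Ω π)) (k : Fin n → K)
    (i : Fin n) :
    v (algebraMap K Ω (k i) * z ^ (i : ℕ)) ≤ v (∑ j, algebraMap K Ω (k j) * z ^ (j : ℕ)) := by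
  have hπ : 0 < v (algebraMap K Ω π) := h.abv_pos
  have hn : n ≠ 0 := by rintro rfl; exact i.elim0
  have hz0 : 0 < v z := by
    rw [v.pos_iff]; rintro rfl
    rw [map_zero, zero_pow hn] at hz
    exact hπ.ne hz
  have hz1 : v z < 1 := by
    by_contra hcon
    have := one_le_pow₀ (n := n) (not_lt.1 hcon)
    rw [hz] at this
    exact absurd h.lt_one (not_lt.2 this)
  have : Nonempty (Fin n) := ⟨i⟩
  obtain ⟨m, -, hm⟩ := Finset.exists_max_image Finset.univ
    (fun j => v (algebraMap K Ω (k j) * z ^ (j : ℕ))) Finset.univ_nonempty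
  rcases eq_or_ne (k m) 0 with h0 | h0
  · refine (hm i (Finset.mem_univ _)).trans ?_
    simp [h0]
  · refine (hm i (Finset.mem_univ _)).trans (le_of_eq ?_)
    symm
    refine IsNonarchimedean.apply_sum_eq_of_lt (k := m) hv (fun x => (v.map_neg x).symm)
      (Finset.mem_univ _) fun j _ hjm => (hm j (Finset.mem_univ _)).lt_of_ne fun heq => ?_
    -- Measured in powers of `v z`, the `j`-th nonzero term has exponent congruent to `j` modulo
    -- `n`. Nonzero terms therefore have pairwise distinct sizes and cannot cancel.
    have hval : ∀ j, k j ≠ 0 → ∃ N : ℤ, v (algebraMap K Ω (k j) * z ^ (j : ℕ)) =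
        v z ^ (n * N + j : ℤ) := by
      intro j hj
      obtain ⟨N, hN⟩ := h.discrete (k j) hj
      refine ⟨N, ?_⟩
      rw [restrictAbv_apply, restrictAbv_apply] at hN
      rw [map_mul, hN, map_pow, ← hz, zpow_add₀ hz0.ne', zpow_mul, zpow_natCast, zpow_natCast]
    have hj0 : k j ≠ 0 := by
      intro hj0
      rw [hj0, map_zero, zero_mul, map_zero, eq_comm, map_eq_zero, mul_eq_zero] at heq
      rcases heq with heq | heq
      · exact h0 ((map_eq_zero _).1 heq)
      · exact v.pos_iff.1 hz0 (eq_zero_of_pow_eq_zero heq)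
    obtain ⟨N, hN⟩ := hval j hj0
    obtain ⟨M, hM⟩ := hval m h0
    rw [hN, hM] at heq
    have := zpow_right_injective₀ hz0 hz1.ne heq
    have hj := j.2
    have hm := m.2
    apply hjm
    ext
    have h1 : ((n * N + j : ℤ)) % n = (n * M + m : ℤ) % n := by rw [this]
    rw [Int.mul_add_emod_self_left, Int.mul_add_emod_self_left, Int.emod_eq_of_lt (by omega)
      (by omega), Int.emod_eq_of_lt (by omega) (by omega)] at h1
    exact_mod_cast h1

theorem abv_le_of_sq_eq {z : Ω} (hz : v z ^ 2 = v (algebraMap K Ω π)) (k₀ k₁ : K) :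
    v (algebraMap K Ω k₀) ≤ v (algebraMap K Ω k₀ + algebraMap K Ω k₁ * z) ∧
      v (algebraMap K Ω k₁ * z) ≤ v (algebraMap K Ω k₀ + algebraMap K Ω k₁ * z) := by
  have h0 := abv_term_le hv h hz ![k₀, k₁] 0
  have h1 := abv_term_le hv h hz ![k₀, k₁] 1
  simp only [Fin.sum_univ_two, Matrix.cons_val_zero, Matrix.cons_val_one, Fin.val_zero, Fin.val_one,
    pow_zero, pow_one, mul_one] at h0 h1
  exact ⟨h0, h1⟩

omit hv in
theorem lt_one_of_pow_eq {n : ℕ} {z : Ω} (hz : v z ^ n = v (algebraMap K Ω π)) : v z < 1 := by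
  by_contra hcon
  have := one_le_pow₀ (n := n) (not_lt.1 hcon)
  rw [hz] at this
  exact absurd h.lt_one (not_lt.2 this)

omit hv in
/-- An element of `K` that is small enough to keep `k z ^ i` integral is integral. -/
theorem abv_le_one_of_mul_pow_le {n i : ℕ} (hi : i < n) {z : Ω}
    (hz : v z ^ n = v (algebraMap K Ω π)) {k : K} (hk : v (algebraMap K Ω k * z ^ i) ≤ 1) :
    v (algebraMap K Ω k) ≤ 1 := by
  rcases eq_or_ne k 0 with rfl | h0
  · simp
  · obtain ⟨N, hN⟩ := h.discrete k h0
    by_contra hcon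
    rw [not_le, ← restrictAbv_apply, hN, ← zpow_zero (restrictAbv v K π), h.zpow_lt_iff] at hcon
    have hπ : 0 < v (algebraMap K Ω π) := h.abv_pos
    have hz1 := lt_one_of_pow_eq h hz
    have hz0 : 0 < v z := by
      rw [v.pos_iff]; rintro rfl
      rw [map_zero, zero_pow (by omega)] at hz
      exact hπ.ne hz
    rw [map_mul, ← restrictAbv_apply, hN, restrictAbv_apply, ← hz, map_pow, ← zpow_natCast,
      ← zpow_natCast, ← zpow_mul, ← zpow_add₀ hz0.ne', ← zpow_zero (v z),
      zpow_le_zpow_iff_right_of_lt_one₀ hz0 hz1] at hk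
    nlinarith

omit hv in
theorem abv_mul_pow_lt_one {n i : ℕ} (hi : i < n) (hi' : i ≠ 0) {z : Ω}
    (hz : v z ^ n = v (algebraMap K Ω π)) {k : K} (hk : v (algebraMap K Ω k * z ^ i) ≤ 1) :
    v (algebraMap K Ω k * z ^ i) < 1 := by
  rw [map_mul, map_pow]
  exact mul_lt_one_of_nonneg_of_lt_one_right (abv_le_one_of_mul_pow_le h hi hz hk)
    (by positivity) (pow_lt_one₀ (v.nonneg _) (lt_one_of_pow_eq h hz) hi')

/-- A ramified square root generates an extension with a uniformiser of known different. -/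
theorem exists_uniformizer_of_depth {x : Kˣ} (hx : h.depth x ≠ 0) {α : Ω}
    (hα : α ^ 2 = algebraMap K Ω x) :
    ∃ k₀ k₁ : K, v (algebraMap K Ω k₀ + algebraMap K Ω k₁ * α) ^ 2 = v (algebraMap K Ω π) ∧
      v (2 * (algebraMap K Ω k₁ * α)) ^ 2 =
        v (algebraMap K Ω π) ^ discExponent e (h.depth x) := by
  have hπ : 0 < v (algebraMap K Ω π) := h.abv_pos
  have hα' : v α ^ 2 = v (algebraMap K Ω x) := by rw [← map_pow, hα]
  have h2 : v 2 = v (algebraMap K Ω π) ^ e := by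
    have := h.two; rwa [restrictAbv_apply, map_ofNat] at this
  by_cases hxe : h.depth x ≤ e
  · obtain ⟨s, hs⟩ : ∃ s, h.depth x + s = e := ⟨e - h.depth x, by omega⟩
    have h1 : x ∈ h.level s := by
      have := h.depth_le_iff.1 (le_refl (h.depth x))
      rwa [IsDyadic.filtration, if_pos hxe, show e - h.depth x = s by omega] at this
    have h2' : x ∉ h.level (s + 1) := by
      intro hcon
      have : h.depth x ≤ h.depth x - 1 := by
        rw [h.depth_le_iff, IsDyadic.filtration, if_pos (by omega),
          show e - (h.depth x - 1) = s + 1 by omega]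
        exact hcon
      omega
    obtain ⟨y, hy1, hy2⟩ := h.exists_of_mem_level_of_notMem (by omega) h1 h2'
    rw [restrictAbv_apply] at hy1 hy2
    rw [restrictAbv_apply] at hy2
    set Y := algebraMap K Ω y
    set P := algebraMap K Ω π
    have hP : P ≠ 0 := v.pos_iff.1 hπ
    have hw : algebraMap K Ω (x * y ^ 2) = (Y * α) ^ 2 := by
      rw [map_mul, ← hα, map_pow]; ring
    rw [hw] at hy1
    rw [map_sub, hw, map_one, show (Y * α) ^ 2 - 1 = (Y * α - 1) * ((Y * α - 1) + 2) by ring] at hy2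
    have hγ := abv_sq_eq_of_two_sq_lt hv (γ := Y * α - 1) (by
      rw [hy2, h2, ← pow_mul]
      exact (h.pow_lt_iff (m := e * 2) (n := 2 * s + 1)).2 (by omega))
    rw [hy2] at hγ
    -- The uniformiser is `(y α - 1) / π ^ s`: the square of the numerator has the size of `π ^ (2 *
    -- s + 1)`. Its difference from its conjugate, `2 y α / π ^ s`, has exponent `e - s`, which is
    -- the depth.
    refine ⟨-(π ^ s)⁻¹, (π ^ s)⁻¹ * y, ?_, ?_⟩
    · rw [show algebraMap K Ω (-(π ^ s)⁻¹) + algebraMap K Ω ((π ^ s)⁻¹ * y) * α =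
        (P ^ s)⁻¹ * (Y * α - 1) by rw [map_neg, map_mul, map_inv₀, map_pow]; ring]
      rw [map_mul, mul_pow, hγ, map_inv₀, map_pow, inv_pow, ← pow_mul, pow_succ, mul_comm s 2]
      field_simp
    · rw [show 2 * (algebraMap K Ω ((π ^ s)⁻¹ * y) * α) = 2 * (P ^ s)⁻¹ * (Y * α) by
        rw [map_mul, map_inv₀, map_pow]; ring]
      rw [map_pow] at hy1
      rw [map_mul, mul_pow, hy1, map_mul, map_inv₀, map_pow, h2, discExponent, if_pos hxe, mul_one,
        show v P ^ e = v P ^ h.depth x * v P ^ s by rw [← pow_add, hs]]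
      field_simp
      rw [← pow_mul, mul_comm]
  · have h1 : x ∉ h.level 0 := by
      intro hcon
      apply hxe
      rw [h.depth_le_iff, IsDyadic.filtration, if_pos le_rfl, Nat.sub_self]
      exact hcon
    obtain ⟨n, hn⟩ := h.odd_of_notMem_level h1
    rw [restrictAbv_apply, restrictAbv_apply] at hn
    have key : v (algebraMap K Ω (π ^ (-n)) * α) ^ 2 = v (algebraMap K Ω π) := by
      rw [map_mul, mul_pow, hα', hn, map_zpow₀, map_zpow₀, ← zpow_natCast, ← zpow_mul,
        ← zpow_add₀ hπ.ne']
      ring_nf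
      simp
    -- In odd valuation a rescaled `α` is itself a uniformiser, and its different `2 α π ^ (-n)` has
    -- squared exponent `2 * e + 1`.
    refine ⟨0, π ^ (-n), ?_, ?_⟩
    · rw [map_zero, zero_add, key]
    · rw [map_mul, mul_pow, key, h2, discExponent, if_neg hxe, pow_succ]; ring

/-- An extension generated by an element of valuation `1 / 2` is again dyadic. -/
theorem isDyadic_of_sq_eq {E : Type*} [Field E] [Algebra K E] [Algebra E Ω] [IsScalarTower K E Ω]
    [IsGalois E Ω] [IsAlgClosed Ω] [CharZero E]
    (hinv : ∀ (s : Ω ≃ₐ[E] Ω) (x : Ω), v (s x) = v x) {z : E}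
    (hz : v (algebraMap E Ω z) ^ 2 = v (algebraMap K Ω π))
    (hE : ∀ x : E, ∃ k₀ k₁ : K, x = algebraMap K E k₀ + algebraMap K E k₁ * z) :
    IsDyadic (restrictAbv v E) z (2 * e) := by
  have hπ : 0 < v (algebraMap K Ω π) := h.abv_pos
  have hz0 : 0 < v (algebraMap E Ω z) := by
    rw [v.pos_iff]; intro h0
    rw [h0, map_zero, zero_pow two_ne_zero] at hz
    exact hπ.ne hz
  have hmap : ∀ k₀ k₁ : K, algebraMap E Ω (algebraMap K E k₀ + algebraMap K E k₁ * z) =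
      algebraMap K Ω k₀ + algebraMap K Ω k₁ * algebraMap E Ω z := by
    intro k₀ k₁
    rw [map_add, map_mul, ← IsScalarTower.algebraMap_apply, ← IsScalarTower.algebraMap_apply]
  have hdisc : ∀ k : K, k ≠ 0 → ∃ n : ℤ, v (algebraMap K Ω k) = v (algebraMap E Ω z) ^ (2 * n) := by
    intro k hk
    obtain ⟨n, hn⟩ := h.discrete k hk
    refine ⟨n, ?_⟩
    rw [restrictAbv_apply, restrictAbv_apply, ← hz] at hn
    rw [hn, zpow_mul]; norm_cast
  refine ⟨fun x y => ?_, ?_, lt_one_of_pow_eq h hz, ?_, ?_, by have := h.pos; omega, ?_, ?_⟩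
  · simpa only [restrictAbv_apply, map_add] using hv (algebraMap E Ω x) (algebraMap E Ω y)
  · rintro rfl; simp at hz0
  · intro x hx
    obtain ⟨k₀, k₁, rfl⟩ := hE x
    simp only [restrictAbv_apply, hmap]
    obtain ⟨h0, h1⟩ := abv_le_of_sq_eq hv h hz k₀ k₁
    have h2 := hv (algebraMap K Ω k₀) (algebraMap K Ω k₁ * algebraMap E Ω z)
    have hne : v (algebraMap K Ω k₀ + algebraMap K Ω k₁ * algebraMap E Ω z) ≠ 0 := by
      rw [← hmap]; exact v.ne_zero_iff.2 ((map_ne_zero _).2 hx)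
    rcases le_max_iff.1 h2 with h3 | h3
    · have h4 := le_antisymm h3 h0
      have hk : k₀ ≠ 0 := by
        rintro rfl
        exact hne (h4.trans (by simp))
      obtain ⟨n, hn⟩ := hdisc k₀ hk
      exact ⟨2 * n, by rw [h4, hn]⟩
    · have h4 := le_antisymm h3 h1
      have hk : k₁ ≠ 0 := by
        rintro rfl
        exact hne (h4.trans (by simp))
      obtain ⟨n, hn⟩ := hdisc k₁ hk
      exact ⟨2 * n + 1, by rw [h4, map_mul, hn, zpow_add_one₀ hz0.ne']⟩
  · have := h.two
    rw [restrictAbv_apply, restrictAbv_apply, map_ofNat] at this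
    rw [restrictAbv_apply, restrictAbv_apply, map_ofNat, this, pow_mul, hz]
  · intro x hx
    obtain ⟨k₀, k₁, rfl⟩ := hE x
    simp only [restrictAbv_apply, hmap] at hx
    obtain ⟨h0, h1⟩ := abv_le_of_sq_eq hv h hz k₀ k₁
    obtain ⟨y, hy⟩ := h.perfect k₀ (h0.trans hx)
    -- The summand `k₁ z` is not a unit, so every integral element agrees with an element of `K`
    -- modulo the maximal ideal, and square roots modulo that ideal can be taken in `K`.
    refine ⟨algebraMap K E y, ?_⟩
    rw [restrictAbv_apply, map_sub, hmap, map_pow, ← IsScalarTower.algebraMap_apply, ← sub_sub]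
    refine (abv_sub_le hv _ _).trans_lt (max_lt ?_ ?_)
    · rw [restrictAbv_apply, map_sub, map_pow] at hy
      exact hy
    · have := abv_mul_pow_lt_one h (i := 1) (by norm_num) one_ne_zero hz (k := k₁)
        (by rw [pow_one]; exact h1.trans hx)
      rwa [pow_one] at this
  · intro c hc
    exact isSquare_one_add_four_mul hv hinv c hc

end Extension

end TwoAdic

/-! ### Algebra of biquadratic extensions -/

namespace TwoAdic

open IntermediateField

section Biquadratic

variable {K Ω : Type*} [Field K] [Field Ω] [Algebra K Ω]

theorem mem_adjoin_sqrt [Algebra.IsAlgebraic K Ω] {α : Ω} {a : K} (hα : α ^ 2 = algebraMap K Ω a)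
    {x : Ω} :
    x ∈ K⟮α⟯ ↔ ∃ k₀ k₁ : K, x = algebraMap K Ω k₀ + algebraMap K Ω k₁ * α := by
  constructor
  · intro hx
    have hx' : x ∈ Algebra.adjoin K {α} := by
      rwa [← IntermediateField.mem_toSubalgebra, IntermediateField.adjoin_toSubalgebra] at hx
    induction hx' using Algebra.adjoin_induction with
    | mem x h =>
      obtain rfl := Set.mem_singleton_iff.1 h
      exact ⟨0, 1, by simp⟩
    | algebraMap r => exact ⟨r, 0, by simp⟩
    | add x y hx hy ihx ihy =>
      obtain ⟨k₀, k₁, rfl⟩ := ihx (by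
        rwa [← IntermediateField.mem_toSubalgebra, IntermediateField.adjoin_toSubalgebra])
      obtain ⟨l₀, l₁, rfl⟩ := ihy (by
        rwa [← IntermediateField.mem_toSubalgebra, IntermediateField.adjoin_toSubalgebra])
      exact ⟨k₀ + l₀, k₁ + l₁, by simp only [map_add]; ring⟩
    | mul x y hx hy ihx ihy =>
      obtain ⟨k₀, k₁, rfl⟩ := ihx (by
        rwa [← IntermediateField.mem_toSubalgebra, IntermediateField.adjoin_toSubalgebra])
      obtain ⟨l₀, l₁, rfl⟩ := ihy (by
        rwa [← IntermediateField.mem_toSubalgebra, IntermediateField.adjoin_toSubalgebra])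
      refine ⟨k₀ * l₀ + a * (k₁ * l₁), k₀ * l₁ + k₁ * l₀, ?_⟩
      simp only [map_add, map_mul, ← hα]; ring
  · rintro ⟨k₀, k₁, rfl⟩
    exact add_mem (IntermediateField.algebraMap_mem _ _) (mul_mem (IntermediateField.algebraMap_mem _ _) (mem_adjoin_simple_self K α))

/-- The element of a biquadratic extension with given coordinates. -/
def biquadElt (α β : Ω) (c : Fin 4 → K) : Ω :=
  algebraMap K Ω (c 0) + algebraMap K Ω (c 1) * α + algebraMap K Ω (c 2) * β +
    algebraMap K Ω (c 3) * (α * β)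

theorem mem_adjoin_pair [Algebra.IsAlgebraic K Ω] {α β : Ω} {a b : K}
    (hα : α ^ 2 = algebraMap K Ω a) (hβ : β ^ 2 = algebraMap K Ω b) {x : Ω} :
    x ∈ adjoin K {α, β} ↔ ∃ c : Fin 4 → K, x = biquadElt α β c := by
  have hS : ∀ x, x ∈ Algebra.adjoin K {α, β} ↔ x ∈ adjoin K {α, β} := fun x => by
    rw [← IntermediateField.mem_toSubalgebra, IntermediateField.adjoin_toSubalgebra]
  constructor
  · rw [← hS]
    intro hx
    induction hx using Algebra.adjoin_induction with
    | mem x hx =>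
      rcases hx with rfl | rfl
      · exact ⟨![0, 1, 0, 0], by simp [biquadElt]⟩
      · exact ⟨![0, 0, 1, 0], by simp [biquadElt]⟩
    | algebraMap r => exact ⟨![r, 0, 0, 0], by simp [biquadElt]⟩
    | add x y hx hy ihx ihy =>
      obtain ⟨c, rfl⟩ := ihx
      obtain ⟨d, rfl⟩ := ihy
      exact ⟨c + d, by simp only [biquadElt, Pi.add_apply, map_add]; ring⟩
    | mul x y hx hy ihx ihy =>
      obtain ⟨c, rfl⟩ := ihx
      obtain ⟨d, rfl⟩ := ihy
      refine ⟨![c 0 * d 0 + a * (c 1 * d 1) + b * (c 2 * d 2) + a * b * (c 3 * d 3),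
        c 0 * d 1 + c 1 * d 0 + b * (c 2 * d 3 + c 3 * d 2),
        c 0 * d 2 + c 2 * d 0 + a * (c 1 * d 3 + c 3 * d 1),
        c 0 * d 3 + c 3 * d 0 + c 1 * d 2 + c 2 * d 1], ?_⟩
      simp [biquadElt, ← hα, ← hβ]; ring
  · rintro ⟨c, rfl⟩
    have h1 : α ∈ adjoin K {α, β} := subset_adjoin K _ (by simp)
    have h2 : β ∈ adjoin K {α, β} := subset_adjoin K _ (by simp)
    exact add_mem (add_mem (add_mem (IntermediateField.algebraMap_mem _ _) (mul_mem (IntermediateField.algebraMap_mem _ _) h1))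
      (mul_mem (IntermediateField.algebraMap_mem _ _) h2)) (mul_mem (IntermediateField.algebraMap_mem _ _) (mul_mem h1 h2))

/-- `α` and `β` are square roots of `a` and `b`, and `σ`, `τ` negate `β`, `α` respectively. -/
structure IsBiquadratic (a b : K) (α β : Ω) (σ τ : Ω ≃ₐ[K] Ω) : Prop where
  sq_left : α ^ 2 = algebraMap K Ω a
  sq_right : β ^ 2 = algebraMap K Ω b
  left_ne : α ≠ 0
  right_ne : β ≠ 0
  fst_left : σ α = α
  fst_right : σ β = -β
  snd_left : τ α = -α
  snd_right : τ β = β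

theorem apply_eq_or_neg {E : Type*} [Field E] [Algebra K E] {γ : E} {g : K}
    (hγ : γ ^ 2 = algebraMap K E g) (s : E ≃ₐ[K] E) : s γ = γ ∨ s γ = -γ := by
  rw [← sq_eq_sq_iff_eq_or_eq_neg, ← map_pow, hγ, AlgEquiv.commutes]

/-- Squaring `β = k₀ + k₁ α` puts `2 k₀ k₁ α` in `K`. Then `α` lies in `K`, or `k₀ = 0`, or `k₁ =
0`, and these make `a`, `a * b` or `b` a square respectively. -/
theorem notMem_adjoin_sqrt [Algebra.IsAlgebraic K Ω] [CharZero K] {α β : Ω} {a b : K}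
    (hα : α ^ 2 = algebraMap K Ω a) (hβ : β ^ 2 = algebraMap K Ω b) (ha : ¬ IsSquare a)
    (hb : ¬ IsSquare b) (hab : ¬ IsSquare (a * b)) : β ∉ K⟮α⟯ := by
  have : CharZero Ω := charZero_of_injective_algebraMap (algebraMap K Ω).injective
  rw [mem_adjoin_sqrt hα]
  rintro ⟨k₀, k₁, rfl⟩
  have h1 : algebraMap K Ω (2 * k₀ * k₁) * α = algebraMap K Ω (b - k₀ ^ 2 - k₁ ^ 2 * a) := by
    rw [map_sub, map_sub, ← hβ]; simp only [map_mul, map_pow, ← hα, map_ofNat]; ring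
  by_cases h0 : 2 * k₀ * k₁ = 0
  · rw [h0, map_zero, zero_mul, eq_comm, map_eq_zero] at h1
    rcases mul_eq_zero.1 h0 with h2 | h2
    · have h3 : k₀ = 0 := by simpa using h2
      subst h3
      exact hab ⟨k₁ * a, by linear_combination a * h1⟩
    · subst h2
      exact hb ⟨k₀, by linear_combination h1⟩
  · apply ha
    refine ⟨(b - k₀ ^ 2 - k₁ ^ 2 * a) / (2 * k₀ * k₁), ?_⟩
    apply (algebraMap K Ω).injective
    rw [map_mul, map_div₀, ← h1, ← hα]
    have : algebraMap K Ω (2 * k₀ * k₁) ≠ 0 := (map_ne_zero _).2 h0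
    field_simp

theorem exists_aut_of_notMem [IsGalois K Ω] {α β : Ω} {b : K} (hβ : β ^ 2 = algebraMap K Ω b)
    (h : β ∉ K⟮α⟯) : ∃ σ : Ω ≃ₐ[K] Ω, σ α = α ∧ σ β = -β := by
  have h1 : β ∉ Set.range (algebraMap K⟮α⟯ Ω) := by
    rintro ⟨x, rfl⟩; exact h x.2
  rw [InfiniteGalois.mem_range_algebraMap_iff_fixed] at h1
  push Not at h1
  obtain ⟨s, hs⟩ := h1
  refine ⟨s.restrictScalars K, s.commutes (AdjoinSimple.gen K α), ?_⟩
  exact (apply_eq_or_neg hβ (s.restrictScalars K)).resolve_left hs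

theorem exists_isBiquadratic [IsGalois K Ω] [CharZero K] {α β : Ω} {a b : K}
    (hα : α ^ 2 = algebraMap K Ω a) (hβ : β ^ 2 = algebraMap K Ω b) (ha : ¬ IsSquare a)
    (hb : ¬ IsSquare b) (hab : ¬ IsSquare (a * b)) :
    ∃ σ τ : Ω ≃ₐ[K] Ω, IsBiquadratic a b α β σ τ := by
  obtain ⟨σ, h1, h2⟩ := exists_aut_of_notMem hβ (notMem_adjoin_sqrt hα hβ ha hb hab)
  obtain ⟨τ, h3, h4⟩ := exists_aut_of_notMem hα (notMem_adjoin_sqrt hβ hα hb ha (by rwa [mul_comm]))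
  refine ⟨σ, τ, hα, hβ, ?_, ?_, h1, h2, h4, h3⟩
  · rintro rfl
    refine ha ⟨0, (algebraMap K Ω).injective ?_⟩
    rw [← hα]; simp
  · rintro rfl
    refine hb ⟨0, (algebraMap K Ω).injective ?_⟩
    rw [← hβ]; simp

namespace IsBiquadratic

variable {a b : K} {α β : Ω} {σ τ : Ω ≃ₐ[K] Ω} (H : IsBiquadratic a b α β σ τ)
include H

theorem fst_biquadElt (c : Fin 4 → K) :
    σ (biquadElt α β c) = biquadElt α β ![c 0, c 1, -c 2, -c 3] := by
  simp [biquadElt, H.fst_left, H.fst_right]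

theorem snd_biquadElt (c : Fin 4 → K) :
    τ (biquadElt α β c) = biquadElt α β ![c 0, -c 1, c 2, -c 3] := by
  simp [biquadElt, H.snd_left, H.snd_right]

/-- The four conjugates differ by the four characters of the Klein group, so averaging them with
signs isolates each coordinate. -/
theorem coord_eq_zero [CharZero K] {c : Fin 4 → K} (h : biquadElt α β c = 0) : c = 0 := by
  have : CharZero Ω := charZero_of_injective_algebraMap (algebraMap K Ω).injective
  have h1 : biquadElt α β ![c 0, c 1, -c 2, -c 3] = 0 := by rw [← H.fst_biquadElt, h, map_zero]
  have h2 : biquadElt α β ![c 0, -c 1, c 2, -c 3] = 0 := by rw [← H.snd_biquadElt, h, map_zero]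
  have h3 : biquadElt α β ![c 0, -c 1, -c 2, c 3] = 0 := by
    have := congrArg σ h2
    rw [H.fst_biquadElt, map_zero] at this
    simpa using this
  simp only [biquadElt, Matrix.cons_val, map_neg] at h h1 h2 h3
  have e0 : algebraMap K Ω (c 0) = 0 := by linear_combination (h + h1 + h2 + h3) / 4
  have e1 : algebraMap K Ω (c 1) * α = 0 := by linear_combination (h + h1 - h2 - h3) / 4
  have e2 : algebraMap K Ω (c 2) * β = 0 := by linear_combination (h - h1 + h2 - h3) / 4
  have e3 : algebraMap K Ω (c 3) * (α * β) = 0 := by linear_combination (h - h1 - h2 + h3) / 4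
  ext i
  fin_cases i
  · simpa using e0
  · simpa [H.left_ne] using e1
  · simpa [H.right_ne] using e2
  · simpa [H.left_ne, H.right_ne] using e3

theorem coord_injective [CharZero K] {c d : Fin 4 → K} (h : biquadElt α β c = biquadElt α β d) :
    c = d := by
  rw [← sub_eq_zero]
  apply H.coord_eq_zero
  rw [← sub_eq_zero] at h
  rw [← h]
  simp only [biquadElt, Pi.sub_apply, map_sub]; ring

theorem finrank_eq [Algebra.IsAlgebraic K Ω] [CharZero K] :
    Module.finrank K (adjoin K {α, β}) = 4 := by
  have hmem : ∀ c : Fin 4 → K, biquadElt α β c ∈ adjoin K {α, β} :=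
    fun c => (mem_adjoin_pair H.sq_left H.sq_right).2 ⟨c, rfl⟩
  let f : (Fin 4 → K) →ₗ[K] adjoin K {α, β} :=
    { toFun := fun c => ⟨biquadElt α β c, hmem c⟩
      map_add' := fun c d => by
        ext; simp only [biquadElt, Pi.add_apply, map_add, AddMemClass.mk_add_mk]; ring
      map_smul' := fun r c => by
        ext
        change biquadElt α β (r • c) = r • biquadElt α β c
        simp only [biquadElt, Pi.smul_apply, smul_eq_mul, map_mul, Algebra.smul_def]
        ring }
  have hf : Function.Bijective f := by
    constructor
    · intro c d hcd
      exact H.coord_injective (congrArg Subtype.val hcd)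
    · rintro ⟨x, hx⟩
      obtain ⟨c, rfl⟩ := (mem_adjoin_pair H.sq_left H.sq_right).1 hx
      exact ⟨c, rfl⟩
  rw [← (LinearEquiv.ofBijective f hf).finrank_eq]
  simp

omit H in
theorem normal_adjoin [IsGalois K Ω] (hα : α ^ 2 = algebraMap K Ω a)
    (hβ : β ^ 2 = algebraMap K Ω b) : Normal K (adjoin K {α, β}) := by
  rw [normal_iff_forall_map_le']
  intro s
  rw [adjoin_map, adjoin_le_iff]
  rintro _ ⟨x, hx, rfl⟩
  have hx' : x ∈ adjoin K {α, β} := subset_adjoin K _ hx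
  have : s x = x ∨ s x = -x := by
    rcases hx with rfl | rfl
    · exact apply_eq_or_neg hα s
    · exact apply_eq_or_neg hβ s
  change s x ∈ _
  rcases this with h | h <;> rw [h]
  · exact hx'
  · exact neg_mem hx'

theorem isKleinFour [IsGalois K Ω] [CharZero K] : IsKleinFour Gal(adjoin K {α, β}/K) := by
  have := normal_adjoin H.sq_left H.sq_right
  have hG : IsGalois K (adjoin K {α, β}) := { }
  have hfd : FiniteDimensional K (adjoin K {α, β}) :=
    Module.finite_of_finrank_pos (by rw [H.finrank_eq]; norm_num)
  have hcard : Nat.card Gal(adjoin K {α, β}/K) = 4 := by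
    rw [IsGalois.card_aut_eq_finrank, H.finrank_eq]
  refine ⟨hcard, ?_⟩
  have h1 : α ∈ adjoin K {α, β} := subset_adjoin K _ (by simp)
  have h2 : β ∈ adjoin K {α, β} := subset_adjoin K _ (by simp)
  have hsq : ∀ s : Gal(adjoin K {α, β}/K), s ^ 2 = 1 := by
    intro s
    have e1 : s (s ⟨α, h1⟩) = ⟨α, h1⟩ := by
      rcases apply_eq_or_neg (γ := ⟨α, h1⟩) (g := a) (Subtype.ext H.sq_left) s with h | h <;>
        simp [h]
    have e2 : s (s ⟨β, h2⟩) = ⟨β, h2⟩ := by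
      rcases apply_eq_or_neg (γ := ⟨β, h2⟩) (g := b) (Subtype.ext H.sq_right) s with h | h <;>
        simp [h]
    ext x
    obtain ⟨c, hc⟩ := (mem_adjoin_pair H.sq_left H.sq_right).1 x.2
    have hx : x = algebraMap K _ (c 0) + algebraMap K _ (c 1) * ⟨α, h1⟩ +
        algebraMap K _ (c 2) * ⟨β, h2⟩ + algebraMap K _ (c 3) * (⟨α, h1⟩ * ⟨β, h2⟩) :=
      Subtype.ext hc
    rw [hx]
    simp only [sq, AlgEquiv.mul_apply, map_add, map_mul, AlgEquiv.commutes, e1, e2,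
      AlgEquiv.one_apply]
  have hdvd : Monoid.exponent Gal(adjoin K {α, β}/K) ∣ 2 := Monoid.exponent_dvd_of_forall_pow_eq_one hsq
  rcases (Nat.dvd_prime Nat.prime_two).1 hdvd with h | h
  · rw [Monoid.exp_eq_one_iff] at h
    rw [Nat.card_of_subsingleton 1] at hcard
    norm_num at hcard
  · exact h

/-- The elements of the base whose square root lies in a biquadratic extension. -/
theorem eq_mul_of_sq_mem [IsGalois K Ω] [CharZero K] {γ : Ω} {g : K}
    (hγ : γ ^ 2 = algebraMap K Ω g) (hmem : γ ∈ adjoin K {α, β}) :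
    ∃ k : K, g = k ^ 2 ∨ g = k ^ 2 * a ∨ g = k ^ 2 * b ∨ g = k ^ 2 * (a * b) := by
  obtain ⟨c, rfl⟩ := (mem_adjoin_pair H.sq_left H.sq_right).1 hmem
  have hinj := (algebraMap K Ω).injective
  have hz : ∀ x : K, x = -x → x = 0 := fun x hx => by simpa using self_eq_neg.1 hx
  have hneg : ∀ d : Fin 4 → K, - biquadElt α β d = biquadElt α β (-d) := fun d => by
    simp only [biquadElt, Pi.neg_apply, map_neg]; ring
  have h1 := apply_eq_or_neg hγ σ
  have h2 := apply_eq_or_neg hγ τ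
  rw [H.fst_biquadElt, hneg] at h1
  rw [H.snd_biquadElt, hneg] at h2
  have hfin : ∀ d : Fin 4 → K, c = d → biquadElt α β d ^ 2 = algebraMap K Ω g := by
    rintro d rfl; exact hγ
  have hc : c = ![c 0, c 1, c 2, c 3] := by ext i; fin_cases i <;> rfl
  -- `γ` is an eigenvector of both `σ` and `τ`. Each of the four pairs of signs leaves a single
  -- coordinate alive.
  rcases h1 with h1 | h1 <;> rcases h2 with h2 | h2
  · replace h1 := H.coord_injective h1
    replace h2 := H.coord_injective h2
    rw [hz (c 1) (congrFun h2 1).symm, hz (c 2) (congrFun h1 2).symm, hz (c 3) (congrFun h1 3).symm] at hc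
    refine ⟨c 0, Or.inl (hinj ?_)⟩
    rw [← hfin _ hc]; simp [biquadElt]
  · replace h1 := H.coord_injective h1
    replace h2 := H.coord_injective h2
    rw [hz (c 0) (congrFun h2 0), hz (c 2) (congrFun h1 2).symm, hz (c 3) (congrFun h1 3).symm] at hc
    refine ⟨c 1, Or.inr (Or.inl (hinj ?_))⟩
    rw [← hfin _ hc]; simp [biquadElt, mul_pow, H.sq_left]
  · replace h1 := H.coord_injective h1
    replace h2 := H.coord_injective h2
    rw [hz (c 0) (congrFun h1 0), hz (c 1) (congrFun h1 1), hz (c 3) (congrFun h2 3).symm] at hc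
    refine ⟨c 2, Or.inr (Or.inr (Or.inl (hinj ?_)))⟩
    rw [← hfin _ hc]; simp [biquadElt, mul_pow, H.sq_right]
  · replace h1 := H.coord_injective h1
    replace h2 := H.coord_injective h2
    rw [hz (c 0) (congrFun h1 0), hz (c 1) (congrFun h1 1), hz (c 2) (congrFun h2 2)] at hc
    refine ⟨c 3, Or.inr (Or.inr (Or.inr (hinj ?_)))⟩
    rw [← hfin _ hc]; simp [biquadElt, mul_pow, H.sq_left, H.sq_right]

end IsBiquadratic

end Biquadratic

end TwoAdic

/-! ### Totally ramified biquadratic extensions -/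

namespace TwoAdic

open IntermediateField

section Ramified

variable {K Ω : Type*} [Field K] [Field Ω] [Algebra K Ω] {v : AbsoluteValue Ω ℝ}
  (hv : IsNonarchimedean v) {π : K} {e : ℕ} (h : IsDyadic (restrictAbv v K) π e)
include h

theorem abv_algebraMap_pos : 0 < v (algebraMap K Ω π) := h.abv_pos

theorem sq_abv_algebraMap_ne (k : K) : v (algebraMap K Ω k) ^ 2 ≠ v (algebraMap K Ω π) := by
  intro hk
  have hπ := abv_algebraMap_pos h
  have hk0 : k ≠ 0 := by
    rintro rfl
    rw [map_zero, map_zero, zero_pow two_ne_zero] at hk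
    exact hπ.ne hk
  obtain ⟨n, hn⟩ := h.discrete k hk0
  rw [restrictAbv_apply] at hn
  rw [hn, ← zpow_natCast, ← zpow_mul] at hk
  have := h.zpow_inj (m := n * (2 : ℕ)) (n := 1) (by rw [zpow_one]; exact hk)
  push_cast at this
  omega

theorem right_coeff_ne_zero {α : Ω} {k₀ k₁ : K}
    (hz : v (algebraMap K Ω k₀ + algebraMap K Ω k₁ * α) ^ 2 = v (algebraMap K Ω π)) : k₁ ≠ 0 := by
  rintro rfl
  rw [map_zero, zero_mul, add_zero] at hz
  exact sq_abv_algebraMap_ne h _ hz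

include hv in
/-- Among the integral elements of a ramified quadratic extension, a uniformiser is moved most by
conjugation. -/
theorem abv_two_mul_le {α : Ω} {k₀ k₁ p r : K}
    (hz : v (algebraMap K Ω k₀ + algebraMap K Ω k₁ * α) ^ 2 = v (algebraMap K Ω π))
    (hx : v (algebraMap K Ω p + algebraMap K Ω r * α) ≤ 1) :
    v (2 * (algebraMap K Ω r * α)) ≤ v (2 * (algebraMap K Ω k₁ * α)) := by
  have hk₁ := right_coeff_ne_zero h hz
  have hk₁' : algebraMap K Ω k₁ ≠ 0 := (map_ne_zero _).2 hk₁
  -- Rewritten in terms of the uniformiser, the integral element has coefficient `r / k₁`. That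
  -- coefficient must be integral, and it is the ratio of the two conjugate differences.
  have h1 := (abv_le_of_sq_eq hv h hz (p - r / k₁ * k₀) (r / k₁)).2
  rw [show algebraMap K Ω (p - r / k₁ * k₀) + algebraMap K Ω (r / k₁) *
    (algebraMap K Ω k₀ + algebraMap K Ω k₁ * α) = algebraMap K Ω p + algebraMap K Ω r * α by
      simp only [map_sub, map_mul, map_div₀]; field_simp; ring] at h1
  have h2 := abv_le_one_of_mul_pow_le h (i := 1) (by norm_num) hz
    (by rw [pow_one]; exact h1.trans hx)
  rw [show 2 * (algebraMap K Ω r * α) = algebraMap K Ω (r / k₁) * (2 * (algebraMap K Ω k₁ * α)) by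
    rw [map_div₀]; field_simp, map_mul]
  exact mul_le_of_le_one_left (v.nonneg _) h2

include hv in
/-- The different of a quadratic subextension as a product of conjugate differences of a
uniformiser of the quartic extension. -/
theorem sq_abv_conj_mul {x : Kˣ} (hx : h.depth x ≠ 0) {α : Ω} (hα : α ^ 2 = algebraMap K Ω x)
    {τ : Ω ≃ₐ[K] Ω} (hτ : τ α = -α) {w w' : Ω} (hw : v w ^ 4 = v (algebraMap K Ω π))
    (hw' : v w' = v w) {s₀ s₁ n₀ n₁ : K} (hs : w + w' = algebraMap K Ω s₀ + algebraMap K Ω s₁ * α)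
    (hn : w * w' = algebraMap K Ω n₀ + algebraMap K Ω n₁ * α) :
    v ((w - τ w) * (w - τ w')) ^ 2 = v (algebraMap K Ω π) ^ discExponent e (h.depth x) := by
  obtain ⟨k₀, k₁, hk, hd⟩ := exists_uniformizer_of_depth hv h hx hα
  have hw1 : v w < 1 := lt_one_of_pow_eq h hw
  have hn2 : v (algebraMap K Ω n₀ + algebraMap K Ω n₁ * α) ^ 2 = v (algebraMap K Ω π) := by
    rw [← hn, map_mul, hw', ← hw]; ring
  have hle : ∀ {y : Ω}, v y ^ 2 = v (algebraMap K Ω π) → v y ≤ 1 :=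
    fun hy => (lt_one_of_pow_eq h hy).le
  -- The product `w w'` is a second uniformiser of `K(α)`. Any two of them are moved equally far by
  -- conjugation.
  have heq : v (2 * (algebraMap K Ω n₁ * α)) = v (2 * (algebraMap K Ω k₁ * α)) :=
    le_antisymm (abv_two_mul_le hv h hk (hle hn2)) (abv_two_mul_le hv h hn2 (hle hk))
  have hs1 : v (2 * (algebraMap K Ω s₁ * α)) ≤ v (2 * (algebraMap K Ω n₁ * α)) := by
    refine abv_two_mul_le hv h hn2 (p := s₀) ?_
    rw [← hs]
    exact (hv _ _).trans (max_le hw1.le (hw'.trans_le hw1.le))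
  have hpos : 0 < v (2 * (algebraMap K Ω n₁ * α)) := by
    rw [heq]
    by_contra hcon
    have h0 := le_antisymm (not_lt.1 hcon) (v.nonneg _)
    rw [h0] at hd
    have := pow_pos (abv_algebraMap_pos h) (discExponent e (h.depth x))
    rw [← hd] at this
    norm_num at this
  have h1 : τ w + τ w' = algebraMap K Ω s₀ - algebraMap K Ω s₁ * α := by
    rw [← map_add, hs]; simp [hτ, sub_eq_add_neg]
  have h2 : τ w * τ w' = algebraMap K Ω n₀ - algebraMap K Ω n₁ * α := by
    rw [← map_mul, hn]; simp [hτ, sub_eq_add_neg]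
  -- The left side is the value at `w` of the `τ`-conjugate of `(X - w)(X - w')`. Subtracting the
  -- vanishing value of the original polynomial leaves a trace and a norm contribution. The trace
  -- part is strictly smaller because it carries an extra factor `w`.
  have key : (w - τ w) * (w - τ w') =
      2 * (algebraMap K Ω s₁ * α) * w - 2 * (algebraMap K Ω n₁ * α) := by
    linear_combination (-w) * h1 + h2 + w * hs - hn
  have : v ((w - τ w) * (w - τ w')) = v (-(2 * (algebraMap K Ω n₁ * α))) := by
    apply abv_eq_of_sub_lt hv
    rw [key, sub_neg_eq_add, sub_add_cancel, v.map_neg, map_mul]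
    nlinarith [v.nonneg (2 * (algebraMap K Ω s₁ * α)), v.nonneg w]
  rw [this, v.map_neg, heq, hd]

/-- The quotient of `1 + 4c` by the unit `1 + 4d` lies in `1 + 4𝔭`, hence is a square. -/
theorem isSquare_of_one_add {c d : K} (hc : v (algebraMap K Ω c) ≤ 1)
    (hcd : v (algebraMap K Ω (c - d)) < 1) (hd : IsSquare (1 + 4 * d)) :
    IsSquare (1 + 4 * c) := by
  have hd1 : v (algebraMap K Ω d) ≤ 1 := by
    have := abv_sub_le h.nonarch c (c - d)
    rw [sub_sub_cancel] at this
    exact this.trans (max_le hc hcd.le)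
  have hu : restrictAbv v K (1 + 4 * d) = 1 := by
    apply abv_one_add h.nonarch
    rw [map_mul]
    exact mul_lt_one_of_nonneg_of_lt_one_left (AbsoluteValue.nonneg _ _) h.abv_four_lt hd1
  have hu0 : 1 + 4 * d ≠ 0 := by
    intro h0; rw [h0, map_zero] at hu; exact zero_ne_one hu
  have := h.hensel ((c - d) / (1 + 4 * d)) (by rw [map_div₀, hu, div_one]; exact hcd)
  have h1 := hd.mul this
  rwa [show (1 + 4 * d) * (1 + 4 * ((c - d) / (1 + 4 * d))) = 1 + 4 * c by field_simp; ring] at h1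

variable [CharZero K]

include hv in
/-- In a totally ramified extension, units of `K` in `1 + 4𝒪` are squares only if they are so
in `K`. -/
theorem isSquare_of_mem_level {n : ℕ} (hn0 : 0 < n) {w : Ω} (hw : v w ^ n = v (algebraMap K Ω π))
    {L : IntermediateField K Ω}
    (hspan : ∀ x ∈ L, ∃ k : Fin n → K, x = ∑ i, algebraMap K Ω (k i) * w ^ (i : ℕ))
    {g : Kˣ} (hg : g ∈ h.level e) {γ : Ω} (hγ : γ ∈ L) (hγg : γ ^ 2 = algebraMap K Ω g) :
    IsSquare (g : K) := by
  have : CharZero Ω := charZero_of_injective_algebraMap (algebraMap K Ω).injective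
  obtain ⟨y, c, hc, hy⟩ := h.mem_level_e.1 hg
  have hy0 : y ≠ 0 := by
    rintro rfl
    have := abv_one_add h.nonarch (x := 4 * c) (by
      rw [map_mul]; exact mul_lt_one_of_nonneg_of_lt_one_left (AbsoluteValue.nonneg _ _)
        h.abv_four_lt hc)
    rw [← hy] at this; simp at this
  -- This is a root of the Artin–Schreier equation `T ^ 2 + T = c` in `L`. Its expansion in powers
  -- of `w` is congruent to the constant term `k 0`, so the equation is already solvable modulo the
  -- maximal ideal of `K`.
  set η : Ω := (γ * algebraMap K Ω y - 1) / 2 with hη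
  have hη2 : η ^ 2 + η = algebraMap K Ω c := by
    have h1 := congrArg (algebraMap K Ω) hy
    simp only [map_mul, map_add, map_pow, map_one, map_ofNat, ← hγg] at h1
    rw [hη]
    linear_combination h1 / 4
  have hηL : η ∈ L := by
    refine div_mem (sub_mem (mul_mem hγ (IntermediateField.algebraMap_mem _ _)) (one_mem _)) ?_
    exact ofNat_mem L 2
  obtain ⟨k, hk⟩ := hspan η hηL
  have hη1 : v η ≤ 1 := by
    by_contra hcon
    push Not at hcon
    have h1 : v (η + 1) = v η := abv_eq_of_sub_lt hv (by simpa using hcon)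
    have h2 : v (η * (η + 1)) ≤ 1 := by
      rw [show η * (η + 1) = η ^ 2 + η by ring, hη2]; exact hc
    rw [map_mul, h1] at h2
    nlinarith
  have hterm : ∀ i, v (algebraMap K Ω (k i) * w ^ (i : ℕ)) ≤ 1 := fun i => by
    have := abv_term_le hv h hw k i
    rw [← hk] at this
    exact this.trans hη1
  have : NeZero n := ⟨hn0.ne'⟩
  have hk0 : v (algebraMap K Ω (k 0)) ≤ 1 := by simpa using hterm 0
  have hdiff : v (η - algebraMap K Ω (k 0)) < 1 := by
    rw [hk, ← Finset.add_sum_erase _ _ (Finset.mem_univ (0 : Fin n))]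
    simp only [Fin.val_zero, pow_zero, mul_one, add_sub_cancel_left]
    rcases (Finset.univ.erase (0 : Fin n)).eq_empty_or_nonempty with hem | hne
    · rw [hem]; simp
    · obtain ⟨i, hi, hle⟩ := IsNonarchimedean.finset_image_add_of_nonempty hv
        (fun i : Fin n => algebraMap K Ω (k i) * w ^ (i : ℕ)) hne
      refine hle.trans_lt (abv_mul_pow_lt_one h i.2 ?_ hw (hterm i))
      have := Finset.ne_of_mem_erase hi
      exact fun h0 => this (Fin.ext (by simpa using h0))
  have hsq : IsSquare (1 + 4 * c) := by
    refine isSquare_of_one_add h hc (d := k 0 ^ 2 + k 0) ?_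
      ⟨1 + 2 * k 0, by ring⟩
    rw [map_sub, ← hη2, map_add, map_pow, show η ^ 2 + η - (algebraMap K Ω (k 0) ^ 2 +
      algebraMap K Ω (k 0)) = (η - algebraMap K Ω (k 0)) * (η + algebraMap K Ω (k 0) + 1) by ring,
      map_mul]
    refine mul_lt_one_of_nonneg_of_lt_one_left (v.nonneg _) hdiff ?_
    refine (hv _ _).trans (max_le ((hv _ _).trans (max_le hη1 hk0)) ?_)
    simp
  rw [← hy] at hsq
  obtain ⟨d, hd⟩ := hsq
  refine ⟨d / y, ?_⟩
  field_simp
  rw [hd, sq]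

variable [IsGalois K Ω] [IsAlgClosed Ω]

include hv in
/-- A biquadratic extension without unramified quadratic subextension has an element of
valuation `1 / 4`. -/
theorem exists_quartic_uniformizer (hinv : ∀ (s : Ω ≃ₐ[K] Ω) (x : Ω), v (s x) = v x)
    {a b : Kˣ} {α β : Ω} (hα : α ^ 2 = algebraMap K Ω a) (hβ : β ^ 2 = algebraMap K Ω b)
    (ha : a ∉ h.level e) (hb : b ∉ h.level e) (hab : a * b ∉ h.level e) :
    ∃ w ∈ adjoin K {α, β}, v w ^ 4 = v (algebraMap K Ω π) := by
  obtain ⟨k₀, k₁, hz, -⟩ := exists_uniformizer_of_depth hv h (mt h.depth_eq_zero_iff.1 ha) hα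
  have hk₁ := right_coeff_ne_zero h hz
  have hk₁' : algebraMap K Ω k₁ ≠ 0 := (map_ne_zero _).2 hk₁
  have hmem : ∀ p r : K, algebraMap K Ω p + algebraMap K Ω r * α ∈ K⟮α⟯ := fun p r =>
    (mem_adjoin_sqrt hα).2 ⟨p, r, rfl⟩
  set z : K⟮α⟯ := ⟨algebraMap K Ω k₀ + algebraMap K Ω k₁ * α, hmem _ _⟩ with hzdef
  have hE : ∀ x : K⟮α⟯, ∃ l₀ l₁ : K,
      x = algebraMap K K⟮α⟯ l₀ + algebraMap K K⟮α⟯ l₁ * z := by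
    rintro ⟨x, hx⟩
    obtain ⟨p, r, rfl⟩ := (mem_adjoin_sqrt hα).1 hx
    refine ⟨p - r / k₁ * k₀, r / k₁, Subtype.ext ?_⟩
    change _ = algebraMap K Ω (p - r / k₁ * k₀) + algebraMap K Ω (r / k₁) *
      (algebraMap K Ω k₀ + algebraMap K Ω k₁ * α)
    simp only [map_sub, map_mul, map_div₀]; field_simp; ring
  have hEd : IsDyadic (restrictAbv v K⟮α⟯) z (2 * e) :=
    isDyadic_of_sq_eq (E := K⟮α⟯) hv h (fun s x => hinv (s.restrictScalars K) x) hz hE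
  set b' : K⟮α⟯ˣ := Units.map (algebraMap K K⟮α⟯).toMonoidHom b with hb'
  have hβ' : β ^ 2 = algebraMap K⟮α⟯ Ω b' := by rw [hβ]; rfl
  -- Suppose `b` has depth zero over `K(α)`. The constant `c` may be replaced by its `K`-part `c₀`,
  -- so `b (1 + 4 c₀)` becomes a square in `K(α)`. Then `b` or `a b` times `1 + 4 c₀` is a square in
  -- `K`, and so one of them has depth zero over `K`.
  by_cases hlev : b' ∈ hEd.level (2 * e)
  · exfalso
    obtain ⟨y, c, hc, hy⟩ := hEd.mem_level_e.1 hlev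
    obtain ⟨c₀, c₁, rfl⟩ := hE c
    have hval : ∀ l : K, restrictAbv v K⟮α⟯ (algebraMap K K⟮α⟯ l) = v (algebraMap K Ω l) :=
      fun l => rfl
    obtain ⟨h0, h1⟩ := abv_le_of_sq_eq hv h hz c₀ c₁
    have hc' : v (algebraMap K Ω c₀ + algebraMap K Ω c₁ *
      (algebraMap K Ω k₀ + algebraMap K Ω k₁ * α)) ≤ 1 := hc
    have hc1 : restrictAbv v K⟮α⟯ (algebraMap K K⟮α⟯ c₁ * z) < 1 := by
      have := abv_mul_pow_lt_one h (i := 1) (by norm_num) one_ne_zero hz (k := c₁)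
        (by rw [pow_one]; exact h1.trans hc')
      rwa [pow_one] at this
    have hsmall : restrictAbv v K (4 * c₀) < 1 := by
      rw [map_mul]
      exact mul_lt_one_of_nonneg_of_lt_one_left (AbsoluteValue.nonneg _ _) h.abv_four_lt
        (h0.trans hc')
    have hu0 : 1 + 4 * c₀ ≠ 0 := h.one_add_ne_zero hsmall
    have hu : v (algebraMap K Ω (1 + 4 * c₀)) = 1 := abv_one_add h.nonarch hsmall
    have hu0' : algebraMap K K⟮α⟯ (1 + 4 * c₀) ≠ 0 := (map_ne_zero _).2 hu0
    obtain ⟨t, ht⟩ := hEd.hensel (algebraMap K K⟮α⟯ c₁ * z / algebraMap K K⟮α⟯ (1 + 4 * c₀)) (by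
      rw [map_div₀, hval, hu, div_one]; exact hc1)
    have hy1 : (b' : K⟮α⟯) * y ^ 2 = algebraMap K K⟮α⟯ (1 + 4 * c₀) * (t * t) := by
      rw [hy, ← ht]
      field_simp
      simp only [map_add, map_mul, map_one, map_ofNat]
      ring
    have hy0 : y ≠ 0 := by
      rintro rfl
      rw [zero_pow two_ne_zero, mul_zero, eq_comm, mul_eq_zero, or_iff_right hu0'] at hy1
      have := hEd.one_add_ne_zero (x := 4 * (algebraMap K K⟮α⟯ c₁ * z /
        algebraMap K K⟮α⟯ (1 + 4 * c₀))) (by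
          rw [map_mul, map_div₀, hval, hu, div_one]
          exact mul_lt_one_of_nonneg_of_lt_one_left (AbsoluteValue.nonneg _ _) hEd.abv_four_lt
            hc1.le)
      rw [ht] at this
      exact this hy1
    have hroot : (algebraMap K K⟮α⟯ (1 + 4 * c₀) * t / y) ^ 2 =
        algebraMap K K⟮α⟯ ((1 + 4 * c₀) * b) := by
      have hb'' : (b' : K⟮α⟯) = algebraMap K K⟮α⟯ b := rfl
      rw [map_mul, ← hb'', div_pow, div_eq_iff (pow_ne_zero 2 hy0)]
      linear_combination (-algebraMap K K⟮α⟯ (1 + 4 * c₀)) * hy1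
    have hroot' := congrArg (algebraMap K⟮α⟯ Ω) hroot
    rw [map_pow, ← IsScalarTower.algebraMap_apply] at hroot'
    have hlevel : ∀ (x : Kˣ) (d : K), (x : K) * (1 + 4 * c₀) = d * d → x ∈ h.level e := by
      intro x d hd
      have hd0 : d ≠ 0 := by
        rintro rfl
        rw [mul_zero] at hd
        exact mul_ne_zero x.ne_zero hu0 hd
      refine h.mem_level_e.2 ⟨(1 + 4 * c₀) / d, c₀, h0.trans hc', ?_⟩
      rw [div_pow, ← mul_div_assoc, div_eq_iff (pow_ne_zero 2 hd0)]
      linear_combination (1 + 4 * c₀) * hd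
    refine notMem_adjoin_sqrt hα hroot' ?_ ?_ ?_ (algebraMap K K⟮α⟯ (1 + 4 * c₀) * t / y).2
    · rintro ⟨d, hd⟩
      have hd0 : d ≠ 0 := by rintro rfl; simp at hd
      exact ha (h.square_le_level e ⟨Units.mk0 d hd0, Units.ext hd⟩)
    · rintro ⟨d, hd⟩
      exact hb (hlevel b d (by rw [← hd, mul_comm]))
    · rintro ⟨d, hd⟩
      exact hab (hlevel (a * b) d (by rw [← hd, Units.val_mul]; ring))
  -- Otherwise the quadratic construction is repeated over `K(α)`, and it halves the valuation of
  -- `z`.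
  · obtain ⟨l₀, l₁, hl, -⟩ := exists_uniformizer_of_depth hv hEd
      (mt hEd.depth_eq_zero_iff.1 hlev) hβ'
    have hle : K⟮α⟯ ≤ adjoin K {α, β} := adjoin.mono K _ _ (by simp)
    refine ⟨_, add_mem (hle l₀.2) (mul_mem (hle l₁.2) (subset_adjoin K _ (show β ∈ ({α, β} : Set Ω) by
      simp))), ?_⟩
    have hz' : v (algebraMap K⟮α⟯ Ω z) ^ 2 = v (algebraMap K Ω π) := hz
    rw [← hz', ← hl, ← pow_mul]
    rfl

end Ramified

end TwoAdic

/-! ### Discriminant of a power basis -/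

namespace TwoAdic

open IntermediateField

section Discriminant

variable {K Ω : Type*} [Field K] [Field Ω] [Algebra K Ω] {v : AbsoluteValue Ω ℝ}
  (hv : IsNonarchimedean v) {π : K} {e : ℕ} (h : IsDyadic (restrictAbv v K) π e)
include hv h

theorem linearIndependent_pow {n : ℕ} {L : IntermediateField K Ω} {w : L}
    (hw : v w ^ n = v (algebraMap K Ω π)) :
    LinearIndependent K fun i : Fin n => w ^ (i : ℕ) := by
  rw [Fintype.linearIndependent_iff]
  intro k hk i
  have h1 := abv_term_le hv h hw k i
  have h2 := congrArg (algebraMap L Ω) hk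
  simp only [Algebra.smul_def, map_sum, map_mul, map_pow, map_zero,
    ← IsScalarTower.algebraMap_apply] at h2
  have h3 : ∑ j, algebraMap K Ω (k j) * (w : Ω) ^ (j : ℕ) = 0 := h2
  rw [h3, map_zero] at h1
  have h4 := v.eq_zero.1 (le_antisymm h1 (v.nonneg _))
  rcases mul_eq_zero.1 h4 with h5 | h5
  · exact (map_eq_zero _).1 h5
  · have h6 := eq_zero_of_pow_eq_zero h5
    have hn : n ≠ 0 := by rintro rfl; exact i.elim0
    rw [h6, map_zero, zero_pow hn] at hw
    exact absurd hw (abv_algebraMap_pos h).ne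

/-- The powers of an element of valuation `1 / n` as a basis of an extension of degree `n`. -/
noncomputable def powBasis {n : ℕ} (hn : 0 < n) {L : IntermediateField K Ω}
    (hL : Module.finrank K L = n) {w : L} (hw : v w ^ n = v (algebraMap K Ω π)) :
    Module.Basis (Fin n) K L :=
  haveI : Nonempty (Fin n) := ⟨⟨0, hn⟩⟩
  basisOfLinearIndependentOfCardEqFinrank (linearIndependent_pow hv h hw) (by simp [hL])

theorem powBasis_apply {n : ℕ} (hn : 0 < n) {L : IntermediateField K Ω}
    (hL : Module.finrank K L = n) {w : L} (hw : v w ^ n = v (algebraMap K Ω π)) (i : Fin n) :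
    powBasis hv h hn hL hw i = w ^ (i : ℕ) := by
  simp [powBasis]

theorem exists_eq_sum_pow {n : ℕ} (hn : 0 < n) {L : IntermediateField K Ω}
    (hL : Module.finrank K L = n) {w : L} (hw : v w ^ n = v (algebraMap K Ω π)) {x : Ω}
    (hx : x ∈ L) : ∃ k : Fin n → K, x = ∑ i, algebraMap K Ω (k i) * (w : Ω) ^ (i : ℕ) := by
  refine ⟨(powBasis hv h hn hL hw).repr ⟨x, hx⟩, ?_⟩
  have h1 := congrArg (algebraMap L Ω) ((powBasis hv h hn hL hw).sum_repr ⟨x, hx⟩)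
  simp only [Algebra.smul_def, map_sum, map_mul, map_pow, powBasis_apply,
    ← IsScalarTower.algebraMap_apply] at h1
  exact h1.symm

omit hv h in
/-- The discriminant of a power family in a biquadratic extension. -/
theorem IsBiquadratic.discr_pow [IsGalois K Ω] [IsAlgClosed Ω] [CharZero K] {a b : K} {α β : Ω}
    {σ τ : Ω ≃ₐ[K] Ω} (H : IsBiquadratic a b α β σ τ) (w : adjoin K {α, β}) :
    algebraMap K Ω (Algebra.discr K fun i : Fin 4 => w ^ (i : ℕ)) =
      ((σ w - w) * (τ w - w) * (σ (τ w) - w) * ((τ w - σ w) * (σ (τ w) - σ w)) *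
        (σ (τ w) - τ w)) ^ 2 := by
  have : CharZero Ω := charZero_of_injective_algebraMap (algebraMap K Ω).injective
  have h1 : α ∈ (adjoin K {α, β}) := subset_adjoin K _ (by simp)
  have h2 : β ∈ (adjoin K {α, β}) := subset_adjoin K _ (by simp)
  have hfd : FiniteDimensional K (adjoin K {α, β}) :=
    Module.finite_of_finrank_pos (by rw [H.finrank_eq]; norm_num)
  let f : Fin 4 → ((adjoin K {α, β}) →ₐ[K] Ω) := ![val _, σ.toAlgHom.comp (val _), τ.toAlgHom.comp (val _),
    (σ.toAlgHom.comp τ.toAlgHom).comp (val _)]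
  have hα : ![α, α, -α, -α] = fun i => f i ⟨α, h1⟩ := by
    ext i; fin_cases i <;> simp [f, H.fst_left, H.snd_left]
  have hβ : ![β, -β, β, -β] = fun i => f i ⟨β, h2⟩ := by
    ext i; fin_cases i <;> simp [f, H.fst_right, H.snd_right]
  have hinj : Function.Injective f := by
    intro i j hij
    have e1 : ![α, α, -α, -α] i = ![α, α, -α, -α] j := by rw [hα]; simp only [hij]
    have e2 : ![β, -β, β, -β] i = ![β, -β, β, -β] j := by rw [hβ]; simp only [hij]
    have h3 := H.left_ne
    have h4 := H.right_ne
    fin_cases i <;> fin_cases j <;>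
      simp [self_eq_neg, neg_eq_self, h3, h4] at e1 e2 ⊢
  have hbij : Function.Bijective f := by
    rw [Fintype.bijective_iff_injective_and_card]
    refine ⟨hinj, ?_⟩
    rw [AlgHom.card, H.finrank_eq, Fintype.card_fin]
  rw [Algebra.discr_eq_det_embeddingsMatrixReindex_pow_two K Ω _ (Equiv.ofBijective f hbij)]
  have hmat : Algebra.embeddingsMatrixReindex K Ω (fun i : Fin 4 => w ^ (i : ℕ))
      (Equiv.ofBijective f hbij) = (Matrix.vandermonde fun i => f i w).transpose := by
    ext i j
    simp [Algebra.embeddingsMatrixReindex, Algebra.embeddingsMatrix, Matrix.vandermonde]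
  rw [hmat, Matrix.det_transpose, Matrix.det_vandermonde, Fin.prod_univ_four,
    show Finset.Ioi (0 : Fin 4) = {1, 2, 3} by decide, show Finset.Ioi (1 : Fin 4) = {2, 3} by decide,
    show Finset.Ioi (2 : Fin 4) = {3} by decide, show Finset.Ioi (3 : Fin 4) = ∅ by decide,
    Finset.prod_insert (by decide), Finset.prod_pair (by decide), Finset.prod_pair (by decide),
    Finset.prod_singleton, Finset.prod_empty]
  simp only [f, Matrix.cons_val]
  change ((σ w - w) * ((τ w - w) * (σ (τ w) - w)) * ((τ w - σ w) * (σ (τ w) - σ w)) *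
    (σ (τ w) - τ w) * 1) ^ 2 = _
  ring

/-- The discriminant of a totally ramified biquadratic extension is the product of the
discriminants of its quadratic subextensions. -/
theorem IsBiquadratic.abv_discr [IsGalois K Ω] [IsAlgClosed Ω] [CharZero K]
    (hinv : ∀ (s : Ω ≃ₐ[K] Ω) (x : Ω), v (s x) = v x) {a b : Kˣ} {α β : Ω} {σ τ : Ω ≃ₐ[K] Ω}
    (H : IsBiquadratic (a : K) (b : K) α β σ τ) (ha : h.depth a ≠ 0) (hb : h.depth b ≠ 0)
    (hab : h.depth (a * b) ≠ 0) {w : adjoin K {α, β}}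
    (hw : v w ^ 4 = v (algebraMap K Ω π)) :
    v (algebraMap K Ω (Algebra.discr K fun i : Fin 4 => w ^ (i : ℕ))) =
      v (algebraMap K Ω π) ^ (discExponent e (h.depth a) + discExponent e (h.depth b) +
        discExponent e (h.depth (a * b))) := by
  obtain ⟨c, hc⟩ := (mem_adjoin_pair H.sq_left H.sq_right).1 w.2
  have hcomm : τ (σ (w : Ω)) = σ (τ w) := by
    rw [hc]; simp [H.fst_biquadElt, H.snd_biquadElt]
  -- For each quadratic subextension, `w'` is the conjugate of `w` over it, and the displayed
  -- coefficients are those of the relative trace and norm of `w`.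
  have e1 := sq_abv_conj_mul hv h ha H.sq_left H.snd_left hw (w' := σ w) (hinv σ w)
    (s₀ := 2 * c 0) (s₁ := 2 * c 1)
    (n₀ := c 0 ^ 2 + a * c 1 ^ 2 - b * c 2 ^ 2 - a * b * c 3 ^ 2)
    (n₁ := 2 * c 0 * c 1 - 2 * b * c 2 * c 3)
    (by
      rw [hc, H.fst_biquadElt]
      simp only [biquadElt, Matrix.cons_val, map_mul, map_neg, map_ofNat]
      ring)
    (by
      rw [hc, H.fst_biquadElt]
      simp only [biquadElt, Matrix.cons_val, map_add, map_sub, map_mul, map_pow, map_neg,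
        map_ofNat, ← H.sq_left, ← H.sq_right]
      ring)
  have e2 := sq_abv_conj_mul hv h hb H.sq_right H.fst_right hw (w' := τ w) (hinv τ w)
    (s₀ := 2 * c 0) (s₁ := 2 * c 2)
    (n₀ := c 0 ^ 2 + b * c 2 ^ 2 - a * c 1 ^ 2 - a * b * c 3 ^ 2)
    (n₁ := 2 * c 0 * c 2 - 2 * a * c 1 * c 3)
    (by
      rw [hc, H.snd_biquadElt]
      simp only [biquadElt, Matrix.cons_val, map_mul, map_neg, map_ofNat]
      ring)
    (by
      rw [hc, H.snd_biquadElt]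
      simp only [biquadElt, Matrix.cons_val, map_add, map_sub, map_mul, map_pow, map_neg,
        map_ofNat, ← H.sq_left, ← H.sq_right]
      ring)
  have e3 := sq_abv_conj_mul hv h hab (α := α * β) (by
      rw [mul_pow, H.sq_left, H.sq_right, Units.val_mul, map_mul]) (τ := σ)
    (by rw [map_mul, H.fst_left, H.fst_right, mul_neg]) hw (w' := σ (τ w))
    (by rw [hinv, hinv])
    (s₀ := 2 * c 0) (s₁ := 2 * c 3)
    (n₀ := c 0 ^ 2 + a * b * c 3 ^ 2 - a * c 1 ^ 2 - b * c 2 ^ 2)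
    (n₁ := 2 * c 0 * c 3 - 2 * c 1 * c 2)
    (by
      rw [hc, H.snd_biquadElt, H.fst_biquadElt]
      simp only [biquadElt, Matrix.cons_val, map_mul, map_neg, map_ofNat]
      ring)
    (by
      rw [hc, H.snd_biquadElt, H.fst_biquadElt]
      simp only [biquadElt, Matrix.cons_val, map_add, map_sub, map_mul, map_pow, map_neg,
        map_ofNat, ← H.sq_left, ← H.sq_right]
      ring)
  have hσσ' : σ (σ (τ (w : Ω))) = τ w := by
    rw [hc]; simp [H.fst_biquadElt, H.snd_biquadElt]
  rw [hcomm] at e1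
  rw [hσσ'] at e3
  -- The six conjugate differences fall into three pairs of equal size `A`, `B`, `C`. The
  -- discriminant has size `(A B C) ^ 4`, and the three relations give `(B C) ^ 2`, `(A C) ^ 2` and
  -- `(A B) ^ 2`.
  have d1 : v (τ (w : Ω) - σ w) = v ((w : Ω) - σ (τ w)) := by
    rw [← hinv σ (w - σ (τ w)), map_sub σ, hσσ', v.map_sub]
  have d2 : v (σ (τ (w : Ω)) - σ w) = v ((w : Ω) - τ w) := by
    rw [← map_sub σ, hinv, v.map_sub]
  have d3 : v (σ (τ (w : Ω)) - τ w) = v ((w : Ω) - σ w) := by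
    rw [← hcomm, ← map_sub τ, hinv, v.map_sub]
  rw [H.discr_pow, pow_add, pow_add, ← e1, ← e2, ← e3]
  simp only [map_mul, map_pow, d1, d2, d3, v.map_sub _ (w : Ω)]
  ring

end Discriminant

end TwoAdic

/-! ### The spectral absolute value and the ring of integers -/

namespace TwoAdic

open IsLocalRing IntermediateField

section SpectralAbv

/-- The unique extension of the `2`-adic absolute value, as an absolute value. -/
noncomputable def specAbv (F : Type*) [Field F] [Algebra ℚ_[2] F] [Algebra.IsAlgebraic ℚ_[2] F] :
    AbsoluteValue F ℝ where
  toFun := spectralNorm ℚ_[2] F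
  map_mul' := map_mul (spectralMulAlgNorm ℚ_[2] F)
  nonneg' := spectralNorm_nonneg
  eq_zero' x := ⟨fun hx => eq_zero_of_map_spectralNorm_eq_zero hx
    (Algebra.IsAlgebraic.isAlgebraic x), fun hx => by rw [hx, spectralNorm_zero]⟩
  add_le' x y := map_add_le_add (spectralMulAlgNorm ℚ_[2] F) x y

theorem isNonarchimedean_specAbv (F : Type*) [Field F] [Algebra ℚ_[2] F]
    [Algebra.IsAlgebraic ℚ_[2] F] : IsNonarchimedean (specAbv F) :=
  isNonarchimedean_spectralNorm (K := ℚ_[2]) (L := F)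

theorem specAbv_algebraMap {F E : Type*} [Field F] [Algebra ℚ_[2] F] [Algebra.IsAlgebraic ℚ_[2] F]
    [Field E] [Algebra ℚ_[2] E] [Algebra.IsAlgebraic ℚ_[2] E] [Algebra F E]
    [IsScalarTower ℚ_[2] F E] (x : F) : specAbv E (algebraMap F E x) = specAbv F x :=
  (spectralNorm.eq_of_tower (K := ℚ_[2]) (L := E) x).symm

theorem specAbv_aut {F E : Type*} [Field F] [Algebra ℚ_[2] F]
    [Field E] [Algebra ℚ_[2] E] [Algebra.IsAlgebraic ℚ_[2] E] [Algebra F E]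
    [IsScalarTower ℚ_[2] F E] (s : E ≃ₐ[F] E) (x : E) : specAbv E (s x) = specAbv E x :=
  (spectralNorm_eq_of_equiv (s.restrictScalars ℚ_[2]) x).symm

variable {F : Type*} [Field F] [Algebra ℚ_[2] F] [Algebra ℤ_[2] F] [IsScalarTower ℤ_[2] ℚ_[2] F]

section Algebraic

variable [Algebra.IsAlgebraic ℚ_[2] F]

theorem specAbv_le_one_iff {x : F} : specAbv F x ≤ 1 ↔ x ∈ ringOfIntegers F :=
  (isIntegral_iff_spectralNorm_le_one x).symm

theorem specAbv_le_one_iff_mem_range (x : F) :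
    specAbv F x ≤ 1 ↔ x ∈ Set.range (algebraMap (ringOfIntegers F) F) := by
  rw [specAbv_le_one_iff]
  exact ⟨fun hx => ⟨⟨x, hx⟩, rfl⟩, by rintro ⟨y, rfl⟩; exact y.2⟩

theorem isUnit_iff_specAbv {r : ringOfIntegers F} : IsUnit r ↔ specAbv F r = 1 := by
  constructor
  · rintro ⟨u, rfl⟩
    have h1 : specAbv F ((u : ringOfIntegers F) : F) ≤ 1 := specAbv_le_one_iff.2 u.1.2
    have h2 : specAbv F ((u⁻¹ : (ringOfIntegers F)ˣ) : ringOfIntegers F) ≤ 1 :=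
      specAbv_le_one_iff.2 (u⁻¹).1.2
    have h3 : specAbv F ((u : ringOfIntegers F) : F) *
        specAbv F ((u⁻¹ : (ringOfIntegers F)ˣ) : ringOfIntegers F) = 1 := by
      rw [← map_mul, ← Subalgebra.coe_mul, Units.mul_inv]; simp
    have h4 := AbsoluteValue.nonneg (specAbv F) ((u : ringOfIntegers F) : F)
    nlinarith
  · intro hr
    have hr0 : (r : F) ≠ 0 := by
      rw [← (specAbv F).ne_zero_iff, hr]; exact one_ne_zero
    refine IsUnit.of_mul_eq_one ⟨(r : F)⁻¹, specAbv_le_one_iff.1 ?_⟩ ?_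
    · rw [map_inv₀, hr, inv_one]
    · exact Subtype.ext (mul_inv_cancel₀ hr0)

theorem mem_maximalIdeal_iff_specAbv (r : ringOfIntegers F) :
    r ∈ maximalIdeal (ringOfIntegers F) ↔ specAbv F (algebraMap (ringOfIntegers F) F r) < 1 := by
  rw [mem_maximalIdeal, mem_nonunits_iff, isUnit_iff_specAbv]
  have h1 : specAbv F (r : F) ≤ 1 := specAbv_le_one_iff.2 r.2
  exact ⟨fun h => lt_of_le_of_ne h1 h, fun h => h.ne⟩

omit [Algebra ℤ_[2] F] [IsScalarTower ℤ_[2] ℚ_[2] F] in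
theorem specAbv_two : specAbv F 2 = 1 / 2 := by
  have h : specAbv F (algebraMap ℚ_[2] F 2) = ‖(2 : ℚ_[2])‖ := spectralNorm_extends 2
  rw [map_ofNat] at h
  rw [h]
  have := Padic.norm_p (p := 2)
  simpa using this

end Algebraic

variable [FiniteDimensional ℚ_[2] F]

instance isDedekindDomain_ringOfIntegers : IsDedekindDomain (ringOfIntegers F) :=
  integralClosure.isDedekindDomain ℤ_[2] ℚ_[2] F

instance finite_ringOfIntegers : Module.Finite ℤ_[2] (ringOfIntegers F) :=
  IsIntegralClosure.finite ℤ_[2] ℚ_[2] F _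

theorem two_mem_maximalIdeal : (2 : ringOfIntegers F) ∈ maximalIdeal (ringOfIntegers F) := by
  rw [mem_maximalIdeal_iff_specAbv, map_ofNat, specAbv_two]; norm_num

theorem two_ne_zero_ringOfIntegers : (2 : ringOfIntegers F) ≠ 0 := by
  intro h
  have h1 := congrArg (fun x : ringOfIntegers F => specAbv F (x : F)) h
  have h2 : specAbv F (2 : F) = specAbv F 0 := h1
  rw [specAbv_two, map_zero] at h2
  norm_num at h2

instance isDiscreteValuationRing_ringOfIntegers : IsDiscreteValuationRing (ringOfIntegers F) := by
  have hR : ¬ IsField (ringOfIntegers F) := by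
    intro hF
    have h1 := (isField_iff_maximalIdeal_eq.1 hF)
    have h2 := two_mem_maximalIdeal (F := F)
    rw [h1, Ideal.mem_bot] at h2
    exact two_ne_zero_ringOfIntegers h2
  have h3 : IsDiscreteValuationRing (ringOfIntegers F) ↔ IsDedekindDomain (ringOfIntegers F) :=
    (IsDiscreteValuationRing.TFAE (ringOfIntegers F) hR).out 0 2
  exact h3.2 isDedekindDomain_ringOfIntegers

omit [FiniteDimensional ℚ_[2] F] in
theorem faithfulSMul_ringOfIntegers : FaithfulSMul ℤ_[2] (ringOfIntegers F) := by
  rw [faithfulSMul_iff_algebraMap_injective]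
  refine Function.Injective.of_comp (f := algebraMap (ringOfIntegers F) F) ?_
  rw [← RingHom.coe_comp, ← IsScalarTower.algebraMap_eq, IsScalarTower.algebraMap_eq ℤ_[2] ℚ_[2] F]
  exact (algebraMap ℚ_[2] F).injective.comp (IsFractionRing.injective ℤ_[2] ℚ_[2])

theorem isLocalHom_ringOfIntegers : IsLocalHom (algebraMap ℤ_[2] (ringOfIntegers F)) :=
  have := faithfulSMul_ringOfIntegers (F := F)
  Algebra.IsIntegral.isLocalHom _ _

instance finite_residueField_ringOfIntegers : Finite (ResidueField (ringOfIntegers F)) :=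
  have := isLocalHom_ringOfIntegers (F := F)
  ResidueField.finite_of_finite (R := ℤ_[2]) inferInstance

theorem specAbv_unit (u : (ringOfIntegers F)ˣ) : specAbv F ((u : ringOfIntegers F) : F) = 1 :=
  isUnit_iff_specAbv.1 u.isUnit

theorem exists_specAbv_eq_zpow {ϖ : ringOfIntegers F} (hϖ : Irreducible ϖ) {x : F} (hx : x ≠ 0) :
    ∃ n : ℤ, specAbv F x = specAbv F ϖ ^ n := by
  have key : ∀ y : ringOfIntegers F, y ≠ 0 → ∃ n : ℕ, specAbv F y = specAbv F ϖ ^ n := by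
    intro y hy
    obtain ⟨n, u, rfl⟩ := IsDiscreteValuationRing.eq_unit_mul_pow_irreducible hy hϖ
    refine ⟨n, ?_⟩
    rw [Subalgebra.coe_mul, map_mul, specAbv_unit, one_mul, Subalgebra.coe_pow, map_pow]
  rcases le_total (specAbv F x) 1 with h | h
  · obtain ⟨n, hn⟩ := key ⟨x, specAbv_le_one_iff.1 h⟩ (fun h0 => hx (congrArg Subtype.val h0))
    exact ⟨n, by simpa using hn⟩
  · have h' : specAbv F x⁻¹ ≤ 1 := by
      rw [map_inv₀]; exact inv_le_one_of_one_le₀ h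
    obtain ⟨n, hn⟩ := key ⟨x⁻¹, specAbv_le_one_iff.1 h'⟩
      (fun h0 => inv_ne_zero hx (congrArg Subtype.val h0))
    refine ⟨-n, ?_⟩
    rw [zpow_neg, zpow_natCast, ← hn, map_inv₀, inv_inv]

/-- The maximal ideal of `R` extends to exactly the `n`-th power of that of `S`, and these powers
decrease strictly. The case `a = 2` over `ℤ_[2]` gives the absolute index; a uniformiser of `K`
gives the relative one. -/
theorem ramificationIdx_eq_of_uniformizer {R S : Type*} [CommRing R] [IsDomain R] [IsLocalRing R]
    [CommRing S] [IsDomain S] [IsDiscreteValuationRing S] [Algebra R S] [FaithfulSMul R S]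
    {a : R} (ha : maximalIdeal R = Ideal.span {a}) (ha0 : a ≠ 0) {ϖ : S} (hϖ : Irreducible ϖ)
    {u : Sˣ} {n : ℕ} (hn : n ≠ 0) (h : algebraMap R S a = u * ϖ ^ n) :
    (maximalIdeal S).ramificationIdx R = n := by
  have : Module.IsTorsionFree R S := .trans_faithfulSMul R S S
  have hS := hϖ.maximalIdeal_eq
  have hmap : (maximalIdeal R).map (algebraMap R S) = maximalIdeal S ^ n := by
    rw [ha, Ideal.map_span, Set.image_singleton, h, hS, Ideal.span_singleton_pow,
      Ideal.span_singleton_mul_left_unit u.isUnit]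
  have hlies : (maximalIdeal S).LiesOver (maximalIdeal R) := by
    refine ⟨(maximalIdeal.isMaximal R).eq_of_le (Ideal.comap_ne_top _ (Ideal.IsPrime.ne_top')) ?_⟩
    rw [← Ideal.map_le_iff_le_comap, hmap]
    exact Ideal.pow_le_self hn
  have hp : maximalIdeal R ≠ ⊥ := by
    rw [ha, Ne, Ideal.span_singleton_eq_bot]; exact ha0
  rw [← Ideal.ramificationIdx'_eq_ramificationIdx (maximalIdeal R) (maximalIdeal S) hp]
  refine Ideal.ramificationIdx'_spec hmap.le ?_
  rw [hmap, hS, Ideal.span_singleton_pow, Ideal.span_singleton_pow, Ideal.span_singleton_le_span_singleton]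
  intro hdvd
  have := (pow_dvd_pow_iff hϖ.ne_zero hϖ.not_isUnit).1 hdvd
  omega

/-- The ring of integers of a `2`-adic field has a uniformiser `ϖ`, and `|2| = |ϖ| ^ e`. -/
theorem specAbv_two_eq_pow {ϖ : ringOfIntegers F} (hϖ : Irreducible ϖ) :
    specAbv F 2 = specAbv F ϖ ^ absRamificationIdx F ∧ 0 < absRamificationIdx F := by
  obtain ⟨n, u, hn⟩ := IsDiscreteValuationRing.eq_unit_mul_pow_irreducible
    (two_ne_zero_ringOfIntegers (F := F)) hϖ
  have hn0 : n ≠ 0 := by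
    rintro rfl
    have h1 := two_mem_maximalIdeal (F := F)
    rw [hn, pow_zero, mul_one, mem_maximalIdeal] at h1
    exact h1 u.isUnit
  have := faithfulSMul_ringOfIntegers (F := F)
  have hidx : absRamificationIdx F = n := by
    refine ramificationIdx_eq_of_uniformizer (a := (2 : ℤ_[2])) ?_ two_ne_zero hϖ (u := u) hn0 ?_
    · simpa using PadicInt.maximalIdeal_eq_span_p (p := 2)
    · rw [map_ofNat, hn]
  rw [hidx]
  refine ⟨?_, Nat.pos_of_ne_zero hn0⟩
  have h1 : specAbv F (2 : F) = specAbv F ((u : ringOfIntegers F) * ϖ ^ n : ringOfIntegers F) := by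
    rw [← hn]; rfl
  rw [h1, Subalgebra.coe_mul, map_mul, specAbv_unit, one_mul, Subalgebra.coe_pow, map_pow]

theorem specAbv_uniformizer_lt_one {ϖ : ringOfIntegers F} (hϖ : Irreducible ϖ) :
    specAbv F ϖ < 1 := by
  refine (mem_maximalIdeal_iff_specAbv ϖ).1 ?_
  rw [mem_maximalIdeal]; exact hϖ.not_isUnit

theorem exists_sq_sub_mem_maximalIdeal {R : Type*} [CommRing R] [IsLocalRing R]
    [Finite (ResidueField R)] (h2 : (2 : R) ∈ maximalIdeal R) (x : R) :
    ∃ y : R, y ^ 2 - x ∈ maximalIdeal R := by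
  have hchar : ringChar (ResidueField R) = 2 := by
    refine CharP.ringChar_of_prime_eq_zero Nat.prime_two ?_
    have := (residue_eq_zero_iff (2 : R)).2 h2
    rwa [map_ofNat, ← Nat.cast_ofNat] at this
  obtain ⟨y, hy⟩ := FiniteField.isSquare_of_char_two hchar (residue R x)
  obtain ⟨y, rfl⟩ := residue_surjective y
  refine ⟨y, ?_⟩
  rw [← residue_eq_zero_iff, map_sub, hy, map_pow, sq, sub_self]

/-- Every integral element is a square modulo the maximal ideal. -/
theorem exists_sq_sub_lt_one (x : F) (hx : specAbv F x ≤ 1) : ∃ y, specAbv F (y ^ 2 - x) < 1 := by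
  obtain ⟨y, hy⟩ := exists_sq_sub_mem_maximalIdeal two_mem_maximalIdeal
    (⟨x, specAbv_le_one_iff.1 hx⟩ : ringOfIntegers F)
  have h1 := (mem_maximalIdeal_iff_specAbv _).1 hy
  rw [map_sub, map_pow] at h1
  exact ⟨_, h1⟩

end SpectralAbv

end TwoAdic

/-! ### Ramification and discriminant ideals read off from absolute values -/

namespace TwoAdic

open IsLocalRing IntermediateField

section Closure

variable {K : Type*} [Field K] [Algebra ℚ_[2] K]

omit [Algebra ℚ_[2] K] in
theorem isGalois_algebraicClosure [CharZero K] : IsGalois K (AlgebraicClosure K) := { }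

variable (K) in
theorem charZero_of_algebra_padic : CharZero K :=
  charZero_of_injective_algebraMap (algebraMap ℚ_[2] K).injective

theorem isScalarTower_algebraicClosure (L : IntermediateField K (AlgebraicClosure K)) :
    IsScalarTower ℚ_[2] L (AlgebraicClosure K) := by
  refine IsScalarTower.of_algebraMap_eq fun x => ?_
  rw [IsScalarTower.algebraMap_apply ℚ_[2] K L, IsScalarTower.algebraMap_apply ℚ_[2] K
    (AlgebraicClosure K), ← IsScalarTower.algebraMap_apply K L]

instance isAlgebraic_algebraicClosure [Algebra.IsAlgebraic ℚ_[2] K] :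
    Algebra.IsAlgebraic ℚ_[2] (AlgebraicClosure K) :=
  Algebra.IsAlgebraic.trans ℚ_[2] K (AlgebraicClosure K)

theorem specAbv_coe [Algebra.IsAlgebraic ℚ_[2] K] {L : IntermediateField K (AlgebraicClosure K)}
    (x : L) : specAbv (AlgebraicClosure K) x = specAbv L x :=
  have := isScalarTower_algebraicClosure L
  specAbv_algebraMap (F := L) (E := AlgebraicClosure K) x

variable [Algebra ℤ_[2] K] [IsScalarTower ℤ_[2] ℚ_[2] K] [FiniteDimensional ℚ_[2] K]

omit [Algebra ℤ_[2] K] [IsScalarTower ℤ_[2] ℚ_[2] K] in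
theorem restrictAbv_specAbv : restrictAbv (specAbv (AlgebraicClosure K)) K = specAbv K :=
  AbsoluteValue.ext fun x => specAbv_algebraMap (F := K) (E := AlgebraicClosure K) x

omit [Algebra ℤ_[2] K] [IsScalarTower ℤ_[2] ℚ_[2] K] in
theorem isSquare_one_add_four_mul_of_specAbv_lt_one (c : K) (hc : specAbv K c < 1) :
    IsSquare (1 + 4 * c) := by
  have := charZero_of_algebra_padic K
  have := isGalois_algebraicClosure (K := K)
  refine isSquare_one_add_four_mul (isNonarchimedean_specAbv (AlgebraicClosure K))
    (fun s x => specAbv_aut s x) c ?_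
  rw [specAbv_algebraMap]
  exact hc

theorem isDyadic_specAbv {ϖ : ringOfIntegers K} (hϖ : Irreducible ϖ) :
    IsDyadic (specAbv K) (ϖ : K) (absRamificationIdx K) where
  nonarch := isNonarchimedean_specAbv K
  ne_zero := fun h0 => hϖ.ne_zero (Subtype.ext h0)
  lt_one := specAbv_uniformizer_lt_one hϖ
  discrete := fun _ hx => exists_specAbv_eq_zpow hϖ hx
  two := (specAbv_two_eq_pow hϖ).1
  pos := (specAbv_two_eq_pow hϖ).2
  perfect := exists_sq_sub_lt_one
  hensel := isSquare_one_add_four_mul_of_specAbv_lt_one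

theorem isDyadic_restrictAbv_specAbv {ϖ : ringOfIntegers K} (hϖ : Irreducible ϖ) :
    IsDyadic (restrictAbv (specAbv (AlgebraicClosure K)) K) (ϖ : K) (absRamificationIdx K) :=
  restrictAbv_specAbv (K := K) ▸ isDyadic_specAbv hϖ

section Finite

variable {L : IntermediateField K (AlgebraicClosure K)} [FiniteDimensional K L]

omit [Algebra ℤ_[2] K] [IsScalarTower ℤ_[2] ℚ_[2] K] in
theorem finiteDimensional_padic : FiniteDimensional ℚ_[2] L := FiniteDimensional.trans ℚ_[2] K L

omit [Algebra ℚ_[2] K] [IsScalarTower ℤ_[2] ℚ_[2] K] [FiniteDimensional ℚ_[2] K]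
  [FiniteDimensional K L] in
theorem coe_algebraMap_ringOfIntegers (x : ringOfIntegers K) :
    ((algebraMap (ringOfIntegers K) (ringOfIntegers L) x : ringOfIntegers L) : L) =
      algebraMap K L (x : K) := rfl

omit [IsScalarTower ℤ_[2] ℚ_[2] K] [FiniteDimensional ℚ_[2] K] [FiniteDimensional K L] in
theorem faithfulSMul_ringOfIntegers_extension :
    FaithfulSMul (ringOfIntegers K) (ringOfIntegers L) := by
  rw [faithfulSMul_iff_algebraMap_injective]
  intro x y hxy
  have h1 := congrArg Subtype.val hxy
  rw [coe_algebraMap_ringOfIntegers, coe_algebraMap_ringOfIntegers] at h1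
  exact Subtype.ext ((algebraMap K L).injective h1)

/-- The ramification index in terms of absolute values of uniformisers. -/
theorem exists_uniformizer_pow_eq {ϖ : ringOfIntegers K} (hϖ : Irreducible ϖ) :
    ∃ ψ : L, 0 < (maximalIdeal (ringOfIntegers L)).ramificationIdx (ringOfIntegers K) ∧
      specAbv (AlgebraicClosure K) ψ ^
        (maximalIdeal (ringOfIntegers L)).ramificationIdx (ringOfIntegers K) =
          specAbv (AlgebraicClosure K) (algebraMap K (AlgebraicClosure K) ϖ) ∧
      specAbv (AlgebraicClosure K) ψ < 1 ∧
      ∀ x : L, x ≠ 0 → ∃ n : ℤ,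
        specAbv (AlgebraicClosure K) x = specAbv (AlgebraicClosure K) ψ ^ n := by
  have := finiteDimensional_padic (L := L)
  have := faithfulSMul_ringOfIntegers_extension (L := L)
  obtain ⟨ψ, hψ⟩ := IsDiscreteValuationRing.exists_irreducible (ringOfIntegers L)
  have hne : algebraMap (ringOfIntegers K) (ringOfIntegers L) ϖ ≠ 0 := by
    rw [Ne, FaithfulSMul.algebraMap_eq_zero_iff]; exact hϖ.ne_zero
  obtain ⟨n, u, hn⟩ := IsDiscreteValuationRing.eq_unit_mul_pow_irreducible hne hψ
  have hval : specAbv (AlgebraicClosure K) (algebraMap K (AlgebraicClosure K) ϖ) =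
      specAbv (AlgebraicClosure K) ((ψ : L) : AlgebraicClosure K) ^ n := by
    have h1 : specAbv (AlgebraicClosure K) (algebraMap K (AlgebraicClosure K) ϖ) =
        specAbv L (algebraMap (ringOfIntegers K) (ringOfIntegers L) ϖ : ringOfIntegers L) :=
      specAbv_coe (algebraMap K L ϖ)
    rw [h1, hn, specAbv_coe, Subalgebra.coe_mul, map_mul, specAbv_unit, one_mul,
      Subalgebra.coe_pow, map_pow]
  have hn0 : n ≠ 0 := by
    rintro rfl
    rw [pow_zero] at hval
    have h1 := specAbv_uniformizer_lt_one hϖ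
    rw [← specAbv_algebraMap (E := AlgebraicClosure K)] at h1
    exact h1.ne hval
  have hidx := ramificationIdx_eq_of_uniformizer (hϖ.maximalIdeal_eq) hϖ.ne_zero hψ hn0 hn
  refine ⟨ψ, ?_, ?_, ?_, ?_⟩
  · rw [hidx]; exact Nat.pos_of_ne_zero hn0
  · rw [hidx, hval]
  · rw [specAbv_coe]; exact specAbv_uniformizer_lt_one hψ
  · intro x hx
    simp only [specAbv_coe]
    exact exists_specAbv_eq_zpow hψ hx

/-- For the converse, independence of the powers of a uniformiser `ψ` of `L` bounds the ramification
index by the degree. Writing `w` as a power of `ψ` up to absolute value shows that the degree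
divides the index. -/
theorem isTotallyRamified_iff {ϖ : ringOfIntegers K} (hϖ : Irreducible ϖ) :
    IsTotallyRamified K L ↔ ∃ w : L, specAbv (AlgebraicClosure K) w ^ Module.finrank K L =
      specAbv (AlgebraicClosure K) (algebraMap K (AlgebraicClosure K) ϖ) := by
  have hv := isNonarchimedean_specAbv (AlgebraicClosure K)
  have h := isDyadic_restrictAbv_specAbv hϖ
  obtain ⟨ψ, hpos, hψ, hψ1, hdisc⟩ := exists_uniformizer_pow_eq (L := L) hϖ
  constructor
  · intro hL
    exact ⟨ψ, by rw [← hψ, ← hL]⟩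
  · rintro ⟨w, hw⟩
    set n := (maximalIdeal (ringOfIntegers L)).ramificationIdx (ringOfIntegers K) with hn
    have hle : n ≤ Module.finrank K L := by
      have := (linearIndependent_pow hv h hψ).fintype_card_le_finrank
      simpa using this
    refine le_antisymm hle ?_
    have hfr : 0 < Module.finrank K L := Module.finrank_pos
    have hπ := abv_algebraMap_pos h
    have hw0 : w ≠ 0 := by
      rintro rfl
      rw [ZeroMemClass.coe_zero, map_zero, zero_pow hfr.ne'] at hw
      exact hπ.ne hw
    have hψ0 : 0 < specAbv (AlgebraicClosure K) ψ := by
      rcases (AbsoluteValue.nonneg (specAbv (AlgebraicClosure K)) (ψ : AlgebraicClosure K)).eq_or_lt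
        with h0 | h0
      · rw [← h0, zero_pow hpos.ne'] at hψ
        exact absurd hψ hπ.ne
      · exact h0
    obtain ⟨k, hk⟩ := hdisc w hw0
    rw [hk, ← hψ, ← zpow_natCast, ← zpow_natCast, ← zpow_mul] at hw
    have h1 := zpow_right_injective₀ hψ0 hψ1.ne hw
    change Module.finrank K L ≤ n
    have hdvd : (Module.finrank K L : ℤ) ∣ n := ⟨k, by rw [← h1, mul_comm]⟩
    exact Nat.le_of_dvd hpos (Int.natCast_dvd_natCast.1 hdvd)

/-- The discriminant ideal of a totally ramified extension is generated by the discriminant of the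
powers of a uniformiser. -/
theorem discrValuation_eq {ϖ : ringOfIntegers K} (hϖ : Irreducible ϖ) {w : L}
    (hw : specAbv (AlgebraicClosure K) w ^ Module.finrank K L =
      specAbv (AlgebraicClosure K) (algebraMap K (AlgebraicClosure K) ϖ)) {m : ℕ}
    (hm : specAbv (AlgebraicClosure K) (algebraMap K (AlgebraicClosure K)
        (Algebra.discr K fun i : Fin (Module.finrank K L) => w ^ (i : ℕ))) =
      specAbv (AlgebraicClosure K) (algebraMap K (AlgebraicClosure K) ϖ) ^ m) :
    discrValuation K L = m := by
  have hv := isNonarchimedean_specAbv (AlgebraicClosure K)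
  have h := isDyadic_restrictAbv_specAbv hϖ
  have hfr : 0 < Module.finrank K L := Module.finrank_pos
  set B := powBasis hv h hfr rfl hw with hB
  have hBv : (⇑B) = fun i : Fin (Module.finrank K L) => w ^ (i : ℕ) :=
    funext fun i => powBasis_apply hv h hfr rfl hw i
  have hres : ∀ x : K, specAbv (AlgebraicClosure K) (algebraMap K (AlgebraicClosure K) x) =
      specAbv K x := fun x => specAbv_algebraMap x
  have hπ : 0 < specAbv K (ϖ : K) := by rw [← hres]; exact abv_algebraMap_pos h
  rw [hres, hres] at hm
  have hϖ1 : specAbv K (ϖ : K) ≤ 1 := specAbv_le_one_iff.2 ϖ.2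
  have hw1 : specAbv (AlgebraicClosure K) w < 1 := lt_one_of_pow_eq h hw
  set D : ringOfIntegers K := ⟨Algebra.discr K B, specAbv_le_one_iff.1 (by
    rw [hBv, hm]; exact pow_le_one₀ hπ.le hϖ1)⟩ with hD
  have hideal : discrIdeal K L = Ideal.span {D} := by
    apply le_antisymm
    · rw [discrIdeal, Ideal.span_le]
      rintro d ⟨b, hb, hd⟩
      rw [SetLike.mem_coe, Ideal.mem_span_singleton]
      -- Terms in powers of `w` do not cancel, so integral elements have integral coordinates. Every
      -- integral basis then has discriminant equal to that of `B` times the square of an integral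
      -- determinant.
      have hint : ∀ i j, B.toMatrix b i j ∈ ringOfIntegers K := by
        intro i j
        rw [← specAbv_le_one_iff, ← hres]
        have hbj : specAbv (AlgebraicClosure K) (b j : AlgebraicClosure K) ≤ 1 := by
          rw [specAbv_coe]; exact specAbv_le_one_iff.2 (hb j)
        have hrepr := congrArg (algebraMap L (AlgebraicClosure K)) (B.sum_repr (b j))
        simp only [Algebra.smul_def, map_sum, map_mul, map_pow, hBv,
          ← IsScalarTower.algebraMap_apply] at hrepr
        have hterm := abv_term_le hv h hw (B.repr (b j)) i
        refine abv_le_one_of_mul_pow_le h i.2 hw (hterm.trans ?_)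
        have : ∑ x, algebraMap K (AlgebraicClosure K) (B.repr (b j) x) *
          (w : AlgebraicClosure K) ^ (x : ℕ) = b j := hrepr
        rw [this]; exact hbj
      let P : Matrix _ _ (ringOfIntegers K) := Matrix.of fun i j => ⟨B.toMatrix b i j, hint i j⟩
      have hP : B.toMatrix b = P.map (algebraMap (ringOfIntegers K) K) := by
        ext i j; rfl
      refine ⟨P.det ^ 2, ?_⟩
      apply FaithfulSMul.algebraMap_injective (ringOfIntegers K) K
      rw [hd, map_mul, map_pow]
      have h1 := Algebra.discr_of_matrix_vecMul B (B.toMatrix b)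
      rw [B.toMatrix_map_vecMul] at h1
      rw [h1, hP, mul_comm]
      congr 2
      rw [RingHom.map_det]; rfl
    · rw [Ideal.span_singleton_le_iff_mem]
      refine Ideal.subset_span ⟨B, fun i => ?_, rfl⟩
      rw [← specAbv_le_one_iff, ← specAbv_coe, hBv]
      change specAbv (AlgebraicClosure K) ((w : AlgebraicClosure K) ^ (i : ℕ)) ≤ 1
      rw [map_pow]
      exact pow_le_one₀ (AbsoluteValue.nonneg _ _) hw1.le
  have hD0 : D ≠ 0 := by
    intro h0
    have h1 : Algebra.discr K B = 0 := congrArg Subtype.val h0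
    rw [← hBv, h1, map_zero] at hm
    exact (pow_pos hπ m).ne hm
  obtain ⟨n, u, hn⟩ := IsDiscreteValuationRing.eq_unit_mul_pow_irreducible hD0 hϖ
  have hnm : n = m := by
    have h1 : Algebra.discr K B = ((u * ϖ ^ n : ringOfIntegers K) : K) := congrArg Subtype.val hn
    rw [← hBv, h1, Subalgebra.coe_mul, map_mul, specAbv_unit, one_mul, Subalgebra.coe_pow,
      map_pow] at hm
    exact pow_right_injective₀ hπ (specAbv_uniformizer_lt_one hϖ).ne hm
  rw [discrValuation, hideal, hn, Ideal.span_singleton_mul_left_unit u.isUnit,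
    ← Ideal.span_singleton_pow, ← hϖ.maximalIdeal_eq, hnm]
  refine emultiplicity_pow_self (IsDiscreteValuationRing.not_a_field _) ?_ m
  rw [Ideal.isUnit_iff]
  exact Ideal.IsPrime.ne_top'

end Finite

end Closure

end TwoAdic

/-! ### Counting pairs in a filtered group of exponent two -/

namespace TwoAdic

open Finset

section Pairs

variable {G : Type*} [CommGroup G] {d : G → ℕ} (hd : ∀ x y, d (x * y) ≤ max (d x) (d y))
  (hG : ∀ x : G, x * x = 1)
include hd hG

/-- The isosceles property: `y = x * (x * y)` bounds the depth of `y` in turn. -/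
theorem depth_mul_of_lt {x y : G} (hxy : d x < d y) : d (x * y) = d y := by
  have h1 := hd x y
  have h2 := hd x (x * y)
  rw [← mul_assoc, hG, one_mul] at h2
  grind

theorem depth_mul_of_gt {x y : G} (hxy : d y < d x) : d (x * y) = d x := by
  rw [mul_comm]
  exact depth_mul_of_lt hd hG hxy

variable [Fintype G]

/-- Ordered pairs generating a subgroup of order four whose nontrivial elements have positive depth
and total weight `m`. -/
noncomputable def weightedPairs (d : G → ℕ) (δ : ℕ → ℕ) (m : ℕ) : Finset (G × G) :=
  {p | 1 ≤ d p.1 ∧ 1 ≤ d p.2 ∧ 1 ≤ d (p.1 * p.2) ∧ δ (d p.1) + δ (d p.2) + δ (d (p.1 * p.2)) = m}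

omit hd hG in
theorem mem_weightedPairs {δ : ℕ → ℕ} {m : ℕ} {p : G × G} : p ∈ weightedPairs d δ m ↔
    1 ≤ d p.1 ∧ 1 ≤ d p.2 ∧ 1 ≤ d (p.1 * p.2) ∧
      δ (d p.1) + δ (d p.2) + δ (d (p.1 * p.2)) = m := by
  simp [weightedPairs]

/-- Either exactly one of `x`, `y`, `x * y` is shallower than the other two, which share a depth, or
all three depths agree. The three positions of the shallow element are exchanged by the swap and by
`(x, y) ↦ (x * y, x)`, hence the factor `3`. -/
theorem card_weightedPairs (δ : ℕ → ℕ) (m : ℕ) :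
    #(weightedPairs d δ m) =
      3 * #{p : G × G | 1 ≤ d p.1 ∧ d p.1 < d p.2 ∧ δ (d p.1) + 2 * δ (d p.2) = m} +
      #{p : G × G | 1 ≤ d p.1 ∧ d p.2 = d p.1 ∧ d (p.1 * p.2) = d p.1 ∧ 3 * δ (d p.1) = m} := by
  classical
  set A : Finset (G × G) := {p | 1 ≤ d p.1 ∧ d p.1 < d p.2 ∧ δ (d p.1) + 2 * δ (d p.2) = m} with hA
  set B : Finset (G × G) := {p | 1 ≤ d p.2 ∧ d p.2 < d p.1 ∧ δ (d p.2) + 2 * δ (d p.1) = m} with hB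
  set C : Finset (G × G) := {p | 1 ≤ d (p.1 * p.2) ∧ d (p.1 * p.2) < d p.1 ∧ d p.2 = d p.1 ∧
    δ (d (p.1 * p.2)) + 2 * δ (d p.1) = m} with hC
  set D : Finset (G × G) := {p | 1 ≤ d p.1 ∧ d p.2 = d p.1 ∧ d (p.1 * p.2) = d p.1 ∧
    3 * δ (d p.1) = m} with hD
  have hBA : #B = #A := by
    refine card_nbij' Prod.swap Prod.swap ?_ ?_ ?_ ?_ <;> intro p hp <;> simp_all
  have hCA : #C = #A := by
    refine card_nbij' (fun p => (p.1 * p.2, p.1)) (fun p => (p.2, p.2 * p.1)) ?_ ?_ ?_ ?_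
    · intro p hp
      simp_all
    · intro p hp
      have h1 : d (p.2 * p.1) = d p.2 := by
        refine depth_mul_of_gt hd hG ?_
        simp only [hA, coe_filter, mem_univ, true_and, Set.mem_ofPred_eq] at hp
        exact hp.2.1
      have h2 : p.2 * (p.2 * p.1) = p.1 := by rw [← mul_assoc, hG, one_mul]
      simp_all
    · intro p hp
      have h2 : p.1 * (p.1 * p.2) = p.2 := by rw [← mul_assoc, hG, one_mul]
      simp [h2]
    · intro p hp
      have h2 : p.2 * (p.2 * p.1) = p.1 := by rw [← mul_assoc, hG, one_mul]
      simp [h2]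
  have hP : weightedPairs d δ m = ((A ∪ B) ∪ C) ∪ D := by
    ext ⟨x, y⟩
    simp only [mem_weightedPairs, hA, hB, hC, hD, mem_union, mem_filter, mem_univ, true_and]
    rcases lt_trichotomy (d x) (d y) with h | h | h
    · rw [depth_mul_of_lt hd hG h]; grind
    · have := hd x y
      grind
    · rw [depth_mul_of_gt hd hG h]; grind
  have hAB : Disjoint A B := disjoint_filter.2 (by grind)
  have hABC : Disjoint (A ∪ B) C := disjoint_union_left.2
    ⟨disjoint_filter.2 (by grind), disjoint_filter.2 (by grind)⟩
  have hABCD : Disjoint ((A ∪ B) ∪ C) D := disjoint_union_left.2 ⟨disjoint_union_left.2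
    ⟨disjoint_filter.2 (by grind), disjoint_filter.2 (by grind)⟩, disjoint_filter.2 (by grind)⟩
  rw [hP, card_union_of_disjoint hABCD, card_union_of_disjoint hABC, card_union_of_disjoint hAB,
    hBA, hCA]
  ring

omit [CommGroup G] hd hG in
theorem card_depth_eq {c : ℕ → ℕ} (hc : ∀ j, #{x : G | d x ≤ j} = c j) (j : ℕ) :
    (#{x : G | d x = j + 1} : ℚ) = c (j + 1) - c j := by
  classical
  rw [eq_sub_iff_add_eq, ← hc, ← hc, ← Nat.cast_add, ← card_union_of_disjoint]
  · congr 2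
    ext x
    simp only [mem_union, mem_filter, mem_univ, true_and]
    omega
  · exact disjoint_filter.2 (by grind)

/-- From the elements of depth at most `j + 1` one removes those of depth at most `j` and their
translate by `x`. The two removed sets are disjoint because `x` is deeper than `j`. -/
theorem card_depth_eq_mul {c : ℕ → ℕ} (hc : ∀ j, #{x : G | d x ≤ j} = c j) {j : ℕ} {x : G}
    (hx : d x = j + 1) :
    (#{y : G | d y = j + 1 ∧ d (x * y) = j + 1} : ℚ) = c (j + 1) - 2 * c j := by
  classical
  have h1 : #{y : G | d (x * y) ≤ j} = c j := by
    rw [← hc]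
    refine card_nbij' (x * ·) (x * ·) ?_ ?_ ?_ ?_ <;> intro y hy <;>
      simp_all [← mul_assoc]
  have h2 : #{y : G | d y = j + 1 ∧ d (x * y) = j + 1} + (c j + c j) = c (j + 1) := by
    nth_rw 1 [← h1]
    rw [← hc j, ← card_union_of_disjoint, ← card_union_of_disjoint, ← hc]
    · congr 1
      ext y
      simp only [mem_union, mem_filter, mem_univ, true_and]
      have := hd x y
      have h3 := hd x (x * y)
      rw [← mul_assoc, hG, one_mul] at h3
      grind
    · rw [disjoint_union_right]
      exact ⟨disjoint_filter.2 (by grind), disjoint_filter.2 (by grind)⟩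
    · refine disjoint_filter.2 fun y _ h4 h5 => ?_
      have h3 := hd (x * y) y
      rw [mul_assoc, hG, mul_one] at h3
      grind
  rw [← h2]
  push_cast
  ring

omit [CommGroup G] hd hG in
theorem card_depth_lt_pairs {n : ℕ} (hn : ∀ x, d x ≤ n) (δ : ℕ → ℕ) (m : ℕ) :
    (#{p : G × G | 1 ≤ d p.1 ∧ d p.1 < d p.2 ∧ δ (d p.1) + 2 * δ (d p.2) = m} : ℚ) =
      ∑ j ∈ Icc 1 n, ∑ i ∈ Ico 1 j, if δ i + 2 * δ j = m then
        (#{x : G | d x = i} : ℚ) * #{x : G | d x = j} else 0 := by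
  classical
  rw [card_eq_sum_card_fiberwise (f := fun p => d p.2) (t := Icc 1 n), Nat.cast_sum]
  · refine sum_congr rfl fun j hj => ?_
    rw [card_eq_sum_card_fiberwise (f := fun p => d p.1) (t := Ico 1 j), Nat.cast_sum]
    · refine sum_congr rfl fun i hi => ?_
      rw [mem_Ico] at hi
      split_ifs with h
      · rw [← Nat.cast_mul, ← card_product]
        congr 2
        ext p
        simp only [mem_filter, mem_univ, true_and, mem_product]
        grind
      · rw [Nat.cast_eq_zero, card_eq_zero]
        ext p
        simp only [mem_filter, mem_univ, true_and, notMem_empty, iff_false]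
        grind
    · intro p hp
      simp only [coe_filter, mem_filter, mem_univ, true_and, Set.mem_ofPred_eq] at hp
      simp only [coe_Ico, Set.mem_Ico]
      grind
  · intro p hp
    simp only [coe_filter, mem_univ, true_and, Set.mem_ofPred_eq] at hp
    simp only [coe_Icc, Set.mem_Icc]
    have := hn p.2
    grind

theorem card_depth_eq_pairs {c : ℕ → ℕ} (hc : ∀ j, #{x : G | d x ≤ j} = c j) {n : ℕ}
    (hn : ∀ x, d x ≤ n) (δ : ℕ → ℕ) (m : ℕ) :
    (#{p : G × G | 1 ≤ d p.1 ∧ d p.2 = d p.1 ∧ d (p.1 * p.2) = d p.1 ∧ 3 * δ (d p.1) = m} : ℚ) =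
      ∑ j ∈ range n, if 3 * δ (j + 1) = m then
        ((c (j + 1) : ℚ) - c j) * (c (j + 1) - 2 * c j) else 0 := by
  classical
  rw [card_eq_sum_card_fiberwise (f := fun p => d p.1 - 1) (t := range n), Nat.cast_sum]
  · refine sum_congr rfl fun j hj => ?_
    split_ifs with h
    · rw [card_eq_sum_card_fiberwise (f := fun p => p.1) (t := ({x : G | d x = j + 1} : Finset G)),
        Nat.cast_sum, ← card_depth_eq hc, ← nsmul_eq_mul]
      · refine sum_eq_card_nsmul fun x hx => ?_
        rw [mem_filter] at hx
        rw [← card_depth_eq_mul hd hG hc hx.2]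
        congr 1
        refine card_nbij' (fun p => p.2) (fun y => (x, y)) ?_ ?_ ?_ ?_
        · intro p hp
          simp only [coe_filter, mem_filter, mem_univ, true_and, Set.mem_ofPred_eq] at hp ⊢
          obtain ⟨⟨⟨h1, h2, h3, h4⟩, h5⟩, rfl⟩ := hp
          grind
        · intro y hy
          simp only [coe_filter, mem_filter, mem_univ, true_and, Set.mem_ofPred_eq] at hy ⊢
          grind
        · intro p hp
          simp only [coe_filter, mem_filter, mem_univ, true_and, Set.mem_ofPred_eq] at hp
          rw [← hp.2]
        · intro y hy
          rfl
      · intro p hp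
        simp only [coe_filter, mem_filter, mem_univ, true_and, Set.mem_ofPred_eq] at hp ⊢
        grind
    · rw [Nat.cast_eq_zero, card_eq_zero]
      ext p
      simp only [mem_filter, mem_univ, true_and, notMem_empty, iff_false]
      grind
  · intro p hp
    simp only [coe_filter, mem_univ, true_and, Set.mem_ofPred_eq] at hp
    simp only [coe_range, Set.mem_Iio]
    have := hn p.1
    grind

end Pairs

end TwoAdic

/-! ### Evaluation of the sums -/

namespace TwoAdic

open Finset

section Evaluation

/-- The summand is `q ^ (-(j - 1)) - q ^ (-j)`, so the sum telescopes; the minima record truncation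
at `e`. -/
theorem sum_Icc_ite_zpow {q : ℚ} (hq : q ≠ 0) {A B : ℕ} (hAB : A ≤ B) (e : ℕ) :
    ∑ j ∈ Icc 1 e, (if A < j ∧ j ≤ B then (q - 1) * q ^ (-(j : ℤ)) else 0) =
      q ^ (-(min e A : ℕ) : ℤ) - q ^ (-(min e B : ℕ) : ℤ) := by
  induction e with
  | zero => simp
  | succ e ih =>
    rw [sum_Icc_succ_top (by omega), ih]
    split_ifs with h
    · rw [min_eq_right (by omega : A ≤ e), min_eq_left (by omega : e ≤ B),
        min_eq_right (by omega : A ≤ e + 1), min_eq_left (by omega : e + 1 ≤ B)]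
      have h1 : q ^ (-(e : ℤ)) = q * q ^ (-((e + 1 : ℕ) : ℤ)) := by
        rw [← zpow_one_add₀ hq]
        congr 1
        push_cast
        ring
      rw [h1]
      ring
    · rw [add_zero]
      by_cases h2 : e + 1 ≤ A
      · rw [min_eq_left (by omega : e ≤ A), min_eq_left (by omega : e ≤ B),
          min_eq_left h2, min_eq_left (by omega : e + 1 ≤ B)]
        ring
      · rw [min_eq_right (by omega : A ≤ e), min_eq_right (by omega : B ≤ e),
          min_eq_right (by omega : A ≤ e + 1), min_eq_right (by omega : B ≤ e + 1)]

variable {e M : ℕ} {q : ℚ} (hq : q ≠ 0) {N : ℕ → ℚ}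
  (hN : ∀ j, 1 ≤ j → j ≤ e → N j = 2 * (q - 1) * q ^ ((j : ℤ) - 1))
include hq hN

/-- The weight condition forces `i = M - 2 * j`. Then `i < j` reads `M / 3 < j`, and `1 ≤ i` reads
`j ≤ (M - 1) / 2`. -/
theorem sum_lt_pairs_of_le {j : ℕ} (hj : j ≤ e) :
    (∑ i ∈ Ico 1 j, if discExponent e i + 2 * discExponent e j = 2 * M then N i * N j else 0) =
      if M / 3 < j ∧ j ≤ (M - 1) / 2 then
        4 * (q - 1) * q ^ ((M : ℤ) - 2) * ((q - 1) * q ^ (-(j : ℤ))) else 0 := by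
  split_ifs with h
  · rw [sum_eq_single (M - 2 * j)]
    · have h1 : discExponent e (M - 2 * j) + 2 * discExponent e j = 2 * M := by
        rw [discExponent, discExponent, if_pos (by omega), if_pos hj]
        omega
      rw [if_pos h1, hN _ (by omega) (by omega), hN _ (by omega) hj, Nat.cast_sub (by omega)]
      have h2 : q ^ (((M : ℤ) - ((2 * j : ℕ) : ℤ)) - 1) * q ^ ((j : ℤ) - 1) =
          q ^ ((M : ℤ) - 2) * q ^ (-(j : ℤ)) := by
        rw [← zpow_add₀ hq, ← zpow_add₀ hq]
        congr 1
        push_cast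
        ring
      linear_combination 4 * (q - 1) ^ 2 * h2
    · intro i hi hne
      rw [mem_Ico] at hi
      refine if_neg fun h1 => hne ?_
      rw [discExponent, discExponent, if_pos (by omega), if_pos hj] at h1
      omega
    · intro h1
      rw [mem_Ico] at h1
      omega
  · refine sum_eq_zero fun i hi => if_neg fun h1 => h ?_
    rw [mem_Ico] at hi
    rw [discExponent, discExponent, if_pos (by omega), if_pos hj] at h1
    omega

/-- At the top depth the odd weight `2 * e + 1` forces `i = M - (2 * e + 1)`. The bound on `M` is
what keeps `i ≤ e`. -/
theorem sum_lt_pairs_top (hNe : N (e + 1) = 2 * q ^ e) (hM : M ≤ 3 * e + 1) :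
    (∑ i ∈ Ico 1 (e + 1),
      if discExponent e i + 2 * discExponent e (e + 1) = 2 * M then N i * N (e + 1) else 0) =
      if 2 * e + 2 ≤ M then 4 * (q - 1) * q ^ ((M : ℤ) - 2) * q ^ (-(e : ℤ)) else 0 := by
  split_ifs with h
  · rw [sum_eq_single (M - (2 * e + 1))]
    · have h1 : discExponent e (M - (2 * e + 1)) + 2 * discExponent e (e + 1) = 2 * M := by
        rw [discExponent, discExponent, if_pos (by omega), if_neg (by omega)]
        omega
      rw [if_pos h1, hN _ (by omega) (by omega), hNe, Nat.cast_sub (by omega)]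
      have h2 : q ^ (((M : ℤ) - ((2 * e + 1 : ℕ) : ℤ)) - 1) * q ^ e =
          q ^ ((M : ℤ) - 2) * q ^ (-(e : ℤ)) := by
        rw [← zpow_natCast, ← zpow_add₀ hq, ← zpow_add₀ hq]
        congr 1
        push_cast
        ring
      linear_combination 4 * (q - 1) * h2
    · intro i hi hne
      rw [mem_Ico] at hi
      refine if_neg fun h1 => hne ?_
      rw [discExponent, discExponent, if_pos (by omega), if_neg (by omega)] at h1
      omega
    · intro h1
      rw [mem_Ico] at h1
      omega
  · refine sum_eq_zero fun i hi => if_neg fun h1 => h ?_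
    rw [mem_Ico] at hi
    rw [discExponent, discExponent, if_pos (by omega), if_neg (by omega)] at h1
    omega

/-- This is the source of the indicator. For `M ≤ 2 * e + 1` the top depth contributes nothing and
the upper boundary term of the telescoped sum survives. For larger `M` that boundary term is `q ^
(-e)` and cancels against the top depth. -/
theorem sum_lt_pairs (hNe : N (e + 1) = 2 * q ^ e) (h3 : 3 ≤ M) (hM : M ≤ 3 * e + 1) :
    (∑ j ∈ Icc 1 (e + 1), ∑ i ∈ Ico 1 j,
      if discExponent e i + 2 * discExponent e j = 2 * M then N i * N j else 0) =
      4 * (q - 1) * q ^ ((M : ℤ) - 2) * (q ^ (-(M / 3 : ℕ) : ℤ) -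
        (if M ≤ 2 * e + 1 then 1 else 0) * q ^ (-((M - 1) / 2 : ℕ) : ℤ)) := by
  rw [sum_Icc_succ_top (by omega), sum_lt_pairs_top hq hN hNe hM,
    sum_congr rfl fun j hj => (sum_lt_pairs_of_le (M := M) hq hN (mem_Icc.1 hj).2).trans
      (mul_ite_zero ..).symm, ← mul_sum, sum_Icc_ite_zpow hq (by omega), min_eq_right (by omega : M / 3 ≤ e)]
  split_ifs with h1 h2 h2
  · omega
  · rw [min_eq_left (by omega)]
    ring
  · rw [min_eq_right (by omega)]
    ring
  · omega

omit hq hN in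
-- Three equal weights force the common depth `M / 3`, hence `3 ∣ M`. Depth `e + 1` gives nothing:
-- `3 * (2 * e + 1)` is odd, and the factor `c (e + 1) - 2 * c e` vanishes as well.
theorem sum_eq_pairs (hq : q ≠ 0) {c : ℕ → ℚ} (hc : ∀ j ≤ e, c j = 2 * q ^ j)
    (hce : c (e + 1) = 4 * q ^ e) (h3 : 3 ≤ M) (hM : M ≤ 3 * e + 1) :
    (∑ j ∈ range (e + 1), if 3 * discExponent e (j + 1) = 2 * M then
        (c (j + 1) - c j) * (c (j + 1) - 2 * c j) else 0) =
      4 * (q - 1) * q ^ ((M : ℤ) - 2) * ((if 3 ∣ M then 1 else 0) * (q - 2) *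
        q ^ (-(M / 3 : ℕ) : ℤ)) := by
  by_cases h : 3 ∣ M
  · obtain ⟨k, rfl⟩ := h
    obtain ⟨j, rfl⟩ : ∃ j, k = j + 1 := ⟨k - 1, by omega⟩
    rw [sum_eq_single j, if_pos (by rw [discExponent, if_pos (by omega)]; ring),
      if_pos (dvd_mul_right _ _), hc _ (by omega), hc _ (by omega),
      Nat.mul_div_cancel_left _ (by norm_num)]
    · have h2 : q ^ (((3 * (j + 1) : ℕ) : ℤ) - 2) * q ^ (-((j + 1 : ℕ) : ℤ)) = q ^ j * q ^ j := by
        rw [← zpow_natCast, ← zpow_add₀ hq, ← zpow_add₀ hq]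
        congr 1
        push_cast
        ring
      rw [pow_succ]
      linear_combination (-4) * (q - 1) * (q - 2) * h2
    · intro i hi hne
      rw [mem_range] at hi
      refine if_neg fun h1 => ?_
      rw [discExponent] at h1
      split_ifs at h1 <;> omega
    · intro h1
      rw [mem_range] at h1
      omega
  · rw [if_neg h, zero_mul, zero_mul, mul_zero]
    refine sum_eq_zero fun j hj => ?_
    rw [mem_range] at hj
    split_ifs with h1
    · rw [discExponent] at h1
      split_ifs at h1
      · omega
      · obtain rfl : j = e := by omega
        rw [hce, hc j le_rfl]
        ring
    · rfl

end Evaluation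

section Total

variable {G : Type*} [CommGroup G] [Fintype G] {d : G → ℕ}
  (hd : ∀ x y, d (x * y) ≤ max (d x) (d y)) (hG : ∀ x : G, x * x = 1)
  {e : ℕ} (hn : ∀ x, d x ≤ e + 1)
include hd hG hn

/-- The factor `6` is kept apart because it counts the ordered generating pairs of one subgroup of
order four. -/
theorem cast_card_weightedPairs {q : ℚ} (hq : q ≠ 0)
    (hc : ∀ j ≤ e, (#{x : G | d x ≤ j} : ℚ) = 2 * q ^ j) (hce : (Fintype.card G : ℚ) = 4 * q ^ e)
    {M : ℕ} (h3 : 3 ≤ M) (hM : M ≤ 3 * e + 1) :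
    (#(weightedPairs d (discExponent e) (2 * M)) : ℚ) =
      6 * (2 * (q - 1) * q ^ ((M : ℤ) - 2) * (q ^ (-(M / 3 : ℕ) : ℤ) *
        (1 + (if 3 ∣ M then 1 else 0) * ((q - 2) / 3)) -
          (if M ≤ 2 * e + 1 then 1 else 0) * q ^ (-((M - 1) / 2 : ℕ) : ℤ))) := by
  have hce' : (#{x : G | d x ≤ e + 1} : ℚ) = 4 * q ^ e := by
    rw [← hce, filter_true_of_mem fun x _ => hn x, card_univ]
  rw [card_weightedPairs hd hG, Nat.cast_add, Nat.cast_mul, card_depth_lt_pairs hn,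
    card_depth_eq_pairs hd hG (c := fun j => #{x : G | d x ≤ j}) (fun _ => rfl) hn,
    sum_lt_pairs (N := fun j => (#{x : G | d x = j} : ℚ)) hq ?_ ?_ h3 hM,
    sum_eq_pairs (c := fun j => (#{x : G | d x ≤ j} : ℚ)) hq hc hce' h3 hM]
  · push_cast
    ring
  · intro j h1 hj
    obtain ⟨i, rfl⟩ : ∃ i, j = i + 1 := ⟨j - 1, by omega⟩
    rw [card_depth_eq (c := fun j => #{x : G | d x ≤ j}) (fun _ => rfl), hc _ hj,
      hc _ (by omega), Nat.cast_succ, add_sub_cancel_right, zpow_natCast]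
    ring
  · rw [card_depth_eq (c := fun j => #{x : G | d x ≤ j}) (fun _ => rfl), hce', hc e le_rfl]
    ring

/-- The only odd weight is `2 * e + 1`, at depth `e + 1`. By the isosceles property and `htop` it
occurs either twice or not at all. The extreme sums are `3 * 2` and `2 * (2 * e + 1) + 2 * e`. -/
theorem even_of_mem_weightedPairs
    (htop : ∀ x y, d x = e + 1 → d y = e + 1 → d (x * y) ≤ e) (he : 0 < e) {m : ℕ} {p : G × G}
    (hp : p ∈ weightedPairs d (discExponent e) m) : Even m ∧ 6 ≤ m ∧ m ≤ 6 * e + 2 := by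
  rw [mem_weightedPairs] at hp
  obtain ⟨h1, h2, h3, h4⟩ := hp
  have ht := htop p.1 p.2
  have hle1 := hn p.1
  have hle2 := hn p.2
  have hmax := hd p.1 p.2
  have hlt := depth_mul_of_lt hd hG (x := p.1) (y := p.2)
  have hgt := depth_mul_of_gt hd hG (x := p.1) (y := p.2)
  generalize d p.1 = a at *
  generalize d p.2 = b at *
  generalize d (p.1 * p.2) = c at *
  rw [discExponent, discExponent, discExponent] at h4
  rcases lt_trichotomy a b with h | h | h
  · have := hlt h
    subst this
    clear hlt hgt ht
    rw [Nat.even_iff]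
    split_ifs at h4 <;> omega
  · clear hlt hgt
    rw [Nat.even_iff]
    split_ifs at h4 <;> omega
  · have := hgt h
    subst this
    clear hlt hgt ht
    rw [Nat.even_iff]
    split_ifs at h4 <;> omega

end Total

end TwoAdic

/-! ### Kummer theory for the Klein four-group -/

namespace TwoAdic

open IntermediateField

section Kummer

variable {K L : Type*} [Field K] [Field L] [Algebra K L] [FiniteDimensional K L] [IsGalois K L]
  [IsKleinFour Gal(L/K)]

omit [IsGalois K L] in
-- As `g₂` lies outside the subgroup generated by `g₁`, it moves some `u` fixed by `g₁`. Then `u -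
-- g₂ u` is the required simultaneous eigenvector.
theorem exists_apply_eq_neg {g₁ g₂ : Gal(L/K)} (h₂ : g₂ ≠ 1) (hne : g₁ ≠ g₂) :
    ∃ α : L, α ≠ 0 ∧ g₁ α = α ∧ g₂ α = -α := by
  have hsq : ∀ g : Gal(L/K), g * g = 1 := IsKleinFour.mul_self
  have hcomm : ∀ x, g₁ (g₂ x) = g₂ (g₁ x) := fun x =>
    DFunLike.congr_fun (mul_comm_of_exponent_two IsKleinFour.exponent_two g₁ g₂) x
  have hmem : g₂ ∉ Subgroup.zpowers g₁ := by
    rintro ⟨k, hk⟩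
    have hz : ∀ n : ℤ, g₁ ^ (2 * n) = 1 := fun n => by
      rw [zpow_mul, zpow_two, hsq, one_zpow]
    obtain ⟨n, rfl | rfl⟩ := Int.even_or_odd' k
    · refine h₂ ?_
      rw [← hk]
      exact hz n
    · refine hne ?_
      rw [← hk]
      change g₁ = g₁ ^ (2 * n + 1)
      rw [zpow_add, hz, one_mul, zpow_one]
  rw [← fixingSubgroup_fixedField (Subgroup.zpowers g₁), IntermediateField.mem_fixingSubgroup_iff] at hmem
  push Not at hmem
  obtain ⟨u, hu, hu2⟩ := hmem
  have hu1 : g₁ u = u := (mem_fixedField_iff _ _).1 hu g₁ (Subgroup.mem_zpowers g₁)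
  refine ⟨u - g₂ u, fun h0 => hu2 (sub_eq_zero.1 h0).symm, ?_, ?_⟩
  · rw [map_sub, hcomm, hu1]
  · rw [map_sub, ← AlgEquiv.mul_apply, hsq, AlgEquiv.one_apply, neg_sub]

theorem exists_unit_sq_eq [CharZero K] {g₁ g₂ : Gal(L/K)} (h₁ : g₁ ≠ 1) (h₂ : g₂ ≠ 1)
    (hne : g₁ ≠ g₂) {α : L} (hα : α ≠ 0) (hα₁ : g₁ α = α ∨ g₁ α = -α)
    (hα₂ : g₂ α = α ∨ g₂ α = -α) : ∃ a : Kˣ, α ^ 2 = algebraMap K L a := by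
  classical
  have : Fintype Gal(L/K) := Fintype.ofFinite _
  have h : α ^ 2 ∈ Set.range (algebraMap K L) := by
    rw [IsGalois.mem_range_algebraMap_iff_fixed]
    have h1 : g₁ (α ^ 2) = α ^ 2 := by rw [map_pow]; rcases hα₁ with h | h <;> rw [h]; exact neg_sq α
    have h2 : g₂ (α ^ 2) = α ^ 2 := by rw [map_pow]; rcases hα₂ with h | h <;> rw [h]; exact neg_sq α
    intro g
    have hg := Finset.mem_univ g
    rw [← IsKleinFour.eq_finset_univ h₁ h₂ hne] at hg
    simp only [Finset.mem_insert, Finset.mem_singleton] at hg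
    rcases hg with rfl | rfl | rfl | rfl
    · rw [AlgEquiv.mul_apply, h2, h1]
    · exact h1
    · exact h2
    · rfl
  obtain ⟨a, ha⟩ := h
  refine ⟨Units.mk0 a ?_, ha.symm⟩
  rintro rfl
  rw [map_zero] at ha
  exact pow_ne_zero 2 hα ha.symm

omit [FiniteDimensional K L] [IsGalois K L] [IsKleinFour Gal(L/K)] in
theorem not_isSquare_of_apply_eq_neg [CharZero K] {g : Gal(L/K)} {α : L} (hα : α ≠ 0)
    (hg : g α = -α) {a : K} (ha : α ^ 2 = algebraMap K L a) : ¬IsSquare a := by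
  rintro ⟨k, rfl⟩
  have : CharZero L := charZero_of_injective_algebraMap (algebraMap K L).injective
  rw [map_mul, ← sq, sq_eq_sq_iff_eq_or_eq_neg] at ha
  have h1 : g α = α := by rcases ha with rfl | rfl <;> simp
  rw [h1] at hg
  exact hα (self_eq_neg.1 hg)

variable (K L) in
/-- Kummer theory for Klein four extensions. -/
theorem exists_sqrt_generators [CharZero K] : ∃ (a b : Kˣ) (α β : L),
    α ^ 2 = algebraMap K L a ∧ β ^ 2 = algebraMap K L b ∧
      ¬IsSquare (a : K) ∧ ¬IsSquare (b : K) ∧ ¬IsSquare ((a : K) * b) := by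
  classical
  have : Fintype Gal(L/K) := Fintype.ofFinite _
  have hcard : 2 < Fintype.card Gal(L/K) := by rw [IsKleinFour.card_four']; norm_num
  obtain ⟨g₁, h₁⟩ : ∃ g : Gal(L/K), g ≠ 1 :=
    have : Nontrivial Gal(L/K) := Fintype.one_lt_card_iff_nontrivial.1 (by omega)
    exists_ne 1
  obtain ⟨g₂, h₂, hne⟩ : ∃ g : Gal(L/K), g ≠ 1 ∧ g ≠ g₁ := by
    by_contra! hcon
    have h1 : (Finset.univ : Finset Gal(L/K)) ⊆ {1, g₁} := fun g _ => by
      rw [Finset.mem_insert, Finset.mem_singleton, or_iff_not_imp_left]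
      exact hcon g
    have h2 := (Finset.card_le_card h1).trans Finset.card_le_two
    rw [Finset.card_univ] at h2
    omega
  obtain ⟨α, hα, hα1, hα2⟩ := exists_apply_eq_neg h₂ hne.symm
  obtain ⟨β, hβ, hβ2, hβ1⟩ := exists_apply_eq_neg h₁ hne
  obtain ⟨a, ha⟩ := exists_unit_sq_eq h₁ h₂ hne.symm hα (.inl hα1) (.inr hα2)
  obtain ⟨b, hb⟩ := exists_unit_sq_eq h₁ h₂ hne.symm hβ (.inr hβ1) (.inl hβ2)
  refine ⟨a, b, α, β, ha, hb, not_isSquare_of_apply_eq_neg hα hα2 ha,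
    not_isSquare_of_apply_eq_neg hβ hβ1 hb,
    not_isSquare_of_apply_eq_neg (α := α * β) (g := g₁) (mul_ne_zero hα hβ) ?_ ?_⟩
  · rw [map_mul, hα1, hβ1, mul_neg]
  · rw [mul_pow, ha, hb, map_mul]

end Kummer

/-! ### Fields generated by square classes -/

section SquareClasses

variable {K Ω : Type*} [Field K] [Field Ω] [Algebra K Ω]

theorem mk_eq_one_iff_isSquare {a : Kˣ} :
    (QuotientGroup.mk a : Kˣ ⧸ Subgroup.square Kˣ) = 1 ↔ IsSquare (a : K) := by
  rw [QuotientGroup.eq_one_iff, Subgroup.mem_square]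
  constructor
  · rintro ⟨b, rfl⟩
    exact ⟨b, by push_cast; rfl⟩
  · rintro ⟨b, hb⟩
    have hb0 : b ≠ 0 := by
      rintro rfl
      exact a.ne_zero (by rw [hb, zero_mul])
    exact ⟨Units.mk0 b hb0, Units.ext hb⟩

theorem squareClass_mul_self (x : Kˣ ⧸ Subgroup.square Kˣ) : x * x = 1 := by
  induction x using QuotientGroup.induction_on with
  | H a =>
    rw [← QuotientGroup.mk_mul, QuotientGroup.eq_one_iff, Subgroup.mem_square]
    exact ⟨a, rfl⟩

theorem squareClass_mul_eq_one_iff {x y : Kˣ ⧸ Subgroup.square Kˣ} : x * y = 1 ↔ x = y := by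
  constructor
  · intro h
    rw [← mul_one x, ← squareClass_mul_self y, ← mul_assoc, h, one_mul]
  · rintro rfl
    exact squareClass_mul_self x

variable [IsAlgClosed Ω]

variable (Ω) in
/-- A square root of a representative of a square class. -/
noncomputable def sqrtRep (x : Kˣ ⧸ Subgroup.square Kˣ) : Ω :=
  (IsAlgClosed.exists_pow_nat_eq (algebraMap K Ω (x.out : Kˣ)) two_pos).choose

theorem sqrtRep_sq (x : Kˣ ⧸ Subgroup.square Kˣ) :
    sqrtRep Ω x ^ 2 = algebraMap K Ω (x.out : Kˣ) :=
  (IsAlgClosed.exists_pow_nat_eq (algebraMap K Ω (x.out : Kˣ)) two_pos).choose_spec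

variable (Ω) in
/-- The extension generated by the square roots of two square classes. -/
noncomputable def sqrtField (p : (Kˣ ⧸ Subgroup.square Kˣ) × (Kˣ ⧸ Subgroup.square Kˣ)) :
    IntermediateField K Ω :=
  adjoin K {sqrtRep Ω p.1, sqrtRep Ω p.2}

/-- Two square classes generate a subgroup of order four. -/
def IsIndependent (p : (Kˣ ⧸ Subgroup.square Kˣ) × (Kˣ ⧸ Subgroup.square Kˣ)) : Prop :=
  p.1 ≠ 1 ∧ p.2 ≠ 1 ∧ p.1 ≠ p.2

/-- Changing the representative or the sign of the root multiplies it by an element of `K`, so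
membership in `L` depends on the square class alone. -/
theorem sqrtRep_mem_of_sq_eq {L : IntermediateField K Ω} {γ : Ω} (hγ : γ ∈ L) {a : Kˣ}
    (ha : γ ^ 2 = algebraMap K Ω a) : sqrtRep Ω (QuotientGroup.mk a) ∈ L := by
  obtain ⟨⟨b, hb⟩, hb'⟩ := QuotientGroup.mk_out_eq_mul (Subgroup.square Kˣ) a
  rw [Subgroup.mem_square] at hb
  obtain ⟨c, rfl⟩ := hb
  have h1 := sqrtRep_sq (Ω := Ω) (QuotientGroup.mk a : Kˣ ⧸ Subgroup.square Kˣ)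
  have h2 : sqrtRep Ω (QuotientGroup.mk a) ^ 2 = (algebraMap K Ω c * γ) ^ 2 := by
    rw [h1, mul_pow, ha, ← map_pow, ← map_mul]
    congr 1
    have := congrArg Units.val hb'
    push_cast at this
    exact this.trans (by ring)
  have h3 : algebraMap K Ω c * γ ∈ L := mul_mem (IntermediateField.algebraMap_mem L _) hγ
  rcases sq_eq_sq_iff_eq_or_eq_neg.1 h2 with h | h <;> rw [h]
  · exact h3
  · exact neg_mem h3

theorem IsIndependent.not_isSquare_mul {p : (Kˣ ⧸ Subgroup.square Kˣ) × (Kˣ ⧸ Subgroup.square Kˣ)}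
    (hp : IsIndependent p) : ¬IsSquare ((p.1.out : Kˣ) : K) ∧ ¬IsSquare ((p.2.out : Kˣ) : K) ∧
      ¬IsSquare (((p.1.out : Kˣ) : K) * (p.2.out : Kˣ)) := by
  have h1 : (QuotientGroup.mk p.1.out : Kˣ ⧸ Subgroup.square Kˣ) = p.1 := QuotientGroup.out_eq' _
  have h2 : (QuotientGroup.mk p.2.out : Kˣ ⧸ Subgroup.square Kˣ) = p.2 := QuotientGroup.out_eq' _
  rw [← Units.val_mul, ← mk_eq_one_iff_isSquare, ← mk_eq_one_iff_isSquare,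
    ← mk_eq_one_iff_isSquare, QuotientGroup.mk_mul, h1, h2, squareClass_mul_eq_one_iff]
  exact hp

variable [IsGalois K Ω] [CharZero K]

theorem IsIndependent.exists_isBiquadratic
    {p : (Kˣ ⧸ Subgroup.square Kˣ) × (Kˣ ⧸ Subgroup.square Kˣ)} (hp : IsIndependent p) :
    ∃ σ τ : Gal(Ω/K), IsBiquadratic ((p.1.out : Kˣ) : K) ((p.2.out : Kˣ) : K)
      (sqrtRep Ω p.1) (sqrtRep Ω p.2) σ τ :=
  TwoAdic.exists_isBiquadratic (sqrtRep_sq p.1) (sqrtRep_sq p.2) hp.not_isSquare_mul.1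
    hp.not_isSquare_mul.2.1 hp.not_isSquare_mul.2.2

theorem IsIndependent.finrank_eq
    {p : (Kˣ ⧸ Subgroup.square Kˣ) × (Kˣ ⧸ Subgroup.square Kˣ)} (hp : IsIndependent p) :
    Module.finrank K (sqrtField Ω p) = 4 := by
  obtain ⟨σ, τ, H⟩ := hp.exists_isBiquadratic (Ω := Ω)
  exact H.finrank_eq

theorem IsIndependent.finiteDimensional
    {p : (Kˣ ⧸ Subgroup.square Kˣ) × (Kˣ ⧸ Subgroup.square Kˣ)} (hp : IsIndependent p) :
    FiniteDimensional K (sqrtField Ω p) :=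
  Module.finite_of_finrank_pos (by rw [hp.finrank_eq]; norm_num)

/-- The field determines its subgroup of square classes; this is the injectivity half of Kummer
theory. -/
theorem IsIndependent.sqrtRep_mem_iff
    {p : (Kˣ ⧸ Subgroup.square Kˣ) × (Kˣ ⧸ Subgroup.square Kˣ)} (hp : IsIndependent p)
    {z : Kˣ ⧸ Subgroup.square Kˣ} :
    sqrtRep Ω z ∈ sqrtField Ω p ↔ z = 1 ∨ z = p.1 ∨ z = p.2 ∨ z = p.1 * p.2 := by
  have hm1 : sqrtRep Ω p.1 ∈ sqrtField Ω p := subset_adjoin K _ (by simp)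
  have hm2 : sqrtRep Ω p.2 ∈ sqrtField Ω p := subset_adjoin K _ (by simp)
  constructor
  · intro hz
    obtain ⟨σ, τ, H⟩ := hp.exists_isBiquadratic (Ω := Ω)
    obtain ⟨k, hk⟩ := H.eq_mul_of_sq_mem (sqrtRep_sq z) hz
    have hk0 : k ≠ 0 := by
      rintro rfl
      apply (z.out : Kˣ).ne_zero
      simp at hk
    have hmk : (QuotientGroup.mk (Units.mk0 k hk0 ^ 2) : Kˣ ⧸ Subgroup.square Kˣ) = 1 :=
      mk_eq_one_iff_isSquare.2 ⟨k, by rw [Units.val_pow_eq_pow_val, Units.val_mk0, sq]⟩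
    have hout : ∀ x : Kˣ ⧸ Subgroup.square Kˣ, (QuotientGroup.mk x.out : Kˣ ⧸ Subgroup.square Kˣ) = x :=
      fun x => QuotientGroup.out_eq' x
    rw [← hout z]
    rcases hk with h | h | h | h
    · left
      rw [← hmk]
      congr 1
      exact Units.ext h
    · right; left
      have h' : (z.out : Kˣ) = Units.mk0 k hk0 ^ 2 * p.1.out := Units.ext h
      rw [h', QuotientGroup.mk_mul, hmk, one_mul, hout]
    · right; right; left
      have h' : (z.out : Kˣ) = Units.mk0 k hk0 ^ 2 * p.2.out := Units.ext h
      rw [h', QuotientGroup.mk_mul, hmk, one_mul, hout]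
    · right; right; right
      have h' : (z.out : Kˣ) = Units.mk0 k hk0 ^ 2 * (p.1.out * p.2.out) := Units.ext h
      rw [h', QuotientGroup.mk_mul, hmk, one_mul, QuotientGroup.mk_mul, hout, hout]
  · rintro (rfl | rfl | rfl | rfl)
    · exact sqrtRep_mem_of_sq_eq (a := 1) (one_mem (sqrtField Ω p)) (by simp)
    · exact hm1
    · exact hm2
    · have h1 := sqrtRep_mem_of_sq_eq (a := p.1.out * p.2.out) (mul_mem hm1 hm2)
        (by rw [mul_pow, sqrtRep_sq, sqrtRep_sq, ← map_mul, Units.val_mul])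
      rw [QuotientGroup.mk_mul] at h1
      convert h1
      · exact (QuotientGroup.out_eq' p.1).symm
      · exact (QuotientGroup.out_eq' p.2).symm

theorem IsIndependent.sqrtField_eq_iff
    {p q : (Kˣ ⧸ Subgroup.square Kˣ) × (Kˣ ⧸ Subgroup.square Kˣ)} (hp : IsIndependent p)
    (hq : IsIndependent q) : sqrtField Ω q = sqrtField Ω p ↔
      (q.1 = p.1 ∨ q.1 = p.2 ∨ q.1 = p.1 * p.2) ∧ (q.2 = p.1 ∨ q.2 = p.2 ∨ q.2 = p.1 * p.2) := by
  have := hp.finiteDimensional (Ω := Ω)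
  have h1 : sqrtField Ω q = sqrtField Ω p ↔
      sqrtRep Ω q.1 ∈ sqrtField Ω p ∧ sqrtRep Ω q.2 ∈ sqrtField Ω p := by
    constructor
    · intro h
      rw [← h]
      exact ⟨subset_adjoin K _ (by simp), subset_adjoin K _ (by simp)⟩
    · rintro ⟨h1, h2⟩
      refine eq_of_le_of_finrank_eq ?_ (by rw [hp.finrank_eq, hq.finrank_eq])
      rw [sqrtField, adjoin_le_iff]
      rintro x (rfl | rfl)
      · exact h1
      · exact h2
  rw [h1, hp.sqrtRep_mem_iff, hp.sqrtRep_mem_iff, or_iff_right hq.1, or_iff_right hq.2.1]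

open Finset in
-- Pairs generating the same field are the ordered pairs of distinct elements among the three
-- nontrivial classes. The hypothesis `hcl` ensures that all of them belong to `P`.
theorem IsIndependent.card_fiber [Fintype (Kˣ ⧸ Subgroup.square Kˣ)]
    {P : Finset ((Kˣ ⧸ Subgroup.square Kˣ) × (Kˣ ⧸ Subgroup.square Kˣ))}
    [DecidableEq (IntermediateField K Ω)]
    (hP : ∀ p ∈ P, IsIndependent p)
    (hcl : ∀ p ∈ P, ∀ q, IsIndependent q → sqrtField Ω q = sqrtField Ω p → q ∈ P)
    {p : (Kˣ ⧸ Subgroup.square Kˣ) × (Kˣ ⧸ Subgroup.square Kˣ)} (hp : p ∈ P) :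
    #{q ∈ P | sqrtField Ω q = sqrtField Ω p} = 6 := by
  classical
  have hi := hP p hp
  have h1 : {q ∈ P | sqrtField Ω q = sqrtField Ω p} =
      ({p.1, p.2, p.1 * p.2} : Finset (Kˣ ⧸ Subgroup.square Kˣ)).offDiag := by
    ext q
    rw [mem_filter, mem_offDiag]
    simp only [mem_insert, mem_singleton]
    have hne : ∀ z, (z = p.1 ∨ z = p.2 ∨ z = p.1 * p.2) → z ≠ 1 := by
      rintro z (rfl | rfl | rfl)
      · exact hi.1
      · exact hi.2.1
      · rw [Ne, squareClass_mul_eq_one_iff]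
        exact hi.2.2
    constructor
    · rintro ⟨hq, hqp⟩
      have hq' := hP q hq
      obtain ⟨h1, h2⟩ := (hi.sqrtField_eq_iff (Ω := Ω) hq').1 hqp
      exact ⟨h1, h2, hq'.2.2⟩
    · rintro ⟨h1, h2, h3⟩
      have hq' : IsIndependent q := ⟨hne _ h1, hne _ h2, h3⟩
      have h4 := (hi.sqrtField_eq_iff (Ω := Ω) hq').2 ⟨h1, h2⟩
      exact ⟨hcl p hp q hq' h4, h4⟩
  rw [h1, offDiag_card, card_eq_three.2 ⟨p.1, p.2, p.1 * p.2, hi.2.2, ?_, ?_, rfl⟩]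
  · intro h
    exact hi.2.1 (left_eq_mul.1 h)
  · intro h
    exact hi.1 (right_eq_mul.1 h)

open Finset in
theorem card_eq_six_mul_card_image [Fintype (Kˣ ⧸ Subgroup.square Kˣ)]
    {P : Finset ((Kˣ ⧸ Subgroup.square Kˣ) × (Kˣ ⧸ Subgroup.square Kˣ))}
    [DecidableEq (IntermediateField K Ω)]
    (hP : ∀ p ∈ P, IsIndependent p)
    (hcl : ∀ p ∈ P, ∀ q, IsIndependent q → sqrtField Ω q = sqrtField Ω p → q ∈ P) :
    #P = 6 * #(P.image (sqrtField Ω)) := by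
  rw [card_eq_sum_card_image (sqrtField Ω) P, mul_comm, ← smul_eq_mul]
  refine sum_eq_card_nsmul fun L hL => ?_
  obtain ⟨p, hp, rfl⟩ := mem_image.1 hL
  exact IsIndependent.card_fiber hP hcl hp

theorem exists_isIndependent_of_isKleinFour {L : IntermediateField K Ω} [FiniteDimensional K L]
    [IsGalois K L] [IsKleinFour Gal(L/K)] (hL : Module.finrank K L = 4) :
    ∃ p : (Kˣ ⧸ Subgroup.square Kˣ) × (Kˣ ⧸ Subgroup.square Kˣ),
      IsIndependent p ∧ sqrtField Ω p = L := by
  obtain ⟨a, b, α, β, ha, hb, hna, hnb, hnab⟩ := exists_sqrt_generators K L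
  have hp : IsIndependent ((QuotientGroup.mk a, QuotientGroup.mk b) :
      (Kˣ ⧸ Subgroup.square Kˣ) × (Kˣ ⧸ Subgroup.square Kˣ)) := by
    refine ⟨mk_eq_one_iff_isSquare.not.2 hna, mk_eq_one_iff_isSquare.not.2 hnb, ?_⟩
    rw [← Units.val_mul, ← mk_eq_one_iff_isSquare, QuotientGroup.mk_mul,
      squareClass_mul_eq_one_iff] at hnab
    exact hnab
  refine ⟨_, hp, eq_of_le_of_finrank_eq ?_ (by rw [hp.finrank_eq (Ω := Ω), hL])⟩
  have hαL : (α : Ω) ^ 2 = algebraMap K Ω a := congrArg (algebraMap L Ω) ha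
  have hβL : (β : Ω) ^ 2 = algebraMap K Ω b := congrArg (algebraMap L Ω) hb
  rw [sqrtField, adjoin_le_iff]
  rintro x (rfl | rfl)
  · exact sqrtRep_mem_of_sq_eq α.2 hαL
  · exact sqrtRep_mem_of_sq_eq β.2 hβL

end SquareClasses

end TwoAdic

/-! ### Depth on square classes and its distribution -/

namespace TwoAdic

open IsLocalRing IntermediateField

namespace IsDyadic

variable {F : Type*} [Field F] {v : AbsoluteValue F ℝ} {π : F} {e : ℕ} (h : IsDyadic v π e)
include h

theorem square_le_filtration (j : ℕ) : Subgroup.square Fˣ ≤ h.filtration j := by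
  unfold filtration
  split_ifs
  · exact h.square_le_level _
  · exact le_top

/-- The depth of a square class. -/
noncomputable def classDepth (x : Fˣ ⧸ Subgroup.square Fˣ) : ℕ := h.depth x.out

theorem classDepth_mk (a : Fˣ) : h.classDepth (QuotientGroup.mk a) = h.depth a := by
  obtain ⟨⟨b, hb⟩, hb'⟩ := QuotientGroup.mk_out_eq_mul (Subgroup.square Fˣ) a
  refine eq_of_forall_ge_iff fun j => ?_
  rw [classDepth, hb', h.depth_le_iff, h.depth_le_iff]
  exact mul_mem_cancel_right (h.square_le_filtration j hb)

theorem classDepth_mul_le (x y : Fˣ ⧸ Subgroup.square Fˣ) :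
    h.classDepth (x * y) ≤ max (h.classDepth x) (h.classDepth y) := by
  induction x using QuotientGroup.induction_on with | H a => ?_
  induction y using QuotientGroup.induction_on with | H b => ?_
  rw [← QuotientGroup.mk_mul, h.classDepth_mk, h.classDepth_mk, h.classDepth_mk, h.depth_le_iff]
  exact mul_mem (h.depth_le_iff.1 (le_max_left _ _)) (h.depth_le_iff.1 (le_max_right _ _))

theorem classDepth_le (x : Fˣ ⧸ Subgroup.square Fˣ) : h.classDepth x ≤ e + 1 := h.depth_le _

theorem classDepth_one : h.classDepth 1 = 0 := by
  rw [← QuotientGroup.mk_one, h.classDepth_mk, h.depth_eq_zero_iff]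
  exact one_mem _

theorem depth_eq_top_iff {a : Fˣ} : h.depth a = e + 1 ↔ a ∉ h.level 0 := by
  have h1 : h.depth a ≤ e ↔ a ∈ h.level 0 := by
    rw [h.depth_le_iff, filtration, if_pos le_rfl, Nat.sub_self]
  have h2 := h.depth_le a
  rw [← h1]
  omega

/-- Top depth means odd valuation, and a product of two such elements has even valuation. -/
theorem classDepth_mul_le_of_top (x y : Fˣ ⧸ Subgroup.square Fˣ) (hx : h.classDepth x = e + 1)
    (hy : h.classDepth y = e + 1) : h.classDepth (x * y) ≤ e := by
  induction x using QuotientGroup.induction_on with | H a => ?_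
  induction y using QuotientGroup.induction_on with | H b => ?_
  rw [h.classDepth_mk, h.depth_eq_top_iff] at hx hy
  rw [← QuotientGroup.mk_mul, h.classDepth_mk, ← Nat.lt_succ_iff]
  refine lt_of_le_of_ne (h.depth_le _) fun h1 => h.depth_eq_top_iff.1 h1 ?_
  rw [Subgroup.mul_mem_iff_of_index_two h.index_level_zero]
  exact iff_of_false hx hy

section Card

variable {R : Type*} [CommRing R] [IsLocalRing R] [Algebra R F] [Finite (ResidueField R)]
  (hR : ∀ x : F, v x ≤ 1 ↔ x ∈ Set.range (algebraMap R F))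
  (hm : ∀ r : R, r ∈ maximalIdeal R ↔ v (algebraMap R F r) < 1)
  (hinj : Function.Injective (algebraMap R F))
include hR hm hinj

/-- Indices multiply along the filtration: `2` at the bottom, then the residue cardinality at each
of the `j` steps. -/
theorem relIndex_square_level_sub {j : ℕ} (hj : j ≤ e) :
    (Subgroup.square Fˣ).relIndex (h.level (e - j)) = 2 * Nat.card (ResidueField R) ^ j := by
  induction j with
  | zero => rw [pow_zero, mul_one, Nat.sub_zero]; exact h.relIndex_square_level hR hm hinj
  | succ j ih =>
    have h1 : h.level (e - j) ≤ h.level (e - (j + 1)) := h.level_anti (by omega)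
    have h2 := h.relIndex_level_succ hR hm (s := e - (j + 1)) (by omega)
    rw [show e - (j + 1) + 1 = e - j by omega] at h2
    rw [← Subgroup.relIndex_mul_relIndex _ _ _ (h.square_le_level _) h1, ih (by omega), h2,
      pow_succ, mul_assoc]

theorem card_squareClasses :
    Nat.card (Fˣ ⧸ Subgroup.square Fˣ) = 4 * Nat.card (ResidueField R) ^ e := by
  have h1 := h.relIndex_square_level_sub hR hm hinj le_rfl
  rw [Nat.sub_self] at h1
  change (Subgroup.square Fˣ).index = _
  rw [← Subgroup.relIndex_mul_index (h.square_le_level 0), h1, h.index_level_zero]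
  ring

theorem finite_squareClasses : Finite (Fˣ ⧸ Subgroup.square Fˣ) := by
  refine Nat.finite_of_card_ne_zero ?_
  rw [h.card_squareClasses hR hm hinj]
  exact mul_ne_zero four_ne_zero (pow_ne_zero _ Nat.card_pos.ne')

open Finset in
theorem card_classDepth_le [Fintype (Fˣ ⧸ Subgroup.square Fˣ)] {j : ℕ} (hj : j ≤ e) :
    #{x : Fˣ ⧸ Subgroup.square Fˣ | h.classDepth x ≤ j} = 2 * Nat.card (ResidueField R) ^ j := by
  have h1 := Subgroup.relIndex_ker (h.level (e - j)) (QuotientGroup.mk' (Subgroup.square Fˣ))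
  rw [QuotientGroup.ker_mk', h.relIndex_square_level_sub hR hm hinj hj] at h1
  rw [h1]
  refine (Nat.subtype_card _ fun x => ?_).symm
  rw [mem_filter, and_iff_right (mem_univ x), Subgroup.mem_map]
  constructor
  · intro hx
    refine ⟨x.out, ?_, QuotientGroup.out_eq' x⟩
    rw [classDepth, h.depth_le_iff, filtration, if_pos hj] at hx
    exact hx
  · rintro ⟨a, ha, rfl⟩
    rw [QuotientGroup.mk'_apply, h.classDepth_mk, h.depth_le_iff, filtration, if_pos hj]
    exact ha

end Card

end IsDyadic

/-! ### Classification of the extensions by pairs of square classes -/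

section Classification

variable {K : Type*} [Field K] [Algebra ℚ_[2] K] [Algebra ℤ_[2] K] [IsScalarTower ℤ_[2] ℚ_[2] K]
  [FiniteDimensional ℚ_[2] K]

instance isKleinFour_V4 : IsKleinFour V4 where
  card_four := by simp [V4]
  exponent_two := by
    rw [Monoid.exponent_prod, Monoid.exponent_multiplicative, ZMod.exponent]; rfl

/-- A nonsquare of depth zero has an unramified square root, which cannot lie in a totally ramified
extension. -/
theorem depth_ne_zero_of_quartic_uniformizer {ϖ : ringOfIntegers K} (hϖ : Irreducible ϖ)
    {L : IntermediateField K (AlgebraicClosure K)} (h4 : Module.finrank K L = 4)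
    {w : L} (hw : specAbv (AlgebraicClosure K) w ^ 4 =
      specAbv (AlgebraicClosure K) (algebraMap K (AlgebraicClosure K) ϖ))
    {g : Kˣ} (hg : ¬IsSquare (g : K)) {γ : AlgebraicClosure K} (hγ : γ ∈ L)
    (hγg : γ ^ 2 = algebraMap K (AlgebraicClosure K) g) :
    (isDyadic_restrictAbv_specAbv hϖ).depth g ≠ 0 := by
  have := charZero_of_algebra_padic K
  have hv := isNonarchimedean_specAbv (AlgebraicClosure K)
  rw [Ne, IsDyadic.depth_eq_zero_iff]
  intro hlev
  exact hg (isSquare_of_mem_level hv (isDyadic_restrictAbv_specAbv hϖ) (by norm_num) hw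
    (fun x hx => exists_eq_sum_pow hv (isDyadic_restrictAbv_specAbv hϖ) (by norm_num) h4 hw hx)
    hlev hγ hγg)

variable (K) in
/-- Pairs of independent square classes generating a totally ramified extension of discriminant
exponent `m`. -/
noncomputable abbrev discrPairs {ϖ : ringOfIntegers K} (hϖ : Irreducible ϖ)
    [Fintype (Kˣ ⧸ Subgroup.square Kˣ)] (m : ℕ) :
    Finset ((Kˣ ⧸ Subgroup.square Kˣ) × (Kˣ ⧸ Subgroup.square Kˣ)) :=
  weightedPairs (isDyadic_restrictAbv_specAbv hϖ).classDepth
    (discExponent (absRamificationIdx K)) m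

theorem isIndependent_of_mem_discrPairs {ϖ : ringOfIntegers K} (hϖ : Irreducible ϖ)
    [Fintype (Kˣ ⧸ Subgroup.square Kˣ)] {m : ℕ}
    {p : (Kˣ ⧸ Subgroup.square Kˣ) × (Kˣ ⧸ Subgroup.square Kˣ)} (hp : p ∈ discrPairs K hϖ m) :
    IsIndependent p := by
  rw [mem_weightedPairs] at hp
  obtain ⟨h1, h2, h3, -⟩ := hp
  have h0 := (isDyadic_restrictAbv_specAbv hϖ).classDepth_one
  refine ⟨?_, ?_, ?_⟩
  · intro h; rw [h, h0] at h1; omega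
  · intro h; rw [h, h0] at h2; omega
  · intro h; rw [squareClass_mul_eq_one_iff.2 h, h0] at h3; omega

omit [Algebra ℚ_[2] K] [Algebra ℤ_[2] K] [IsScalarTower ℤ_[2] ℚ_[2] K]
  [FiniteDimensional ℚ_[2] K] in
theorem IsIndependent.normal [CharZero K]
    {p : (Kˣ ⧸ Subgroup.square Kˣ) × (Kˣ ⧸ Subgroup.square Kˣ)} :
    Normal K (sqrtField (AlgebraicClosure K) p) :=
  have := isGalois_algebraicClosure (K := K)
  IsBiquadratic.normal_adjoin (sqrtRep_sq p.1) (sqrtRep_sq p.2)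

omit [Algebra ℚ_[2] K] [Algebra ℤ_[2] K] [IsScalarTower ℤ_[2] ℚ_[2] K]
  [FiniteDimensional ℚ_[2] K] in
-- The degree equals `4` only propositionally, so the index type `Fin n` is changed with `n` as a
-- variable.
theorem discr_fin_eq {L : IntermediateField K (AlgebraicClosure K)} (w : L) :
    ∀ n, n = 4 → Algebra.discr K (fun i : Fin n => w ^ (i : ℕ)) =
      Algebra.discr K (fun i : Fin 4 => w ^ (i : ℕ)) := by
  rintro _ rfl
  rfl

omit [Algebra ℚ_[2] K] [Algebra ℤ_[2] K] [IsScalarTower ℤ_[2] ℚ_[2] K]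
  [FiniteDimensional ℚ_[2] K] in
theorem nonempty_galois_mulEquiv [CharZero K]
    {p : (Kˣ ⧸ Subgroup.square Kˣ) × (Kˣ ⧸ Subgroup.square Kˣ)} (hp : IsIndependent p) :
    Nonempty (Gal(normalClosure K (sqrtField (AlgebraicClosure K) p) (AlgebraicClosure K)/K) ≃*
      V4) := by
  have := isGalois_algebraicClosure (K := K)
  have := IsIndependent.normal (p := p)
  -- Quantifying over `N` allows substitution along an equality of fields on which the type of the
  -- Galois group depends.
  have key : ∀ N : IntermediateField K (AlgebraicClosure K),
      N = sqrtField (AlgebraicClosure K) p → Nonempty (Gal(N/K) ≃* V4) := by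
    rintro _ rfl
    obtain ⟨σ, τ, H⟩ := hp.exists_isBiquadratic (Ω := AlgebraicClosure K)
    have h1 : IsKleinFour Gal(sqrtField (AlgebraicClosure K) p/K) := H.isKleinFour
    exact IsKleinFour.nonempty_mulEquiv
  exact key _ (IntermediateField.normalClosure_of_normal _)

/-- This joins arithmetic to counting. Total ramification rules out depth zero for all three
classes; conversely, positive depths produce an element of valuation `1 / 4`. In both directions the
discriminant is computed from such an element. -/
theorem isSigmaExtension_sqrtField_iff {ϖ : ringOfIntegers K} (hϖ : Irreducible ϖ)
    [Fintype (Kˣ ⧸ Subgroup.square Kˣ)] {m : ℕ}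
    {p : (Kˣ ⧸ Subgroup.square Kˣ) × (Kˣ ⧸ Subgroup.square Kˣ)} (hp : IsIndependent p) :
    IsSigmaExtension K V4 m (sqrtField (AlgebraicClosure K) p) ↔ p ∈ discrPairs K hϖ m := by
  have := charZero_of_algebra_padic K
  have := isGalois_algebraicClosure (K := K)
  have := hp.finiteDimensional (Ω := AlgebraicClosure K)
  have hv := isNonarchimedean_specAbv (AlgebraicClosure K)
  have hinv : ∀ (s : Gal(AlgebraicClosure K/K)) (x : AlgebraicClosure K),
    specAbv (AlgebraicClosure K) (s x) = specAbv (AlgebraicClosure K) x := fun s x => specAbv_aut s x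
  have h := isDyadic_restrictAbv_specAbv hϖ
  have h4 := hp.finrank_eq (Ω := AlgebraicClosure K)
  obtain ⟨σ, τ, H⟩ := hp.exists_isBiquadratic (Ω := AlgebraicClosure K)
  have hdepth : h.classDepth (p.1 * p.2) = h.depth (p.1.out * p.2.out) := by
    rw [← h.classDepth_mk, QuotientGroup.mk_mul]
    congr 2
    · exact (QuotientGroup.out_eq' p.1).symm
    · exact (QuotientGroup.out_eq' p.2).symm
  rw [mem_weightedPairs, hdepth]
  change _ ↔ 1 ≤ h.depth p.1.out ∧ 1 ≤ h.depth p.2.out ∧ 1 ≤ h.depth (p.1.out * p.2.out) ∧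
    discExponent _ (h.depth p.1.out) + discExponent _ (h.depth p.2.out) +
      discExponent _ (h.depth (p.1.out * p.2.out)) = m
  have hm1 : sqrtRep (AlgebraicClosure K) p.1 ∈ sqrtField (AlgebraicClosure K) p :=
    subset_adjoin K _ (by simp)
  have hm2 : sqrtRep (AlgebraicClosure K) p.2 ∈ sqrtField (AlgebraicClosure K) p :=
    subset_adjoin K _ (by simp)
  obtain ⟨hn1, hn2, hn3⟩ := hp.not_isSquare_mul
  have hdiscr : ∀ {w : sqrtField (AlgebraicClosure K) p},
      specAbv (AlgebraicClosure K) w ^ 4 =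
        specAbv (AlgebraicClosure K) (algebraMap K (AlgebraicClosure K) ϖ) →
      h.depth p.1.out ≠ 0 → h.depth p.2.out ≠ 0 → h.depth (p.1.out * p.2.out) ≠ 0 →
      discrValuation K (sqrtField (AlgebraicClosure K) p) =
        ((discExponent (absRamificationIdx K) (h.depth p.1.out) +
          discExponent (absRamificationIdx K) (h.depth p.2.out) +
          discExponent (absRamificationIdx K) (h.depth (p.1.out * p.2.out)) : ℕ) : ℕ∞) := by
    intro w hw ha hb hab
    refine discrValuation_eq hϖ (w := w) (by rw [h4, hw]) ?_
    rw [discr_fin_eq w _ h4]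
    exact H.abv_discr hv h hinv ha hb hab hw
  constructor
  · intro hS
    obtain ⟨w, hw⟩ := (isTotallyRamified_iff hϖ).1 hS.isTotallyRamified
    rw [h4] at hw
    have ha := depth_ne_zero_of_quartic_uniformizer hϖ h4 hw hn1 hm1 (sqrtRep_sq p.1)
    have hb := depth_ne_zero_of_quartic_uniformizer hϖ h4 hw hn2 hm2 (sqrtRep_sq p.2)
    have hab := depth_ne_zero_of_quartic_uniformizer hϖ h4 hw (g := p.1.out * p.2.out)
      (by rwa [Units.val_mul]) (mul_mem hm1 hm2)
      (by rw [mul_pow, sqrtRep_sq, sqrtRep_sq, ← map_mul, Units.val_mul])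
    refine ⟨Nat.one_le_iff_ne_zero.2 ha, Nat.one_le_iff_ne_zero.2 hb,
      Nat.one_le_iff_ne_zero.2 hab, ?_⟩
    have h5 := hdiscr hw ha hb hab
    rw [hS.discrValuation_eq] at h5
    exact_mod_cast h5.symm
  · rintro ⟨ha, hb, hab, rfl⟩
    rw [Nat.one_le_iff_ne_zero] at ha hb hab
    obtain ⟨w, hwL, hw⟩ := exists_quartic_uniformizer hv h hinv H.sq_left H.sq_right
      (h.depth_eq_zero_iff.not.1 ha) (h.depth_eq_zero_iff.not.1 hb) (h.depth_eq_zero_iff.not.1 hab)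
    exact
      { finrank_eq := h4
        isTotallyRamified := (isTotallyRamified_iff hϖ).2 ⟨⟨w, hwL⟩, by rw [h4]; exact hw⟩
        discrValuation_eq := hdiscr (w := ⟨w, hwL⟩) hw ha hb hab
        galoisClosureGroup := nonempty_galois_mulEquiv hp }

/-- The normal closure has degree `4`, the order of its group, so it coincides with `L`, and Kummer
theory applies. -/
theorem exists_isIndependent_of_isSigmaExtension {m : ℕ}
    {L : IntermediateField K (AlgebraicClosure K)} (hL : IsSigmaExtension K V4 m L) :
    ∃ p, IsIndependent p ∧ sqrtField (AlgebraicClosure K) p = L := by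
  have := charZero_of_algebra_padic K
  have := isGalois_algebraicClosure (K := K)
  have hfin : FiniteDimensional K L := Module.finite_of_finrank_pos (by rw [hL.finrank_eq]; norm_num)
  obtain ⟨f⟩ := hL.galoisClosureGroup
  have hgal : IsGalois K (normalClosure K L (AlgebraicClosure K)) := { }
  have hcard : Module.finrank K (normalClosure K L (AlgebraicClosure K)) = 4 := by
    rw [← IsGalois.card_aut_eq_finrank, Nat.card_congr f.toEquiv]
    exact IsKleinFour.card_four
  have hLN : L = normalClosure K L (AlgebraicClosure K) :=
    eq_of_le_of_finrank_eq (IntermediateField.le_normalClosure L) (by rw [hcard, hL.finrank_eq])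
  have hK : IsKleinFour Gal(normalClosure K L (AlgebraicClosure K)/K) :=
    { card_four := by rw [Nat.card_congr f.toEquiv]; exact IsKleinFour.card_four
      exponent_two := by
        rw [Monoid.exponent_eq_of_mulEquiv f]; exact IsKleinFour.exponent_two }
  obtain ⟨p, hp, hpL⟩ := exists_isIndependent_of_isKleinFour hcard
  exact ⟨p, hp, hpL.trans hLN.symm⟩

open Classical in
theorem setOf_isSigmaExtension_eq {ϖ : ringOfIntegers K} (hϖ : Irreducible ϖ)
    [Fintype (Kˣ ⧸ Subgroup.square Kˣ)] (m : ℕ) :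
    {L | IsSigmaExtension K V4 m L} =
      ((discrPairs K hϖ m).image (sqrtField (AlgebraicClosure K)) : Set _) := by
  ext L
  rw [Finset.coe_image]
  constructor
  · intro hL
    obtain ⟨p, hp, rfl⟩ := exists_isIndependent_of_isSigmaExtension hL
    exact ⟨p, (isSigmaExtension_sqrtField_iff hϖ hp).1 hL, rfl⟩
  · rintro ⟨p, hp, rfl⟩
    exact (isSigmaExtension_sqrtField_iff hϖ (isIndependent_of_mem_discrPairs hϖ hp)).2 hp

/-- These fields are normal, so a `K`-isomorphic subfield of the algebraic closure is the same
subfield. Counting classes is counting subfields. -/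
theorem injOn_mk_isSigmaExtension (m : ℕ) :
    Set.InjOn (Quotient.mk (extensionSetoid K)) {L | IsSigmaExtension K V4 m L} := by
  intro L hL L' _ hLL'
  have := charZero_of_algebra_padic K
  obtain ⟨p, hp, rfl⟩ := exists_isIndependent_of_isSigmaExtension hL
  have := IsIndependent.normal (p := p)
  obtain ⟨f⟩ := Quotient.exact hLL'
  rw [← AlgHom.fieldRange_of_normal (E := sqrtField (AlgebraicClosure K) p)
    (L'.val.comp (f : _ →ₐ[K] L'))]
  ext x
  rw [AlgHom.mem_fieldRange]
  constructor
  · rintro ⟨y, rfl⟩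
    exact (f y).2
  · intro hx
    exact ⟨f.symm ⟨x, hx⟩, by simp⟩

open Finset in
theorem card_discrPairs {ϖ : ringOfIntegers K} (hϖ : Irreducible ϖ)
    [Fintype (Kˣ ⧸ Subgroup.square Kˣ)] (m : ℕ) :
    #(discrPairs K hϖ m) = 6 * (SigmaSet K V4 m).ncard := by
  classical
  have := charZero_of_algebra_padic K
  have := isGalois_algebraicClosure (K := K)
  rw [SigmaSet, (injOn_mk_isSigmaExtension m).ncard_image,
    setOf_isSigmaExtension_eq hϖ, Set.ncard_coe_finset]
  refine card_eq_six_mul_card_image (fun p hp => isIndependent_of_mem_discrPairs hϖ hp) ?_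
  intro p hp q hq hqp
  rw [← isSigmaExtension_sqrtField_iff hϖ hq, hqp,
    isSigmaExtension_sqrtField_iff hϖ (isIndependent_of_mem_discrPairs hϖ hp)]
  exact hp

theorem finite_sigmaSet {ϖ : ringOfIntegers K} (hϖ : Irreducible ϖ)
    [Fintype (Kˣ ⧸ Subgroup.square Kˣ)] (m : ℕ) : (SigmaSet K V4 m).Finite := by
  classical
  rw [SigmaSet, setOf_isSigmaExtension_eq hϖ]
  exact (Finset.finite_toSet _).image _

end Classification

end TwoAdic

theorem mainTheorem5 (K : Type*) [Field K] [Algebra ℚ_[2] K] [FiniteDimensional ℚ_[2] K]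
    [Algebra ℤ_[2] K] [IsScalarTower ℤ_[2] ℚ_[2] K] (m : ℕ) :
    ((TwoAdic.SigmaSet K TwoAdic.V4 m).Nonempty →
      Even m ∧ 6 ≤ m ∧ m ≤ 6 * TwoAdic.absRamificationIdx K + 2) ∧
    (Even m → 6 ≤ m → m ≤ 6 * TwoAdic.absRamificationIdx K + 2 →
      (TwoAdic.SigmaSet K TwoAdic.V4 m).Finite ∧
      ((TwoAdic.SigmaSet K TwoAdic.V4 m).ncard : ℚ) =
        2 * ((TwoAdic.residueCard K : ℚ) - 1) * (TwoAdic.residueCard K : ℚ) ^ ((m - 4) / 2) *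
          ((TwoAdic.residueCard K : ℚ) ^ (-⌊(m : ℚ) / 6⌋) *
              (1 + (if 3 ∣ m then 1 else 0) * (((TwoAdic.residueCard K : ℚ) - 2) / 3)) -
            (if m ≤ 4 * TwoAdic.absRamificationIdx K + 2 then 1 else 0) *
              (TwoAdic.residueCard K : ℚ) ^ (-⌊((m : ℚ) - 2) / 4⌋))) := by
  classical
  obtain ⟨ϖ, hϖ⟩ := IsDiscreteValuationRing.exists_irreducible (TwoAdic.ringOfIntegers K)
  have h := TwoAdic.isDyadic_restrictAbv_specAbv hϖ
  have hR : ∀ x : K, TwoAdic.restrictAbv (TwoAdic.specAbv (AlgebraicClosure K)) K x ≤ 1 ↔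
      x ∈ Set.range (algebraMap (TwoAdic.ringOfIntegers K) K) := by
    rw [TwoAdic.restrictAbv_specAbv]
    exact TwoAdic.specAbv_le_one_iff_mem_range
  have hm : ∀ r : TwoAdic.ringOfIntegers K,
      r ∈ IsLocalRing.maximalIdeal (TwoAdic.ringOfIntegers K) ↔
        TwoAdic.restrictAbv (TwoAdic.specAbv (AlgebraicClosure K)) K
          (algebraMap (TwoAdic.ringOfIntegers K) K r) < 1 := by
    rw [TwoAdic.restrictAbv_specAbv]
    exact TwoAdic.mem_maximalIdeal_iff_specAbv
  have hinj : Function.Injective (algebraMap (TwoAdic.ringOfIntegers K) K) :=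
    FaithfulSMul.algebraMap_injective _ _
  have := h.finite_squareClasses hR hm hinj
  have : Fintype (Kˣ ⧸ Subgroup.square Kˣ) := Fintype.ofFinite _
  have hq : (TwoAdic.residueCard K : ℚ) ≠ 0 := Nat.cast_ne_zero.2 Nat.card_pos.ne'
  refine ⟨?_, ?_⟩
  · rintro ⟨_, L, hL, -⟩
    have hL' : L ∈ {L | TwoAdic.IsSigmaExtension K TwoAdic.V4 m L} := hL
    rw [TwoAdic.setOf_isSigmaExtension_eq hϖ, Finset.coe_image] at hL'
    obtain ⟨p, hp, -⟩ := hL'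
    exact TwoAdic.even_of_mem_weightedPairs h.classDepth_mul_le TwoAdic.squareClass_mul_self
      h.classDepth_le h.classDepth_mul_le_of_top h.pos hp
  · rintro ⟨M, hM⟩ h6 hle
    -- The count is carried out in terms of half the discriminant exponent.
    obtain rfl : m = 2 * M := by omega
    refine ⟨TwoAdic.finite_sigmaSet hϖ _, ?_⟩
    have key := TwoAdic.cast_card_weightedPairs h.classDepth_mul_le TwoAdic.squareClass_mul_self
      h.classDepth_le hq
      (fun j hj => by rw [h.card_classDepth_le hR hm hinj hj]; push_cast; rfl)
      (by rw [← Nat.card_eq_fintype_card, h.card_squareClasses hR hm hinj]; push_cast; rfl)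
      (M := M) (by omega) (by omega)
    have hcard := TwoAdic.card_discrPairs hϖ (2 * M)
    rw [TwoAdic.discrPairs] at hcard
    rw [hcard, Nat.cast_mul, Nat.cast_ofNat] at key
    -- Both expressions for the number of pairs carry the factor `6`; cancelling it leaves the
    -- number of fields.
    rw [mul_left_cancel₀ (by norm_num) key]
    have hf1 : ⌊((2 * M : ℕ) : ℚ) / 6⌋ = ((M / 3 : ℕ) : ℤ) := by
      have := Rat.floor_natCast_div_natCast (2 * M) 6
      rw [Nat.cast_ofNat] at this
      rw [this]
      omega
    have hf2 : ⌊(((2 * M : ℕ) : ℚ) - 2) / 4⌋ = (((M - 1) / 2 : ℕ) : ℤ) := by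
      have := Rat.floor_natCast_div_natCast (2 * M - 2) 4
      rw [Nat.cast_ofNat, Nat.cast_sub (by omega), Nat.cast_ofNat] at this
      rw [this]
      omega
    -- The truncated subtraction is harmless because `2 * M ≥ 6`.
    have hpow : (TwoAdic.residueCard K : ℚ) ^ ((2 * M - 4) / 2) =
        (TwoAdic.residueCard K : ℚ) ^ ((M : ℤ) - 2) := by
      rw [← zpow_natCast]
      congr 1
      omega
    have h3 : (3 ∣ 2 * M) ↔ 3 ∣ M := by omega
    have h5 : (2 * M ≤ 4 * TwoAdic.absRamificationIdx K + 2) ↔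
        M ≤ 2 * TwoAdic.absRamificationIdx K + 1 := by omega
    rw [hf1, hf2, hpow]
    simp only [h3, h5]
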